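/- Let $P>0$ and $V:\mathbb R\to\mathbb R$. Let $\mu_V$ be the equilibrium measure, i.e. the minimizer over probability measures $\mu$ on $\mathbb R$ of the energy $$\mathcal E(\mu)=\int\Big(V+\ln\frac{d\mu}{dx}\Big)d\mu-P\iint\ln|x-y|\,d\mu(x)\,d\mu(y)\quad(\mu\ll dx),\qquad \mathcal E(\mu)=+\infty\ \text{otherwise},$$ and let $\rho_V$ be its density. Assume: (i) $V\in C^3(\mathbb R)$, $V(x)\to+\infty$ and $|V'(x)|\to+\infty$ as $|x|\to\infty$, and $\mu_V$ satisfies a Poincaré inequality: for some $C>0$, $\mathrm{Var}_{\mu_V}(f)\le C\int|f'|^2d\mu_V$ for all $f\in C^1_c(\mathbb R)$; (ii) for every real polynomial $Q$ and every $\alpha>0$, $Q(V'(x))e^{-V(x)}=o(|x|^{-\alpha})$ as $|x|\to\infty$; (iii) $V'(x_N)^{-2}\sup_{a\le x\le b}|V''(x_N+x)|\to0$ for every real sequence with $|x_N|\to\infty$ and all $a<b$; (iv) $V'^{-2}$ is integrable at infinity, and $V''/V'$ and $V'''/V'$ are $O(1)$ as $|x|\to\infty$. Let $\mathsf H=\{u\in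 L^2(\mu_V): u'\in L^2(\mu_V),\ \int u\,d\mu_V=0\}$ (real functions, weak derivatives), with $\langle u,v\rangle_{\mathsf H}=\int u'v'\,d\mu_V$. Let $$\mathcal H[\phi](x)=\int_0^\infty\frac{\phi(x+t)-\phi(x-t)}{t}\,dt\quad\text{(extended from Schwartz functions to }L^2(\mathbb R)),\qquad \mathcal F[f](\xi)=\int f(t)e^{-it\xi}dt,$$ $$\mathcal A[u]=-\frac{(u'\rho_V)'}{\rho_V},\qquad \mathcal W[u]=-\mathcal H[u'\rho_V]+\int\mathcal H[u'\rho_V]\,d\mu_V,$$ $$\Xi[\phi](x)=2P\int\frac{\phi(x)-\phi(y)}{x-y}d\mu_V(y)+\phi'(x)-V'(x)\phi(x)-2P\int\mathcal H[\phi\rho_V]\,d\mu_V.$$ On $Q(\mathcal L)=\{u\in\mathsf H:\mathcal A[u]\in L^2(\mu_V),\ \mathcal F[u'\rho_V]\in L^2(|\xi|d\xi)\}$ put $$q(u,v)=\langle\mathcal A[u],\mathcal A[v]\rangle_{L^2(\mu_V)}+P\langle\mathcal F[u'\rho_V],\mathcal F[v'\rho_V]\rangle_{L^2(|\xi|d\xi)},$$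 let $\mathcal D(\mathcal L)$ be the set of $v\in Q(\mathcal L)$ for which $\varphi\mapsto q(\varphi,v)$ extends from $Q(\mathcal L)$ to a continuous linear functional on $\mathsf H$, and for $v\in\mathcal D(\mathcal L)$ let $-\mathcal L[v]\in\mathsf H$ be defined by $q(\varphi,v)=\langle\varphi,-\mathcal L[v]\rangle_{\mathsf H}$ for all $\varphi\in Q(\mathcal L)$. Then $\mathsf H$ is a Hilbert space, and $-\mathcal L$ is well defined on $\mathcal D(\mathcal L)$. One has $-\mathcal L[v]=\mathcal A[v]+2P\,\mathcal W[v]$ for all $v\in\mathcal D(\mathcal L)$, and every $\phi\in C_c^\infty(\mathbb R)$ with $\int\phi\,d\mu_V=0$ lies in $\mathcal D(\mathcal L)$ with $\mathcal L[\phi]=\Xi[\phi']$. Moreover: - $-\mathcal L:\mathcal D(\mathcal L)\to\mathsf H$ is bijective; - $\mathcal A$, acting on the functions $u \in \mathsf H$ with $\mathcal A[u]\in L^2(\mu_V)$, has a smallest eigenvalue $\lambda_1(\mathcal A)$, and $\lambda_1(\mathcal A)>0$; - $(-\mathcal L)^{-1}$ is a continuous operator on $\mathsf H$ for $\|\cdot\|_{\mathsf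 H}$, symmetric and positive ($\langle(-\mathcal L)^{-1}f,f\rangle_{\mathsf H}>0$ for $f\ne0$), and for all $f\in\mathsf H$ $$\|\mathcal L^{-1}[f]\|_{\mathsf H}\le\lambda_1(\mathcal A)^{-1}\|f\|_{\mathsf H}.$$ -/

import Mathlib

open MeasureTheory Filter Topology Asymptotics
open scoped ContDiff SchwartzMap

namespace BetaEnsemble

noncomputable section

/-! ### The equilibrium measure and the assumptions on the potential -/

/-- The Lebesgue density of `μ`. -/
def density (μ : Measure ℝ) (x : ℝ) : ℝ := (μ.rnDeriv volume x).toReal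

open Classical in
/-- The energy functional
`∫ (V + log (dμ/dx)) dμ - P ∬ log |x - y| dμ(x) dμ(y)` on probability measures, with the value
`+∞` if `μ` is not absolutely continuous or if the integrals do not converge.
(When `V` grows superlinearly, the negative part of `V + log (dμ/dx)` is always `μ`-integrable,
and `log |x - y|` is integrable as soon as `V + log (dμ/dx)` is; so the second case is exactly the
case where the energy is infinite.) -/
def energy (V : ℝ → ℝ) (P : ℝ) (μ : Measure ℝ) : EReal :=
  if μ ≪ volume ∧ Integrable (fun x => V x + Real.log (density μ x)) μ ∧
      Integrable (fun z : ℝ × ℝ => Real.log |z.1 - z.2|) (μ.prod μ) then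
    (((∫ x, (V x + Real.log (density μ x)) ∂μ)
      - P * ∫ z : ℝ × ℝ, Real.log |z.1 - z.2| ∂(μ.prod μ) : ℝ) : EReal)
  else ⊤

/-- `μ` minimizes the energy among all probability measures on `ℝ`. -/
def IsEquilibriumMeasure (V : ℝ → ℝ) (P : ℝ) (μ : Measure ℝ) : Prop :=
  IsProbabilityMeasure μ ∧
    ∀ ν : Measure ℝ, IsProbabilityMeasure ν → energy V P μ ≤ energy V P ν

/-- The Poincaré inequality for `μ`, on compactly supported `C¹` functions. -/
def Poincare (μ : Measure ℝ) : Prop :=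
  ∃ C : ℝ, 0 < C ∧ ∀ f : ℝ → ℝ, ContDiff ℝ 1 f → HasCompactSupport f →
    ∫ x, (f x - ∫ y, f y ∂μ) ^ 2 ∂μ ≤ C * ∫ x, (deriv f x) ^ 2 ∂μ

/-- The standing assumptions on the potential `V`, whose equilibrium measure is `μ`.
The filter `cocompact ℝ` expresses `|x| → ∞`. -/
structure PotentialAssumptions (V : ℝ → ℝ) (μ : Measure ℝ) : Prop where
  contDiff : ContDiff ℝ 3 V
  tendsto_V : Tendsto V (cocompact ℝ) atTop
  tendsto_V' : Tendsto (fun x => |deriv V x|) (cocompact ℝ) atTop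
  poincare : Poincare μ
  decay : ∀ (Q : Polynomial ℝ) (α : ℝ), 0 < α →
    (fun x => Q.eval (deriv V x) * Real.exp (-V x)) =o[cocompact ℝ] fun x => |x| ^ (-α)
  local_bound : ∀ x : ℕ → ℝ, Tendsto (fun N => |x N|) atTop atTop → ∀ a b : ℝ, a < b →
    Tendsto (fun N => 1 / (deriv V (x N)) ^ 2 *
      sSup ((fun y => |iteratedDeriv 2 V (x N + y)|) '' Set.Icc a b)) atTop (𝓝 0)
  integrable_inv_sq : IntegrableAtFilter (fun x => ((deriv V x) ^ 2)⁻¹) (cocompact ℝ) volume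
  second_bound : (fun x => iteratedDeriv 2 V x / deriv V x) =O[cocompact ℝ] fun _ => (1 : ℝ)
  third_bound : (fun x => iteratedDeriv 3 V x / deriv V x) =O[cocompact ℝ] fun _ => (1 : ℝ)

/-! ### Weak derivatives, Hilbert transform, Fourier transform -/

/-- `g` is the weak (distributional) derivative of `f` on `ℝ`. -/
def HasWeakDeriv (f g : ℝ → ℝ) : Prop :=
  LocallyIntegrable f volume ∧ LocallyIntegrable g volume ∧
    ∀ ψ : ℝ → ℝ, ContDiff ℝ ∞ ψ → HasCompactSupport ψ →
      ∫ x, f x * deriv ψ x = -∫ x, g x * ψ x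

open Classical in
/-- The weak derivative, unique up to Lebesgue-null sets (and `0` if there is none). -/
def weakDeriv (f : ℝ → ℝ) : ℝ → ℝ :=
  if h : ∃ g, HasWeakDeriv f g then h.choose else 0

/-- The Hilbert transform `∫_0^∞ (φ(x+t) - φ(x-t)) / t dt` of a Schwartz function; this is the
principal value of `∫ φ(t) / (t - x) dt`. -/
def hilbertSchwartz (φ : 𝓢(ℝ, ℝ)) (x : ℝ) : ℝ :=
  ∫ t in Set.Ioi (0 : ℝ), (φ (x + t) - φ (x - t)) / t

/-- `g` is the Hilbert transform of `f ∈ L²(ℝ)`: the continuous extension to `L²` of the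
transform of Schwartz functions. -/
def IsHilbertTransform (f g : ℝ → ℝ) : Prop :=
  MemLp f 2 volume ∧ MemLp g 2 volume ∧ ∃ φ : ℕ → 𝓢(ℝ, ℝ),
    Tendsto (fun n => eLpNorm (fun x => φ n x - f x) 2 volume) atTop (𝓝 0) ∧
    Tendsto (fun n => eLpNorm (fun x => hilbertSchwartz (φ n) x - g x) 2 volume) atTop (𝓝 0)

open Classical in
/-- The Hilbert transform on `L²(ℝ)`, defined up to Lebesgue-null sets. -/
def hilbert (f : ℝ → ℝ) : ℝ → ℝ :=
  if h : ∃ g, IsHilbertTransform f g then h.choose else 0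

/-- The Fourier transform `ξ ↦ ∫ f(t) e^{-itξ} dt` of an integrable function. -/
def fourierInt (f : ℝ → ℝ) (ξ : ℝ) : ℂ :=
  ∫ t, (f t : ℂ) * Complex.exp (-(Complex.I * t * ξ))

/-- The master operator `Ξ`. -/
def masterOp (V : ℝ → ℝ) (P : ℝ) (μ : Measure ℝ) (φ : ℝ → ℝ) (x : ℝ) : ℝ :=
  2 * P * (∫ y, (φ x - φ y) / (x - y) ∂μ) + deriv φ x - deriv V x * φ x
    - 2 * P * ∫ y, hilbert (fun t => φ t * density μ t) y ∂μ

/-! ### The Hilbert space `H` -/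

lemma HasWeakDeriv.zero : HasWeakDeriv 0 0 :=
  ⟨locallyIntegrable_zero, locallyIntegrable_zero, by simp⟩

lemma integrable_mul_test {f ψ : ℝ → ℝ} (hf : LocallyIntegrable f volume)
    (hψ : Continuous ψ) (hc : HasCompactSupport ψ) : Integrable (fun x => f x * ψ x) volume := by
  simpa [mul_comm] using hf.integrable_smul_left_of_hasCompactSupport hψ hc

lemma HasWeakDeriv.add {f g f' g' : ℝ → ℝ} (h : HasWeakDeriv f f') (k : HasWeakDeriv g g') :
    HasWeakDeriv (f + g) (f' + g') := by
  refine ⟨h.1.add k.1, h.2.1.add k.2.1, fun ψ hψ hc => ?_⟩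
  have hd : Continuous (deriv ψ) := hψ.continuous_deriv (by simp)
  simp only [Pi.add_apply, add_mul]
  rw [integral_add (integrable_mul_test h.1 hd hc.deriv)
      (integrable_mul_test k.1 hd hc.deriv),
    integral_add (integrable_mul_test h.2.1 hψ.continuous hc)
      (integrable_mul_test k.2.1 hψ.continuous hc),
    h.2.2 ψ hψ hc, k.2.2 ψ hψ hc]
  ring

lemma HasWeakDeriv.smul {f f' : ℝ → ℝ} (c : ℝ) (h : HasWeakDeriv f f') :
    HasWeakDeriv (c • f) (c • f') := by
  refine ⟨h.1.smul c, h.2.1.smul c, fun ψ hψ hc => ?_⟩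
  simp only [Pi.smul_apply, smul_eq_mul, mul_assoc, integral_const_mul]
  rw [h.2.2 ψ hψ hc]
  ring

variable (μ : Measure ℝ) [IsProbabilityMeasure μ]

/-- The pairs `(u, u')` in `L²(μ) × L²(μ)` such that `u'` is the weak derivative of `u` and
`∫ u dμ = 0`. -/
def HSubmodule : Submodule ℝ (Lp ℝ 2 μ × Lp ℝ 2 μ) where
  carrier := {p | (∃ f g : ℝ → ℝ, f =ᵐ[μ] p.1 ∧ g =ᵐ[μ] p.2 ∧ HasWeakDeriv f g) ∧
    ∫ x, p.1 x ∂μ = 0}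
  zero_mem' := by
    refine ⟨⟨0, 0, (Lp.coeFn_zero ℝ 2 μ).symm, (Lp.coeFn_zero ℝ 2 μ).symm, .zero⟩, ?_⟩
    rw [show (0 : Lp ℝ 2 μ × Lp ℝ 2 μ).1 = 0 from rfl, integral_congr_ae (Lp.coeFn_zero ℝ 2 μ)]
    simp
  add_mem' := by
    rintro p q ⟨⟨f, g, hf, hg, h⟩, hp⟩ ⟨⟨f', g', hf', hg', h'⟩, hq⟩
    refine ⟨⟨f + f', g + g', (hf.add hf').trans (Lp.coeFn_add p.1 q.1).symm,
      (hg.add hg').trans (Lp.coeFn_add p.2 q.2).symm, h.add h'⟩, ?_⟩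
    rw [show (p + q).1 = p.1 + q.1 from rfl, integral_congr_ae (Lp.coeFn_add p.1 q.1)]
    simp only [Pi.add_apply]
    rw [integral_add ((Lp.memLp p.1).integrable (by norm_num))
      ((Lp.memLp q.1).integrable (by norm_num)), hp, hq, add_zero]
  smul_mem' := by
    rintro c p ⟨⟨f, g, hf, hg, h⟩, hp⟩
    refine ⟨⟨c • f, c • g, (hf.const_smul c).trans (Lp.coeFn_smul c p.1).symm,
      (hg.const_smul c).trans (Lp.coeFn_smul c p.2).symm, h.smul c⟩, ?_⟩
    rw [show (c • p).1 = c • p.1 from rfl, integral_congr_ae (Lp.coeFn_smul c p.1)]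
    simp only [Pi.smul_apply, smul_eq_mul, integral_const_mul, hp, mul_zero]

/-- The space `H = {u ∈ L²(μ) | u' ∈ L²(μ), ∫ u dμ = 0}`. An element carries its weak derivative,
which `u` determines when the density of `μ` is positive. It does not carry the product norm but
the inner product `⟨u, v⟩ = ∫ u' v' dμ` below. -/
def HSpace : Type := HSubmodule μ

instance : AddCommGroup (HSpace μ) := inferInstanceAs (AddCommGroup (HSubmodule μ))

instance : Module ℝ (HSpace μ) := inferInstanceAs (Module ℝ (HSubmodule μ))

variable {μ}

/-- The element `u ∈ H`, as a function class in `L²(μ)`. -/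
def HSpace.fn (u : HSpace μ) : Lp ℝ 2 μ := u.1.1

variable (μ) in
/-- The weak derivative `u ↦ u'` as a linear map from `H` to `L²(μ)`. -/
def HSpace.dₗ : HSpace μ →ₗ[ℝ] Lp ℝ 2 μ where
  toFun u := u.1.2
  map_add' _ _ := rfl
  map_smul' _ _ := rfl

/-- The weak derivative `u'` of `u ∈ H`. -/
def HSpace.d (u : HSpace μ) : Lp ℝ 2 μ := HSpace.dₗ μ u

/-- `‖u‖_H = ‖u'‖_{L²(μ)}`. -/
instance : SeminormedAddCommGroup (HSpace μ) :=
  SeminormedAddCommGroup.induced (HSpace μ) (Lp ℝ 2 μ) (HSpace.dₗ μ)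

/-- `⟨u, v⟩_H = ⟨u', v'⟩_{L²(μ)}`. -/
instance : InnerProductSpace ℝ (HSpace μ) where
  norm_smul_le c u := by
    change ‖HSpace.dₗ μ (c • u)‖ ≤ ‖c‖ * ‖HSpace.dₗ μ u‖
    rw [map_smul, norm_smul]
  inner u v := inner ℝ u.d v.d
  norm_sq_eq_re_inner u := norm_sq_eq_re_inner (𝕜 := ℝ) u.d
  conj_inner_symm u v := inner_conj_symm u.d v.d
  add_left u v w := by
    change inner ℝ (HSpace.dₗ μ (u + v)) w.d = _
    rw [map_add, inner_add_left]
    rfl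
  smul_left u v c := by
    change inner ℝ (HSpace.dₗ μ (c • u)) v.d = _
    rw [map_smul, inner_smul_left]
    rfl

/-! ### The operators `A`, `W` and the Friedrichs operator `-L` -/

/-- The function `u' ρ`, where `ρ` is the density of `μ`. -/
def HSpace.flux (u : HSpace μ) (x : ℝ) : ℝ := u.d x * density μ x

/-- `A[u] = -(u' ρ)' / ρ`, the outer derivative being weak. -/
def opA (u : HSpace μ) (x : ℝ) : ℝ := -weakDeriv u.flux x / density μ x

/-- `W[u] = -ℋ[u' ρ] + ∫ ℋ[u' ρ] dμ`. -/
def opW (u : HSpace μ) (x : ℝ) : ℝ := -hilbert u.flux x + ∫ y, hilbert u.flux y ∂μ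

variable (μ) in
/-- The form domain `Q(L)`: all `u ∈ H` with `A[u] ∈ L²(μ)` and `ℱ[u' ρ] ∈ L²(|ξ| dξ)`. -/
def formDomain : Set (HSpace μ) :=
  {u | ((∃ g, HasWeakDeriv u.flux g) ∧ MemLp (opA u) 2 μ) ∧
    Integrable (fun ξ => |ξ| * ‖fourierInt u.flux ξ‖ ^ 2) volume}

/-- The form `q(u, v) = ⟨A[u], A[v]⟩_{L²(μ)} + P ⟨ℱ[u' ρ], ℱ[v' ρ]⟩_{L²(|ξ| dξ)}`; for real
functions the last integral is real. -/
def formL (P : ℝ) (u v : HSpace μ) : ℝ :=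
  (∫ x, opA u x * opA v x ∂μ) +
    P * (∫ ξ : ℝ, ((|ξ| : ℝ) : ℂ) * (fourierInt u.flux ξ * starRingEnd ℂ (fourierInt v.flux ξ))).re

variable (μ) in
/-- The domain `D(L)`: all `v ∈ Q(L)` such that `φ ↦ q(φ, v)` extends from `Q(L)` to a continuous
linear functional on `H`. -/
def domL (P : ℝ) : Set (HSpace μ) :=
  {v | v ∈ formDomain μ ∧ ∃ ℓ : HSpace μ →L[ℝ] ℝ, ∀ φ ∈ formDomain μ, ℓ φ = formL P φ v}

/-- The Friedrichs operator: `-L[v]` is the element `f ∈ H` such that `q(φ, v) = ⟨φ, f⟩_H` for all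
`φ ∈ Q(L)`. -/
def negL (P : ℝ) (v : domL μ P) : HSpace μ :=
  Classical.epsilon fun f => ∀ φ ∈ formDomain μ, formL P φ v = inner ℝ φ f

variable (μ) in
/-- The eigenvalues of `A` on mean-zero functions. -/
def eigenvaluesA : Set ℝ :=
  {l | ∃ φ ∈ formDomain μ, φ ≠ 0 ∧ opA φ =ᵐ[μ] fun x => l * φ.fn x}

end

end BetaEnsemble

open BetaEnsemble

namespace BetaEnsemble

noncomputable section

/-! ### Weak derivatives and absolutely continuous functions -/

/-! Let `T` be the embedding of H into L²(μ) and `S` its adjoint. Integration by parts gives ⟨u,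
v⟩_H = ⟨u, A[v]⟩ in L²(μ), so `S` inverts A: for g of mean zero, v = S g solves A[v] = g.
Substituting v = S k turns -L[v] = A[v] + 2P W[v] into (1 + K) k, where K g = 2P W[S g] is bounded
on L²(μ), because W depends boundedly on v'.

The Fourier part of the form is what controls K. The Hilbert transform is the multiplier iπ sign ξ,
hence the pairing of the transforms of u'ρ and v'ρ in L²(|ξ|dξ) equals 2⟨A[u], W[v]⟩, and ⟨g, K k⟩
is P times the pairing for S g and S k. So K is symmetric and nonnegative, 1 + K has an inverse `M`
of norm at most 1, and (-L)⁻¹ = S M T. Symmetry, positivity and the bound ‖T‖² can be read off from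
this factorisation. Since `T` is compact, ‖T‖² is an eigenvalue of S T, and its inverse is the
smallest eigenvalue of A.

The analysis that supports this has four sources. The Euler–Lagrange equation of the energy gives ρ
= exp(c - V + 2P U) with U the logarithmic potential; U differs from log(1+|x|) by a bounded amount,
so ρ is comparable to e^{-V}(1+x²)^P, is bounded and almost everywhere positive, and satisfies ρ' =
-ρ(V' + 2P ℋ[ρ]) (`IsEquilibriumMeasure.gibbsDensity`, `GibbsDensity.hasWeakDeriv_density`). Test
pairs (f, f') are dense among pairs (u, u') in L²(μ) × L²(μ) (`GibbsDensity.closed_induction`),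
which carries the Poincaré inequality and a tail estimate over to H; they yield completeness and,
with averages over short intervals, compactness of `T`. If A[u] is in L²(μ), then u'ρ is of class
H¹, so the Fourier condition in the form domain is automatic (`GibbsDensity.mem_formDomain_iff`). On
a test function φ, the commutator of ℋ with multiplication by φ' cancels the term φ'ℋ[ρ] of A[φ] and
leaves -Ξ[φ'] (`GibbsDensity.exists_masterOp`). -/

lemma HasWeakDeriv.congr {f g f' g' : ℝ → ℝ} (h : HasWeakDeriv f g) (hf : f =ᵐ[volume] f')
    (hg : g =ᵐ[volume] g') : HasWeakDeriv f' g' := by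
  refine ⟨(locallyIntegrable_congr hf).1 h.1, (locallyIntegrable_congr hg).1 h.2.1,
    fun ψ hψ hc => ?_⟩
  have h1 := integral_congr_ae (hf.mul (ae_eq_refl (deriv ψ)))
  have h2 := integral_congr_ae (hg.mul (ae_eq_refl ψ))
  simp only [Pi.mul_apply] at h1 h2
  rw [← h1, ← h2]
  exact h.2.2 ψ hψ hc

lemma HasWeakDeriv.unique {f g g' : ℝ → ℝ} (h : HasWeakDeriv f g) (h' : HasWeakDeriv f g') :
    g =ᵐ[volume] g' := by
  refine ae_eq_of_integral_contDiff_smul_eq h.2.1 h'.2.1 fun ψ hψ hc => ?_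
  simp only [smul_eq_mul, mul_comm (ψ _)]
  have h1 := h.2.2 ψ hψ hc
  have h2 := h'.2.2 ψ hψ hc
  linarith

lemma HasWeakDeriv.sub {f g f' g' : ℝ → ℝ} (h : HasWeakDeriv f f') (k : HasWeakDeriv g g') :
    HasWeakDeriv (f - g) (f' - g') := by
  have := h.add (k.smul (-1))
  simpa [sub_eq_add_neg] using this

lemma HasWeakDeriv.weakDeriv_ae_eq {f g : ℝ → ℝ} (h : HasWeakDeriv f g) :
    weakDeriv f =ᵐ[volume] g := by
  have he : ∃ g, HasWeakDeriv f g := ⟨g, h⟩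
  rw [weakDeriv, dif_pos he]
  exact he.choose_spec.unique h

/-- Absolute continuity on every bounded interval. -/
def LocAC (F : ℝ → ℝ) : Prop := ∀ a b, AbsolutelyContinuousOnInterval F a b

lemma LocAC.continuous {F : ℝ → ℝ} (hF : LocAC F) : Continuous F := by
  refine continuous_iff_continuousAt.2 fun x => ?_
  have := (hF (x - 1) (x + 1)).continuousOn
  rw [Set.uIcc_of_le (by linarith)] at this
  exact this.continuousAt (Icc_mem_nhds (by linarith) (by linarith))

lemma LocAC.mul {F G : ℝ → ℝ} (hF : LocAC F) (hG : LocAC G) : LocAC (F * G) :=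
  fun a b => (hF a b).mul (hG a b)

lemma LocAC.add {F G : ℝ → ℝ} (hF : LocAC F) (hG : LocAC G) : LocAC (F + G) :=
  fun a b => (hF a b).add (hG a b)

lemma locAC_of_contDiff {F : ℝ → ℝ} (hF : ContDiff ℝ 1 F) : LocAC F :=
  fun _ _ => hF.contDiffOn.absolutelyContinuousOnInterval

lemma locAC_primitive {g : ℝ → ℝ} (hg : LocallyIntegrable g volume) :
    LocAC (fun x => ∫ t in (0 : ℝ)..x, g t) := by
  intro a b
  have hi : IntervalIntegrable g volume (min 0 (min a b)) (max 0 (max a b)) :=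
    intervalIntegrable_iff.mpr <|
      (hg.integrableOn_isCompact isCompact_uIcc).mono_set Set.uIoc_subset_uIcc
  have h0 : (0 : ℝ) ∈ Set.uIcc (min 0 (min a b)) (max 0 (max a b)) := by
    rw [Set.uIcc_of_le (by simp)]; simp
  refine (hi.absolutelyContinuousOnInterval_intervalIntegral h0).mono ?_
  rw [Set.uIcc_of_le (a := min 0 (min a b)) (by simp), Set.uIcc]
  exact Set.Icc_subset_Icc (min_le_right _ _) (le_max_right _ _)

/-- On a bounded interval F stays below some C, and exp is Lipschitz with constant e^C on (-∞, C];
absolute continuity survives Lipschitz composition. -/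
lemma LocAC.comp_exp {F : ℝ → ℝ} (hF : LocAC F) : LocAC (fun x => Real.exp (F x)) := by
  intro a b
  obtain ⟨C, hC⟩ := (hF a b).exists_bound
  have hl : LipschitzOnWith (Real.exp C).toNNReal Real.exp (Set.Iic C) := by
    refine (convex_Iic C).lipschitzOnWith_of_nnnorm_deriv_le
      (fun x _ => Real.differentiableAt_exp) fun x hx => ?_
    rw [← NNReal.coe_le_coe, coe_nnnorm, Real.coe_toNNReal _ (Real.exp_pos _).le]
    simpa using hx
  have hFab := hF a b
  rw [absolutelyContinuousOnInterval_iff] at hFab ⊢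
  intro ε hε
  obtain ⟨δ, hδ, h⟩ := hFab (ε / Real.exp C) (by positivity)
  refine ⟨δ, hδ, fun E hE hEδ => ?_⟩
  have h1 := h E hE hEδ
  have hmem : ∀ i < E.1, (E.2 i).1 ∈ Set.uIcc a b ∧ (E.2 i).2 ∈ Set.uIcc a b := by
    intro i hi
    have := hE.1 i (Finset.mem_range.2 hi)
    exact this
  calc _ ≤ ∑ i ∈ Finset.range E.1, Real.exp C * dist (F (E.2 i).1) (F (E.2 i).2) := by
        refine Finset.sum_le_sum fun i hi => ?_
        have hm := hmem i (Finset.mem_range.1 hi)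
        have := hl.dist_le_mul (F (E.2 i).1) ((le_abs_self _).trans (hC _ hm.1))
          (F (E.2 i).2) ((le_abs_self _).trans (hC _ hm.2))
        simpa [Real.coe_toNNReal _ (Real.exp_pos C).le] using this
    _ = Real.exp C * ∑ i ∈ Finset.range E.1, dist (F (E.2 i).1) (F (E.2 i).2) := by
        rw [Finset.mul_sum]
    _ < Real.exp C * (ε / Real.exp C) := by gcongr
    _ = ε := by field_simp

lemma exists_support_subset_Ioo {ψ : ℝ → ℝ} (hc : HasCompactSupport ψ) :
    ∃ R > 0, tsupport ψ ⊆ Set.Ioo (-R) R := by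
  obtain ⟨R, hR⟩ := hc.isBounded.subset_ball 0
  refine ⟨max R 1, by positivity, fun x hx => ?_⟩
  have := hR hx
  rw [Metric.mem_ball, dist_zero_right, Real.norm_eq_abs, abs_lt] at this
  exact ⟨by linarith [le_max_left R 1], by linarith [le_max_left R 1]⟩

lemma integral_eq_interval {f : ℝ → ℝ} {R : ℝ} (hR : 0 < R)
    (hf : ∀ x, x ∉ Set.Ioo (-R) R → f x = 0) : ∫ x, f x = ∫ x in (-R)..R, f x := by
  rw [intervalIntegral.integral_of_le (by linarith)]
  refine (setIntegral_eq_integral_of_forall_compl_eq_zero fun x hx => hf x fun h => hx ?_).symm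
  exact ⟨h.1, h.2.le⟩

/-- Classical integration by parts on an interval whose interior contains the support of ψ, where
the boundary terms vanish. -/
lemma LocAC.hasWeakDeriv {F g : ℝ → ℝ} (hF : LocAC F) (h : ∀ᵐ x, HasDerivAt F (g x) x) :
    HasWeakDeriv F g := by
  have hd : deriv F =ᵐ[volume] g := by filter_upwards [h] with x hx using hx.deriv
  have hli : LocallyIntegrable (deriv F) volume := by
    refine locallyIntegrable_iff.2 fun K hK => ?_
    obtain ⟨R, hR⟩ := hK.isBounded.subset_closedBall 0
    have h1 := (hF (-(max R 0)) (max R 0)).intervalIntegrable_deriv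
    rw [intervalIntegrable_iff_integrableOn_Icc_of_le (by linarith [le_max_right R 0])] at h1
    refine h1.mono_set fun x hx => ?_
    have := hR hx
    rw [Metric.mem_closedBall, dist_zero_right, Real.norm_eq_abs, abs_le] at this
    exact ⟨by linarith [le_max_left R 0], by linarith [le_max_left R 0]⟩
  refine ⟨hF.continuous.locallyIntegrable, (locallyIntegrable_congr hd).1 hli, fun ψ hψ hc => ?_⟩
  obtain ⟨R, hR, hs⟩ := exists_support_subset_Ioo hc
  have hz : ∀ x, x ∉ Set.Ioo (-R) R → ψ x = 0 := fun x hx =>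
    image_eq_zero_of_notMem_tsupport fun h => hx (hs h)
  have hz' : ∀ x, x ∉ Set.Ioo (-R) R → deriv ψ x = 0 := fun x hx =>
    image_eq_zero_of_notMem_tsupport fun h => hx (hs (tsupport_deriv_subset h))
  have hψ' : AbsolutelyContinuousOnInterval ψ (-R) R :=
    locAC_of_contDiff (hψ.of_le (by simp)) _ _
  rw [integral_eq_interval hR fun x hx => by rw [hz' x hx, mul_zero],
    integral_eq_interval hR fun x hx => by rw [hz x hx, mul_zero],
    (hF (-R) R).integral_mul_deriv_eq_deriv_mul hψ', hz R (by simp), hz (-R) (by simp)]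
  rw [intervalIntegral.integral_congr_ae (g := fun x => g x * ψ x)]
  · ring
  · filter_upwards [hd] with x hx _
    rw [hx]

/-- Subtracting from a test function ψ the multiple (∫ψ)η of a fixed bump η of integral 1 leaves the
derivative of another test function, which f annihilates. Hence ∫fψ = (∫fη)(∫ψ) for all ψ, and the
constant is ∫fη. -/
lemma ae_const_of_hasWeakDeriv_zero {f : ℝ → ℝ} (h : HasWeakDeriv f 0) :
    ∃ c : ℝ, f =ᵐ[volume] fun _ => c := by
  obtain ⟨η, -, hηc, hη, -, hη1⟩ : ∃ η : ℝ → ℝ, True ∧ HasCompactSupport η ∧ ContDiff ℝ ∞ η ∧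
      True ∧ ∫ x, η x = 1 := by
    let b : ContDiffBump (0 : ℝ) := ⟨1, 2, by norm_num, by norm_num⟩
    exact ⟨b.normed volume, trivial, b.hasCompactSupport_normed, b.contDiff_normed, trivial,
      b.integral_normed⟩
  refine ⟨∫ x, f x * η x, ae_eq_of_integral_contDiff_smul_eq h.1 (locallyIntegrable_const _)
    fun ψ hψ hc => ?_⟩
  set k : ℝ := ∫ x, ψ x
  set θ : ℝ → ℝ := fun x => ψ x - k * η x with hθ
  have hθs : ContDiff ℝ ∞ θ := hψ.sub (contDiff_const.mul hη)
  have hθc : HasCompactSupport θ := hc.sub (hηc.mul_left)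
  have hψi : Integrable ψ := hψ.continuous.integrable_of_hasCompactSupport hc
  have hηi : Integrable η := hη.continuous.integrable_of_hasCompactSupport hηc
  have hθi : Integrable θ := hψi.sub (hηi.const_mul k)
  have hθ0 : ∫ x, θ x = 0 := by
    rw [hθ, integral_sub hψi (hηi.const_mul k), integral_const_mul, hη1]
    simp [k]
  obtain ⟨R, hR, hs⟩ := exists_support_subset_Ioo hθc
  have hz : ∀ x, x ∉ Set.Ioo (-R) R → θ x = 0 := fun x hx =>
    image_eq_zero_of_notMem_tsupport fun h => hx (hs h)
  set Θ : ℝ → ℝ := fun x => ∫ t in (-R)..x, θ t with hΘ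
  have hΘd : ∀ x, HasDerivAt Θ (θ x) x := fun x =>
    intervalIntegral.integral_hasDerivAt_right (hθs.continuous.intervalIntegrable _ _)
      (hθs.continuous.stronglyMeasurableAtFilter _ _) hθs.continuous.continuousAt
  have hΘder : deriv Θ = θ := funext fun x => (hΘd x).deriv
  have hΘs : ContDiff ℝ ∞ Θ := by
    rw [contDiff_infty_iff_deriv, hΘder]
    exact ⟨fun x => (hΘd x).differentiableAt, hθs⟩
  -- The primitive vanishes to the right of the support exactly because θ has integral zero.
  have hΘc : HasCompactSupport Θ := by
    refine HasCompactSupport.intro (isCompact_Icc (a := -R) (b := R)) fun x hx => ?_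
    rw [Set.mem_Icc, not_and_or, not_le, not_le] at hx
    rcases hx with hx | hx
    · rw [hΘ]
      simp only
      rw [intervalIntegral.integral_symm, intervalIntegral.integral_of_le hx.le,
        setIntegral_eq_zero_of_forall_eq_zero, neg_zero]
      intro t ht
      exact hz t fun h => by linarith [h.1, ht.2]
    · have h1 : ∫ t in (-R)..R, θ t = 0 := by rw [← integral_eq_interval hR hz, hθ0]
      have h2 : ∫ t in R..x, θ t = 0 := by
        rw [intervalIntegral.integral_of_le hx.le, setIntegral_eq_zero_of_forall_eq_zero]
        intro t ht
        exact hz t fun h => by linarith [h.2, ht.1]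
      rw [hΘ]
      simp only
      rw [← intervalIntegral.integral_add_adjacent_intervals
        (hθs.continuous.intervalIntegrable (-R) R) (hθs.continuous.intervalIntegrable R x), h1, h2,
        add_zero]
  have h3 := h.2.2 Θ hΘs hΘc
  rw [hΘder] at h3
  simp only [Pi.zero_apply, zero_mul, integral_zero, neg_zero, hθ, mul_sub] at h3
  have i1 := integrable_mul_test h.1 hψ.continuous hc
  have i2 : Integrable fun x => f x * (k * η x) := by
    have := (integrable_mul_test h.1 hη.continuous hηc).const_mul k
    refine this.congr (.of_forall fun x => ?_)
    simp only; ring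
  rw [integral_sub i1 i2] at h3
  have h4 : ∫ x, f x * (k * η x) = k * ∫ x, f x * η x := by
    rw [← integral_const_mul]; congr 1; ext x; ring
  simp only [smul_eq_mul]
  rw [integral_mul_const, ← h4]
  simp only [mul_comm (ψ _)]
  linarith

/-- A function with a weak derivative has a locally absolutely continuous representative. -/
lemma HasWeakDeriv.exists_locAC {f g : ℝ → ℝ} (h : HasWeakDeriv f g) :
    ∃ F : ℝ → ℝ, LocAC F ∧ f =ᵐ[volume] F ∧ (∀ᵐ x, HasDerivAt F (g x) x) ∧
      ∀ x y, F y - F x = ∫ t in x..y, g t := by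
  have hG := locAC_primitive h.2.1
  have hGd : ∀ᵐ x, HasDerivAt (fun x => ∫ t in (0 : ℝ)..x, g t) (g x) x := by
    filter_upwards [LocallyIntegrable.ae_hasDerivAt_integral h.2.1] with x hx using hx 0
  have hk := (hG.hasWeakDeriv hGd)
  -- f minus the primitive of g has weak derivative zero, hence is constant.
  obtain ⟨c, hc⟩ := ae_const_of_hasWeakDeriv_zero ((h.sub hk).congr (ae_eq_refl _)
    (by simp : g - g =ᵐ[volume] 0))
  have hii : ∀ a b, IntervalIntegrable g volume a b := fun a b => intervalIntegrable_iff.mpr <|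
      (h.2.1.integrableOn_isCompact isCompact_uIcc).mono_set Set.uIoc_subset_uIcc
  refine ⟨(fun _ => c) + fun x => ∫ t in (0 : ℝ)..x, g t,
    (locAC_of_contDiff contDiff_const).add hG, ?_, ?_, fun x y => ?_⟩
  · filter_upwards [hc] with x hx
    simp only [Pi.sub_apply, Pi.add_apply] at hx ⊢
    linarith
  · filter_upwards [hGd] with x hx
    exact hx.const_add c
  · simp only [Pi.add_apply, add_sub_add_left_eq_sub]
    exact intervalIntegral.integral_interval_sub_left (hii _ _) (hii _ _)

lemma HasWeakDeriv.mul_contDiff {f g χ : ℝ → ℝ} (h : HasWeakDeriv f g) (hχ : ContDiff ℝ 1 χ) :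
    HasWeakDeriv (fun x => χ x * f x) (fun x => deriv χ x * f x + χ x * g x) := by
  obtain ⟨F, hF, hfF, hd, -⟩ := h.exists_locAC
  have h1 := ((locAC_of_contDiff hχ).mul hF).hasWeakDeriv
    (g := fun x => deriv χ x * F x + χ x * g x) <| by
    filter_upwards [hd] with x hx
    exact ((hχ.differentiable (by simp)) x).hasDerivAt.mul hx
  refine h1.congr ?_ ?_
  · filter_upwards [hfF] with x hx
    simp [hx]
  · filter_upwards [hfF] with x hx
    simp [hx]

lemma HasWeakDeriv.exp {f g : ℝ → ℝ} (h : HasWeakDeriv f g) :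
    HasWeakDeriv (fun x => Real.exp (f x)) (fun x => Real.exp (f x) * g x) := by
  obtain ⟨F, hF, hfF, hd, -⟩ := h.exists_locAC
  refine (hF.comp_exp.hasWeakDeriv (g := fun x => Real.exp (F x) * g x) ?_).congr ?_ ?_
  · filter_upwards [hd] with x hx using hx.exp
  · filter_upwards [hfF] with x hx
    simp [hx]
  · filter_upwards [hfF] with x hx
    simp [hx]

lemma hasWeakDeriv_of_contDiff {f : ℝ → ℝ} (hf : ContDiff ℝ 1 f) : HasWeakDeriv f (deriv f) :=
  (locAC_of_contDiff hf).hasWeakDeriv <|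
    .of_forall fun x => ((hf.differentiable (by simp)) x).hasDerivAt

/-- A smooth cutoff: equal to `1` on `[-R, R]` and supported in `[-2R, 2R]`. -/
def cutoff (R : ℝ) (x : ℝ) : ℝ :=
  (⟨1, 2, by norm_num, by norm_num⟩ : ContDiffBump (0 : ℝ)) (x / R)

lemma cutoff_contDiff (R : ℝ) : ContDiff ℝ ∞ (cutoff R) :=
  (ContDiffBump.contDiff _).comp (contDiff_id.div_const R)

lemma cutoff_eq_one {R x : ℝ} (hR : 0 < R) (hx : |x| ≤ R) : cutoff R x = 1 := by
  refine ContDiffBump.one_of_mem_closedBall _ ?_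
  rw [Metric.mem_closedBall, dist_zero_right, Real.norm_eq_abs, abs_div, abs_of_pos hR]
  exact (div_le_one hR).2 hx

lemma cutoff_eq_zero {R x : ℝ} (hR : 0 < R) (hx : 2 * R ≤ |x|) : cutoff R x = 0 := by
  refine ContDiffBump.zero_of_le_dist _ ?_
  rw [dist_zero_right, Real.norm_eq_abs, abs_div, abs_of_pos hR]
  exact (le_div_iff₀ hR).2 hx

lemma cutoff_hasCompactSupport {R : ℝ} (hR : 0 < R) : HasCompactSupport (cutoff R) := by
  refine HasCompactSupport.intro (isCompact_Icc (a := -(2 * R)) (b := 2 * R)) fun x hx => ?_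
  refine cutoff_eq_zero hR ?_
  by_contra! h
  exact hx (abs_le.1 h.le)

lemma cutoff_mem_Icc (R x : ℝ) : cutoff R x ∈ Set.Icc (0 : ℝ) 1 :=
  ⟨ContDiffBump.nonneg _, ContDiffBump.le_one _⟩

lemma abs_cutoff_le (R x : ℝ) : |cutoff R x| ≤ 1 := by
  have := cutoff_mem_Icc R x
  rw [abs_of_nonneg this.1]
  exact this.2

/-- All cutoffs are dilates of one bump, so one constant serves for every R; the factor 1/R makes
the cutoff error vanish in the limit. -/
lemma exists_deriv_cutoff_bound : ∃ C : ℝ, 0 ≤ C ∧ ∀ R : ℝ, 0 < R → ∀ x,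
    |deriv (cutoff R) x| ≤ C / R := by
  set b : ContDiffBump (0 : ℝ) := ⟨1, 2, by norm_num, by norm_num⟩ with hb
  have hbs : ContDiff ℝ 1 b := b.contDiff
  obtain ⟨C, hC⟩ := (hbs.continuous_deriv le_rfl).bounded_above_of_compact_support
    b.hasCompactSupport.deriv
  refine ⟨C, (norm_nonneg _).trans (hC 0), fun R hR x => ?_⟩
  have h1 : HasDerivAt (cutoff R) (deriv b (x / R) * (1 / R)) x :=
    HasDerivAt.comp x (h₂ := b) ((hbs.differentiable one_ne_zero) (x / R)).hasDerivAt
      ((hasDerivAt_id x).div_const R)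
  rw [h1.deriv, abs_mul, abs_of_pos (by positivity : 0 < 1 / R), mul_one_div]
  have := hC (x / R)
  rw [Real.norm_eq_abs] at this
  gcongr

lemma tendsto_cutoff (x : ℝ) : Tendsto (fun n : ℕ => cutoff (n + 1) x) atTop (𝓝 1) := by
  refine tendsto_const_nhds.congr' ?_
  obtain ⟨N, hN⟩ := exists_nat_ge |x|
  filter_upwards [eventually_ge_atTop N] with n hn
  have : (N : ℝ) ≤ n := by exact_mod_cast hn
  exact (cutoff_eq_one (by positivity) (by linarith)).symm

/-- Integration by parts against a bounded smooth function with bounded derivative. -/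
lemma HasWeakDeriv.integral_mul_deriv {f g b : ℝ → ℝ} (h : HasWeakDeriv f g) (hf : Integrable f)
    (hg : Integrable g) (hb : ContDiff ℝ ∞ b) {C : ℝ} (hbC : ∀ x, |b x| ≤ C)
    (hbC' : ∀ x, |deriv b x| ≤ C) : ∫ x, f x * deriv b x = -∫ x, g x * b x := by
  obtain ⟨D, hD0, hD⟩ := exists_deriv_cutoff_bound
  have hbd : Continuous (deriv b) := hb.continuous_deriv (by simp)
  have hC0 : 0 ≤ C := (abs_nonneg _).trans (hbC 0)
  set χ : ℕ → ℝ → ℝ := fun n => cutoff (n + 1) with hχ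
  have hχd : ∀ n, Continuous (deriv (χ n)) := fun n =>
    (cutoff_contDiff _).continuous_deriv (by simp)
  have hder : ∀ n x, deriv (fun x => χ n x * b x) x = deriv (χ n) x * b x + χ n x * deriv b x :=
    fun n x => (((cutoff_contDiff _).differentiable (by simp) x).hasDerivAt.mul
      ((hb.differentiable (by simp)) x).hasDerivAt).deriv
  have heq : ∀ n : ℕ, ∫ x, f x * (deriv (χ n) x * b x + χ n x * deriv b x) =
      -∫ x, g x * (χ n x * b x) := fun n => by
    have := h.2.2 (fun x => χ n x * b x) ((cutoff_contDiff _).mul hb)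
      (cutoff_hasCompactSupport (by positivity)).mul_right
    simpa only [hder] using this
  have hDn : ∀ (n : ℕ) x, |deriv (χ n) x| ≤ D / (n + 1) := fun n x => hD _ (by positivity) x
  have hDn' : ∀ (n : ℕ) x, |deriv (χ n) x| ≤ D := fun n x => (hDn n x).trans
    (div_le_self hD0 (by linarith [(Nat.cast_nonneg n : (0 : ℝ) ≤ n)]))
  -- The commutator term with the derivative of the cutoff is O(1/n), so only the derivative of b
  -- survives.
  have l1 : Tendsto (fun n : ℕ => ∫ x, f x * (deriv (χ n) x * b x + χ n x * deriv b x)) atTop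
      (𝓝 (∫ x, f x * deriv b x)) := by
    refine tendsto_integral_of_dominated_convergence (fun x => |f x| * (D * C + C)) (fun n => ?_)
      (hf.abs.mul_const _) (fun n => .of_forall fun x => ?_) (.of_forall fun x => ?_)
    · exact hf.1.mul (((hχd n).mul hb.continuous).add
        ((cutoff_contDiff _).continuous.mul hbd)).aestronglyMeasurable
    · rw [Real.norm_eq_abs, abs_mul]
      gcongr
      refine (abs_add_le _ _).trans ?_
      rw [abs_mul, abs_mul]
      have h1 := hDn' n x
      have h2 := hbC x
      have h3 := hbC' x
      have h4 := abs_cutoff_le (n + 1) x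
      calc _ ≤ D * C + 1 * C := by gcongr
        _ = _ := by ring
    · refine tendsto_const_nhds.mul ?_
      have h1 : Tendsto (fun n : ℕ => deriv (χ n) x) atTop (𝓝 0) := by
        refine squeeze_zero_norm (fun n => hDn n x) ?_
        exact tendsto_const_nhds.div_atTop
          (tendsto_atTop_add_const_right _ _ tendsto_natCast_atTop_atTop)
      simpa using (h1.mul_const (b x)).add ((tendsto_cutoff x).mul_const (deriv b x))
  have l2 : Tendsto (fun n : ℕ => ∫ x, g x * (χ n x * b x)) atTop (𝓝 (∫ x, g x * b x)) := by
    refine tendsto_integral_of_dominated_convergence (fun x => |g x| * C) (fun n => ?_)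
      (hg.abs.mul_const _) (fun n => .of_forall fun x => ?_) (.of_forall fun x => ?_)
    · exact hg.1.mul ((cutoff_contDiff _).continuous.mul hb.continuous).aestronglyMeasurable
    · rw [Real.norm_eq_abs, abs_mul, abs_mul]
      gcongr
      calc _ ≤ 1 * C := by gcongr; exacts [abs_cutoff_le _ _, hbC x]
        _ = _ := by ring
    · simpa using ((tendsto_cutoff x).mul_const (b x)).const_mul (g x)
  refine tendsto_nhds_unique l1 ?_
  simp only [heq]
  exact l2.neg

section fourier

open scoped FourierTransform Real

/-! ### The Fourier transform on `L¹ ∩ L²` -/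

/-- The L² transform agrees with the distributional one, and the integral transform satisfies ∫ f̂ g
= ∫ f ĝ; both sides therefore give the same values against test functions. This is the bridge
between Plancherel and the integral formula. -/
lemma fourier_toLp_ae_eq {f : ℝ → ℂ} (h1 : Integrable f) (h2 : MemLp f 2 volume) :
    ((𝓕 (h2.toLp f) : Lp ℂ 2 (volume : Measure ℝ)) : ℝ → ℂ) =ᵐ[volume] 𝓕 f := by
  have hc : Continuous (𝓕 f) := VectorFourier.fourierIntegral_continuous
    Real.continuous_fourierChar (L := innerₗ ℝ) continuous_inner h1
  refine ae_eq_of_integral_contDiff_smul_eq ((Lp.memLp _).locallyIntegrable (by norm_num))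
    hc.locallyIntegrable fun ψ hψ hψc => ?_
  set g : 𝓢(ℝ, ℂ) := (hψc.toSchwartzMap hψ).postcompCLM Complex.ofRealCLM with hg
  have hgψ : ∀ x, g x = (ψ x : ℂ) := fun x => rfl
  have e := DFunLike.congr_fun (Lp.fourier_toTemperedDistribution_eq (h2.toLp f)) g
  rw [TemperedDistribution.fourier_apply, Lp.toTemperedDistribution_apply,
    Lp.toTemperedDistribution_apply] at e
  simp only [hgψ, smul_eq_mul] at e
  simp only [Complex.real_smul]
  rw [← e]
  have e2 := VectorFourier.integral_fourierIntegral_smul_eq_flip (μ := volume) (ν := volume)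
    (L := innerₗ ℝ) (f := f) (g := (g : ℝ → ℂ)) Real.continuous_fourierChar continuous_inner h1
    g.integrable
  rw [flip_innerₗ] at e2
  calc _ = ∫ x, (𝓕 (g : ℝ → ℂ)) x * f x := by
        refine integral_congr_ae ?_
        filter_upwards [h2.coeFn_toLp] with x hx
        rw [hx]; rfl
    _ = ∫ x, f x • (𝓕 (g : ℝ → ℂ)) x := by
        congr 1; ext x; rw [smul_eq_mul, mul_comm]
    _ = ∫ x, 𝓕 f x • g x := e2.symm
    _ = _ := by congr 1; ext x; rw [hgψ, smul_eq_mul, mul_comm]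

lemma fourierInv_toLp_ae_eq {f : ℝ → ℂ} (h1 : Integrable f) (h2 : MemLp f 2 volume) :
    ((𝓕⁻ (h2.toLp f) : Lp ℂ 2 (volume : Measure ℝ)) : ℝ → ℂ) =ᵐ[volume] 𝓕⁻ f := by
  have hcn : Continuous fun p : ℝ × ℝ => (-innerₗ ℝ) p.1 p.2 := by
    exact (continuous_inner (𝕜 := ℝ) (E := ℝ)).neg
  have hc : Continuous (𝓕⁻ f) := VectorFourier.fourierIntegral_continuous
    Real.continuous_fourierChar (L := -innerₗ ℝ) hcn h1
  refine ae_eq_of_integral_contDiff_smul_eq ((Lp.memLp _).locallyIntegrable (by norm_num))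
    hc.locallyIntegrable fun ψ hψ hψc => ?_
  set g : 𝓢(ℝ, ℂ) := (hψc.toSchwartzMap hψ).postcompCLM Complex.ofRealCLM with hg
  have hgψ : ∀ x, g x = (ψ x : ℂ) := fun x => rfl
  have e := DFunLike.congr_fun (Lp.fourierInv_toTemperedDistribution_eq (h2.toLp f)) g
  rw [TemperedDistribution.fourierInv_apply, Lp.toTemperedDistribution_apply,
    Lp.toTemperedDistribution_apply] at e
  simp only [hgψ, smul_eq_mul] at e
  simp only [Complex.real_smul]
  rw [← e]
  have e2 := VectorFourier.integral_fourierIntegral_smul_eq_flip (μ := volume) (ν := volume)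
    (L := -innerₗ ℝ) (f := f) (g := (g : ℝ → ℂ)) Real.continuous_fourierChar hcn h1 g.integrable
  have hfl : (-innerₗ ℝ : ℝ →ₗ[ℝ] ℝ →ₗ[ℝ] ℝ).flip = -innerₗ ℝ := by
    ext; simp
  rw [hfl] at e2
  calc _ = ∫ x, (𝓕⁻ (g : ℝ → ℂ)) x * f x := by
        refine integral_congr_ae ?_
        filter_upwards [h2.coeFn_toLp] with x hx
        rw [hx, SchwartzMap.fourierInv_coe]
    _ = ∫ x, f x • (𝓕⁻ (g : ℝ → ℂ)) x := by
        congr 1; ext x; rw [smul_eq_mul, mul_comm]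
    _ = ∫ x, 𝓕⁻ f x • g x := e2.symm
    _ = _ := by congr 1; ext x; rw [hgψ, smul_eq_mul, mul_comm]

/-! ### The Fourier multiplier of the Hilbert transform -/

lemma integral_cos_mul_exp {δ : ℝ} (hδ : 0 < δ) (a : ℝ) :
    ∫ t in Set.Ioi (0 : ℝ), Real.cos (a * t) * Real.exp (-δ * t) = δ / (δ ^ 2 + a ^ 2) := by
  have hre : (-δ + a * Complex.I : ℂ).re < 0 := by simpa
  have h := integral_exp_mul_complex_Ioi hre 0
  have h2 : ∀ t : ℝ, Real.cos (a * t) * Real.exp (-δ * t) =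
      (Complex.exp ((-δ + a * Complex.I : ℂ) * t)).re := by
    intro t
    rw [Complex.exp_re]
    simp [mul_comm]
  have hi : IntegrableOn (fun t : ℝ => Complex.exp ((-δ + a * Complex.I : ℂ) * t)) (Set.Ioi 0) :=
    integrableOn_exp_mul_complex_Ioi hre 0
  simp_rw [h2]
  have := integral_re hi
  simp only [RCLike.re_to_complex] at this
  rw [this, h]
  simp only [Complex.ofReal_zero, mul_zero, Complex.exp_zero]
  rw [Complex.div_re]
  simp [Complex.normSq_apply]
  field_simp

/-- Differentiating in `a` removes the factor 1/t and leaves the cosine integral, which is also the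
derivative of arctan(a/δ); both sides vanish at a = 0. -/
lemma integral_sin_div_mul_exp {δ : ℝ} (hδ : 0 < δ) (a : ℝ) :
    ∫ t in Set.Ioi (0 : ℝ), Real.sin (a * t) / t * Real.exp (-δ * t) = Real.arctan (a / δ) := by
  set μ0 := volume.restrict (Set.Ioi (0 : ℝ))
  set F : ℝ → ℝ → ℝ := fun a t => Real.sin (a * t) / t * Real.exp (-δ * t) with hF
  have hpos : ∀ᵐ t ∂μ0, 0 < t := ae_restrict_mem measurableSet_Ioi
  have hexp : Integrable (fun t => Real.exp (-δ * t)) μ0 :=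
    integrableOn_exp_mul_Ioi (by linarith) 0
  have hmeas : ∀ a, AEStronglyMeasurable (F a) μ0 := fun a => by
    have : Measurable (F a) := by fun_prop
    exact this.aestronglyMeasurable
  have hb : ∀ a t : ℝ, 0 < t → |Real.sin (a * t) / t| ≤ |a| := fun a t ht => by
    rw [abs_div, abs_of_pos ht, div_le_iff₀ ht]
    refine Real.abs_sin_le_abs.trans ?_
    rw [abs_mul, abs_of_pos ht]
  have hint : ∀ a, Integrable (F a) μ0 := fun a => by
    refine (hexp.const_mul |a|).mono' (hmeas a) ?_
    filter_upwards [hpos] with t ht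
    rw [Real.norm_eq_abs, abs_mul, abs_of_pos (Real.exp_pos _)]
    exact mul_le_mul_of_nonneg_right (hb a t ht) (Real.exp_pos _).le
  have hder : ∀ a, HasDerivAt (fun a => ∫ t, F a t ∂μ0) (δ / (δ ^ 2 + a ^ 2)) a := fun a => by
    have := (hasDerivAt_integral_of_dominated_loc_of_deriv_le (μ := μ0) (F := F) (x₀ := a)
      (s := Set.univ) (F' := fun a t => Real.cos (a * t) * Real.exp (-δ * t))
      (bound := fun t => Real.exp (-δ * t)) Filter.univ_mem (.of_forall hmeas) (hint a) ?_ ?_ hexp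
      ?_).2
    · rwa [integral_cos_mul_exp hδ a] at this
    · exact (by fun_prop : Continuous fun t => Real.cos (a * t) * Real.exp (-δ * t)
        ).aestronglyMeasurable
    · refine .of_forall fun t x _ => ?_
      rw [Real.norm_eq_abs, abs_mul, abs_of_pos (Real.exp_pos _)]
      exact mul_le_of_le_one_left (Real.exp_pos _).le (Real.abs_cos_le_one _)
    · filter_upwards [hpos] with t ht x _
      have h1 : HasDerivAt (fun x => Real.sin (x * t)) (Real.cos (x * t) * t) x := by
        simpa using (((hasDerivAt_id x).mul_const t).sin)
      have h2 := (h1.div_const t).mul_const (Real.exp (-δ * t))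
      rwa [mul_div_assoc, div_self ht.ne', mul_one] at h2
  have hder2 : ∀ a, HasDerivAt (fun a => Real.arctan (a / δ)) (δ / (δ ^ 2 + a ^ 2)) a := fun a => by
    have := ((hasDerivAt_id' a).div_const δ).arctan
    convert this using 1
    field_simp
  have hconst := is_const_of_deriv_eq_zero
    (f := fun a => (∫ t, F a t ∂μ0) - Real.arctan (a / δ))
    (fun a => ((hder a).sub (hder2 a)).differentiableAt)
    (fun a => (((hder a).sub (hder2 a)).congr_deriv (sub_self _)).deriv) a 0
  simp only [hF] at hconst
  simpa [sub_eq_zero] using hconst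

lemma tendsto_arctan_div (a : ℝ) :
    Tendsto (fun δ : ℝ => Real.arctan (a / δ)) (𝓝[>] 0) (𝓝 (π / 2 * Real.sign a)) := by
  rcases lt_trichotomy a 0 with h | rfl | h
  · rw [Real.sign_of_neg h]
    have : Tendsto (fun δ : ℝ => a / δ) (𝓝[>] 0) atBot := by
      simpa [div_eq_mul_inv] using tendsto_inv_nhdsGT_zero.const_mul_atTop_of_neg h
    have h2 := (Real.tendsto_arctan_atBot.mono_right nhdsWithin_le_nhds).comp this
    simpa [Function.comp_def, neg_div] using h2
  · simp
  · rw [Real.sign_of_pos h]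
    have : Tendsto (fun δ : ℝ => a / δ) (𝓝[>] 0) atTop := by
      simpa [div_eq_mul_inv] using tendsto_inv_nhdsGT_zero.const_mul_atTop h
    have h2 := (Real.tendsto_arctan_atTop.mono_right nhdsWithin_le_nhds).comp this
    simpa [Function.comp_def] using h2

/-- The Fourier multiplier `iπ sign ξ` of the Hilbert transform. -/
def hilbertMult (ξ : ℝ) : ℂ := Complex.I * π * Real.sign ξ

lemma norm_hilbertMult_le (ξ : ℝ) : ‖hilbertMult ξ‖ ≤ π := by
  rw [hilbertMult]
  rcases lt_trichotomy ξ 0 with h | rfl | h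
  · simp [Real.sign_of_neg h, abs_of_pos Real.pi_pos]
  · simp [Real.pi_pos.le]
  · simp [Real.sign_of_pos h, abs_of_pos Real.pi_pos]

lemma measurable_hilbertMult : Measurable hilbertMult := by
  have : Measurable Real.sign := by
    unfold Real.sign
    exact Measurable.ite measurableSet_Iio measurable_const
      (Measurable.ite measurableSet_Ioi measurable_const measurable_const)
  unfold hilbertMult
  fun_prop

/-- A real Schwartz function as a complex one. -/
def toComplex : 𝓢(ℝ, ℝ) →L[ℝ] 𝓢(ℝ, ℂ) := SchwartzMap.postcompCLM Complex.ofRealCLM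

lemma exists_abs_sub_le (φ : 𝓢(ℝ, ℝ)) : ∃ C : ℝ, 0 ≤ C ∧ ∀ x y, |φ x - φ y| ≤ C * |x - y| := by
  obtain ⟨C, hC⟩ := φ.decay 0 1
  have hC0 : 0 ≤ C := hC.1.le
  refine ⟨C, hC0, fun x y => ?_⟩
  have hb : ∀ x ∈ Set.univ, ‖deriv φ x‖ ≤ C := fun x _ => by
    have := hC.2 x
    rwa [pow_zero, one_mul, norm_iteratedFDeriv_eq_norm_iteratedDeriv, iteratedDeriv_one] at this
  exact Convex.norm_image_sub_le_of_norm_deriv_le (fun x _ => φ.differentiable x) hb convex_univ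
    trivial trivial

/-- On (0, 1] the quotient is bounded by twice the Lipschitz constant of φ; beyond 1 the factor 1/t
is at most 1 and φ itself is integrable. -/
lemma integrable_hilbert_kernel (φ : 𝓢(ℝ, ℝ)) (x : ℝ) :
    IntegrableOn (fun t => (φ (x + t) - φ (x - t)) / t) (Set.Ioi 0) := by
  obtain ⟨C, hC0, hC⟩ := exists_abs_sub_le φ
  have i1 : Integrable fun t => φ (x + t) := φ.integrable.comp_add_left x
  have i2 : Integrable fun t => φ (x - t) := φ.integrable.comp_sub_left x
  have hm : Measurable fun t => (φ (x + t) - φ (x - t)) / t := by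
    have := φ.continuous
    have h : Measurable fun t => φ (x + t) - φ (x - t) :=
      (by fun_prop : Continuous fun t => φ (x + t) - φ (x - t)).measurable
    exact h.div measurable_id
  have i3 : IntegrableOn (fun _ : ℝ => 2 * C) (Set.Ioc 0 1) :=
    integrableOn_const (by simp)
  rw [← Set.Ioc_union_Ioi_eq_Ioi zero_le_one]
  refine IntegrableOn.union ?_ ?_
  · refine Integrable.mono' i3 hm.aestronglyMeasurable ?_
    filter_upwards [ae_restrict_mem measurableSet_Ioc] with t ht
    rw [Real.norm_eq_abs, abs_div, abs_of_pos ht.1, div_le_iff₀ ht.1]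
    refine (hC _ _).trans (le_of_eq ?_)
    rw [show x + t - (x - t) = 2 * t by ring, abs_mul, abs_of_pos ht.1, abs_two]
    ring
  · refine Integrable.mono' (i1.sub i2).norm.integrableOn hm.aestronglyMeasurable ?_
    filter_upwards [ae_restrict_mem measurableSet_Ioi] with t ht
    rw [Set.mem_Ioi] at ht
    rw [norm_div]
    refine div_le_self (norm_nonneg _) ?_
    rw [Real.norm_eq_abs, abs_of_pos (by linarith)]
    exact ht.le

lemma fourier_schwartz_integrable_mul (Φ : 𝓢(ℝ, ℂ)) : Integrable fun ξ : ℝ => |ξ| * ‖Φ ξ‖ := by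
  simpa using Φ.integrable_pow_mul volume 1

lemma schwartz_eq_integral_fourier (Φ : 𝓢(ℝ, ℂ)) (x : ℝ) :
    Φ x = ∫ ξ : ℝ, Complex.exp ((2 * π * (x * ξ) : ℝ) * Complex.I) * (𝓕 Φ) ξ := by
  have h : (𝓕⁻ (𝓕 Φ) : 𝓢(ℝ, ℂ)) x = Φ x := by rw [FourierTransform.fourierInv_fourier_eq]
  rw [← h, SchwartzMap.fourierInv_coe, Real.fourierInv_eq']
  refine integral_congr_ae (.of_forall fun ξ => ?_)
  simp [mul_comm]

/-- Fourier inversion writes φ(x+t) - φ(x-t) as an integral in ξ with kernel 2i sin(2πξt). The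
damping e^{-δt} makes the double integral absolutely convergent, so Fubini applies and the
t-integral is an arctangent. -/
lemma hilbertSchwartz_regularised (φ : 𝓢(ℝ, ℝ)) (x : ℝ) {δ : ℝ} (hδ : 0 < δ) :
    ((∫ t in Set.Ioi (0 : ℝ), (φ (x + t) - φ (x - t)) / t * Real.exp (-δ * t) : ℝ) : ℂ) =
      ∫ ξ : ℝ, Complex.exp ((2 * π * (x * ξ) : ℝ) * Complex.I) * (𝓕 (toComplex φ)) ξ *
        (2 * Complex.I * Real.arctan (2 * π * ξ / δ)) := by
  set Φ := toComplex φ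
  set G : ℝ → ℂ := fun ξ => (𝓕 Φ) ξ
  have hGi : Integrable G := (𝓕 Φ).integrable
  have hGc : Continuous G := (𝓕 Φ).continuous
  set μ0 := volume.restrict (Set.Ioi (0 : ℝ))
  set e : ℝ → ℂ := fun ξ => Complex.exp ((2 * π * (x * ξ) : ℝ) * Complex.I) with he
  have hec : Continuous e := by fun_prop
  have hen : ∀ ξ, ‖e ξ‖ = 1 := fun ξ => Complex.norm_exp_ofReal_mul_I _
  have hpt : ∀ t, ((φ (x + t) - φ (x - t) : ℝ) : ℂ) =
      ∫ ξ, e ξ * G ξ * (2 * Complex.I * Real.sin (2 * π * ξ * t)) := fun t => by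
    have hb : ∀ y, Integrable fun ξ : ℝ => Complex.exp ((2 * π * (y * ξ) : ℝ) * Complex.I) * G ξ :=
      fun y => by
        refine hGi.norm.mono' (by fun_prop) (.of_forall fun ξ => ?_)
        rw [norm_mul, Complex.norm_exp_ofReal_mul_I, one_mul]
    have h1 : (φ (x + t) : ℂ) = Φ (x + t) := rfl
    have h2 : (φ (x - t) : ℂ) = Φ (x - t) := rfl
    rw [Complex.ofReal_sub, h1, h2, schwartz_eq_integral_fourier, schwartz_eq_integral_fourier Φ,
      ← integral_sub (hb _) (hb _)]
    refine integral_congr_ae (.of_forall fun ξ => ?_)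
    simp only [he, G]
    have h3 : ∀ s : ℝ, Complex.exp ((2 * π * ((x + s) * ξ) : ℝ) * Complex.I) =
        e ξ * Complex.exp ((2 * π * ξ * s : ℝ) * Complex.I) := fun s => by
      rw [he, ← Complex.exp_add]; congr 1; push_cast; ring
    rw [sub_eq_add_neg x t, h3, h3, Complex.ofReal_sin, Complex.sin]
    rw [show ((2 * π * ξ * -t : ℝ) : ℂ) * Complex.I = -((2 * π * ξ * t : ℝ) : ℂ) * Complex.I by
      push_cast; ring]
    linear_combination (-e ξ * (𝓕 Φ) ξ * (Complex.exp (-((2 * π * ξ * t : ℝ) : ℂ) * Complex.I) -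
      Complex.exp (((2 * π * ξ * t : ℝ) : ℂ) * Complex.I))) * Complex.I_sq
  set H : ℝ → ℝ → ℂ := fun t ξ => e ξ * G ξ *
    (2 * Complex.I * ((Real.sin (2 * π * ξ * t) / t * Real.exp (-δ * t) : ℝ) : ℂ)) with hH
  have hexp : Integrable (fun t => Real.exp (-δ * t)) μ0 :=
    integrableOn_exp_mul_Ioi (by linarith) 0
  have hprod : Integrable (Function.uncurry H) (μ0.prod volume) := by
    -- The domination uses |sin(2πξt)/t| ≤ 2π|ξ|; the factor |ξ| is absorbed by the Schwartz
    -- function φ̂.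
    have hdom := hexp.mul_prod ((fourier_schwartz_integrable_mul (𝓕 Φ)).const_mul (4 * π))
    refine hdom.mono' ?_ ?_
    · refine Measurable.aestronglyMeasurable ?_
      have h1 : Measurable fun p : ℝ × ℝ => Real.sin (2 * π * p.2 * p.1) / p.1 *
        Real.exp (-δ * p.1) := by fun_prop
      have h2 : Measurable fun p : ℝ × ℝ => e p.2 * G p.2 :=
        ((hec.mul hGc).measurable).comp measurable_snd
      exact h2.mul ((Complex.measurable_ofReal.comp h1).const_mul (2 * Complex.I))
    · have hae : ∀ᵐ p : ℝ × ℝ ∂(μ0.prod volume), 0 < p.1 :=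
        Measure.quasiMeasurePreserving_fst.ae (ae_restrict_mem measurableSet_Ioi)
      filter_upwards [hae] with p hp
      simp only [Function.uncurry, hH]
      rw [norm_mul, norm_mul, hen, one_mul, norm_mul, norm_mul, Complex.norm_I, mul_one,
        Complex.norm_real, Complex.norm_ofNat, Real.norm_eq_abs, abs_mul,
        abs_of_pos (Real.exp_pos _)]
      have h1 : |Real.sin (2 * π * p.2 * p.1) / p.1| ≤ 2 * π * |p.2| := by
        rw [abs_div, abs_of_pos hp, div_le_iff₀ hp]
        refine Real.abs_sin_le_abs.trans (le_of_eq ?_)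
        rw [abs_mul, abs_mul, abs_mul, abs_of_pos hp, abs_of_pos Real.pi_pos, abs_two]
      calc _ ≤ ‖G p.2‖ * (2 * (2 * π * |p.2| * Real.exp (-δ * p.1))) := by gcongr
        _ = _ := by simp only [G]; ring
  have hswap := integral_integral_swap hprod
  have hL : ∫ t, ∫ ξ, H t ξ ∂volume ∂μ0 =
      ((∫ t in Set.Ioi (0 : ℝ), (φ (x + t) - φ (x - t)) / t * Real.exp (-δ * t) : ℝ) : ℂ) := by
    rw [← integral_complex_ofReal]
    refine integral_congr_ae (.of_forall fun t => ?_)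
    simp only
    rw [show ((φ (x + t) - φ (x - t)) / t * Real.exp (-δ * t) : ℝ) =
      (φ (x + t) - φ (x - t)) * (Real.exp (-δ * t) / t) by ring, Complex.ofReal_mul, hpt,
      ← integral_mul_const]
    refine integral_congr_ae (.of_forall fun ξ => ?_)
    simp only [hH]
    push_cast
    ring
  rw [← hL, hswap]
  refine integral_congr_ae (.of_forall fun ξ => ?_)
  simp only [hH]
  rw [integral_const_mul, integral_const_mul, integral_complex_ofReal, integral_sin_div_mul_exp hδ]

/-- Removal of the damping: as δ → 0+ the factor 2i arctan(2πξ/δ) tends to iπ sign ξ, with dominated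
convergence on both sides. -/
lemma hilbertSchwartz_eq (φ : 𝓢(ℝ, ℝ)) (x : ℝ) :
    (hilbertSchwartz φ x : ℂ) = 𝓕⁻ (fun ξ => hilbertMult ξ * (𝓕 (toComplex φ)) ξ) x := by
  have hlim1 : Tendsto (fun δ : ℝ => ((∫ t in Set.Ioi (0 : ℝ), (φ (x + t) - φ (x - t)) / t *
      Real.exp (-δ * t) : ℝ) : ℂ)) (𝓝[>] 0) (𝓝 (hilbertSchwartz φ x : ℂ)) := by
    refine (Complex.continuous_ofReal.tendsto _).comp ?_
    have hi := integrable_hilbert_kernel φ x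
    refine tendsto_integral_filter_of_dominated_convergence
      (fun t => ‖(φ (x + t) - φ (x - t)) / t‖) ?_ ?_ hi.norm ?_
    · refine .of_forall fun δ => hi.1.mul ?_
      exact (by fun_prop : Continuous fun t => Real.exp (-δ * t)).aestronglyMeasurable
    · filter_upwards [self_mem_nhdsWithin] with δ hδ
      filter_upwards [ae_restrict_mem measurableSet_Ioi] with t ht
      rw [norm_mul, Real.norm_eq_abs (Real.exp _), abs_of_pos (Real.exp_pos _)]
      refine mul_le_of_le_one_right (norm_nonneg _) (Real.exp_le_one_iff.2 ?_)
      have := mul_pos (Set.mem_Ioi.1 hδ) (Set.mem_Ioi.1 ht)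
      linarith
    · refine .of_forall fun t => ?_
      have : Tendsto (fun δ : ℝ => Real.exp (-δ * t)) (𝓝[>] 0) (𝓝 (Real.exp (-0 * t))) :=
        ((by fun_prop : Continuous fun δ : ℝ => Real.exp (-δ * t)).tendsto 0).mono_left
          nhdsWithin_le_nhds
      simpa using this.const_mul ((φ (x + t) - φ (x - t)) / t)
  have hΦ := (𝓕 (toComplex φ)).integrable (μ := volume)
  have hlim2 : Tendsto (fun δ : ℝ => ∫ ξ : ℝ, Complex.exp ((2 * π * (x * ξ) : ℝ) * Complex.I) *
      (𝓕 (toComplex φ)) ξ * (2 * Complex.I * Real.arctan (2 * π * ξ / δ))) (𝓝[>] 0)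
      (𝓝 (𝓕⁻ (fun ξ => hilbertMult ξ * (𝓕 (toComplex φ)) ξ) x)) := by
    rw [Real.fourierInv_eq']
    refine tendsto_integral_filter_of_dominated_convergence
      (fun ξ => ‖(𝓕 (toComplex φ)) ξ‖ * π) ?_ ?_ (hΦ.norm.mul_const _) ?_
    · refine .of_forall fun δ => ?_
      have h1 : Continuous fun ξ => Complex.exp ((2 * π * (x * ξ) : ℝ) * Complex.I) *
        (𝓕 (toComplex φ)) ξ := (by fun_prop : Continuous fun ξ : ℝ =>
          Complex.exp ((2 * π * (x * ξ) : ℝ) * Complex.I)).mul (𝓕 (toComplex φ)).continuous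
      have h2 : Continuous fun ξ : ℝ => Real.arctan (2 * π * ξ / δ) :=
        Real.continuous_arctan.comp (by fun_prop)
      exact (h1.mul (continuous_const.mul
        (Complex.continuous_ofReal.comp h2))).aestronglyMeasurable
    · refine .of_forall fun δ => .of_forall fun ξ => ?_
      rw [norm_mul, norm_mul, Complex.norm_exp_ofReal_mul_I, one_mul, norm_mul, norm_mul,
        Complex.norm_I, Complex.norm_ofNat, Complex.norm_real, Real.norm_eq_abs]
      gcongr
      have := Real.arctan_lt_pi_div_two (2 * π * ξ / δ)
      have := Real.neg_pi_div_two_lt_arctan (2 * π * ξ / δ)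
      have : |Real.arctan (2 * π * ξ / δ)| ≤ π / 2 := abs_le.2 ⟨by linarith, by linarith⟩
      linarith
    · refine .of_forall fun ξ => ?_
      have h1 := (Complex.continuous_ofReal.tendsto _).comp (tendsto_arctan_div (2 * π * ξ))
      have h2 := (h1.const_mul (2 * Complex.I)).const_mul
        (Complex.exp ((2 * π * (x * ξ) : ℝ) * Complex.I) * (𝓕 (toComplex φ)) ξ)
      refine (h2.congr fun δ => rfl).trans (le_of_eq ?_)
      have hs : Real.sign (2 * π * ξ) = Real.sign ξ := by
        have hp := Real.pi_pos
        rcases lt_trichotomy ξ 0 with h | rfl | h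
        · rw [Real.sign_of_neg h, Real.sign_of_neg (by nlinarith)]
        · simp
        · rw [Real.sign_of_pos h, Real.sign_of_pos (by positivity)]
      rw [hs, hilbertMult]
      congr 1
      simp only [smul_eq_mul, RCLike.inner_apply, conj_trivial]
      push_cast
      ring
  refine tendsto_nhds_unique (hlim1.congr' ?_) hlim2
  filter_upwards [self_mem_nhdsWithin] with δ hδ
  exact hilbertSchwartz_regularised φ x hδ

end fourier

section fourier

open scoped FourierTransform Real ENNReal

/-! ### Bounded operators on `L²` given by operations on functions -/

section lpMap

variable {α β 𝕜 F G : Type*} [MeasurableSpace α] [MeasurableSpace β] {μ : Measure α}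
  {ν : Measure β} [RCLike 𝕜] [NormedAddCommGroup F] [NormedSpace 𝕜 F] [NormedAddCommGroup G]
  [NormedSpace 𝕜 G]

/-- `Φ` acts boundedly from `L²(μ)` to `L²(ν)`. -/
def LpBounded (μ : Measure α) (ν : Measure β) (Φ : (α → F) →ₗ[𝕜] (β → G)) (C : ℝ) : Prop :=
  ∀ f, MemLp f 2 μ → MemLp (Φ f) 2 ν ∧ eLpNorm (Φ f) 2 ν ≤ ENNReal.ofReal C * eLpNorm f 2 μ

lemma LpBounded.ae_congr {Φ : (α → F) →ₗ[𝕜] (β → G)} {C : ℝ} (h : LpBounded μ ν Φ C)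
    {f g : α → F} (hf : MemLp f 2 μ) (hg : MemLp g 2 μ) (hfg : f =ᵐ[μ] g) : Φ f =ᵐ[ν] Φ g := by
  obtain ⟨h1, h2⟩ := h (f - g) (hf.sub hg)
  have h3 : f - g =ᵐ[μ] 0 := by filter_upwards [hfg] with x hx; simp [hx]
  rw [eLpNorm_congr_ae h3, eLpNorm_zero, mul_zero, nonpos_iff_eq_zero,
    eLpNorm_eq_zero_iff h1.1 (by norm_num), map_sub] at h2
  filter_upwards [h2] with x hx
  simpa [sub_eq_zero] using hx

/-- The operator from `L²(μ)` to `L²(ν)` induced by `Φ`. -/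
def lpMap (Φ : (α → F) →ₗ[𝕜] (β → G)) (C : ℝ) (h : LpBounded μ ν Φ C) :
    Lp F 2 μ →L[𝕜] Lp G 2 ν :=
  LinearMap.mkContinuous
    { toFun := fun x => (h x (Lp.memLp x)).1.toLp _
      map_add' := fun x y => by
        rw [← MemLp.toLp_add, MemLp.toLp_eq_toLp_iff]
        rw [← map_add]
        exact h.ae_congr (Lp.memLp _) ((Lp.memLp x).add (Lp.memLp y)) (Lp.coeFn_add x y)
      map_smul' := fun c x => by
        rw [RingHom.id_apply, ← MemLp.toLp_const_smul, MemLp.toLp_eq_toLp_iff]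
        rw [← map_smul]
        exact h.ae_congr (Lp.memLp _) ((Lp.memLp x).const_smul c) (Lp.coeFn_smul c x) }
    (max C 0) fun x => by
      have := (h x (Lp.memLp x)).2
      change ‖(h x (Lp.memLp x)).1.toLp _‖ ≤ _
      rw [Lp.norm_toLp, Lp.norm_def]
      refine (ENNReal.toReal_mono
        (ENNReal.mul_ne_top ENNReal.ofReal_ne_top (Lp.eLpNorm_ne_top x)) this).trans ?_
      rw [ENNReal.toReal_mul, ENNReal.toReal_ofReal', mul_comm]

lemma lpMap_coeFn {Φ : (α → F) →ₗ[𝕜] (β → G)} {C : ℝ} (h : LpBounded μ ν Φ C) (x : Lp F 2 μ) :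
    lpMap Φ C h x =ᵐ[ν] Φ x := (h x (Lp.memLp x)).1.coeFn_toLp

end lpMap

/-! ### The Hilbert transform on `L²` -/

/-- Pointwise multiplication, as a linear map on functions. -/
def mulFun {α 𝕜 : Type*} [RCLike 𝕜] (m : α → 𝕜) : (α → 𝕜) →ₗ[𝕜] (α → 𝕜) :=
  LinearMap.mulLeft 𝕜 m

lemma lpBounded_hilbertMult : LpBounded volume volume (mulFun hilbertMult) π := fun f hf => by
  have hm : AEStronglyMeasurable (mulFun hilbertMult f) volume :=
    measurable_hilbertMult.aestronglyMeasurable.mul hf.1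
  have hb : ∀ x, ‖mulFun hilbertMult f x‖ ≤ π * ‖f x‖ := fun x => by
    change ‖hilbertMult x * f x‖ ≤ _
    rw [norm_mul]
    gcongr
    exact norm_hilbertMult_le x
  exact ⟨hf.of_le_mul hm (.of_forall hb), eLpNorm_le_mul_eLpNorm_of_ae_le_mul (.of_forall hb) 2⟩

/-- Multiplication by `iπ sign ξ` on `L²`. -/
def multL2 : Lp ℂ 2 (volume : Measure ℝ) →L[ℂ] Lp ℂ 2 (volume : Measure ℝ) :=
  lpMap _ _ lpBounded_hilbertMult

lemma multL2_coeFn (x : Lp ℂ 2 (volume : Measure ℝ)) :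
    multL2 x =ᵐ[volume] fun ξ => hilbertMult ξ * x ξ := lpMap_coeFn _ x

/-- The Hilbert transform on complex `L²`. -/
def hilbertL2 : Lp ℂ 2 (volume : Measure ℝ) →L[ℂ] Lp ℂ 2 (volume : Measure ℝ) :=
  ((Lp.fourierTransformₗᵢ ℝ ℂ).symm.toContinuousLinearEquiv.toContinuousLinearMap).comp
    (multL2.comp (Lp.fourierTransformₗᵢ ℝ ℂ).toContinuousLinearEquiv.toContinuousLinearMap)

lemma hilbertL2_apply (x : Lp ℂ 2 (volume : Measure ℝ)) : hilbertL2 x = 𝓕⁻ (multL2 (𝓕 x)) := rfl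

/-- The inclusion of real `L²` in complex `L²`. -/
def ofRealL2 : Lp ℝ 2 (volume : Measure ℝ) →L[ℝ] Lp ℂ 2 (volume : Measure ℝ) :=
  Complex.ofRealCLM.compLpL 2 volume

/-- The real part on `L²`. -/
def reL2 : Lp ℂ 2 (volume : Measure ℝ) →L[ℝ] Lp ℝ 2 (volume : Measure ℝ) :=
  Complex.reCLM.compLpL 2 volume

lemma ofRealL2_coeFn (x : Lp ℝ 2 (volume : Measure ℝ)) :
    ofRealL2 x =ᵐ[volume] fun t => (x t : ℂ) := Complex.ofRealCLM.coeFn_compLpL x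

lemma reL2_coeFn (x : Lp ℂ 2 (volume : Measure ℝ)) :
    reL2 x =ᵐ[volume] fun t => (x t).re := Complex.reCLM.coeFn_compLpL x

/-- The Hilbert transform on real `L²`. -/
def hilbertR : Lp ℝ 2 (volume : Measure ℝ) →L[ℝ] Lp ℝ 2 (volume : Measure ℝ) :=
  reL2.comp ((hilbertL2.restrictScalars ℝ).comp ofRealL2)

lemma hilbertR_apply (x : Lp ℝ 2 (volume : Measure ℝ)) :
    hilbertR x = reL2 (hilbertL2 (ofRealL2 x)) := rfl

lemma memLp_ofReal {f : ℝ → ℝ} (hf : MemLp f 2 volume) :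
    MemLp (fun t => (f t : ℂ)) 2 volume := hf.ofReal

lemma ofRealL2_toLp {f : ℝ → ℝ} (hf : MemLp f 2 volume) :
    ofRealL2 (hf.toLp f) = (memLp_ofReal hf).toLp _ := by
  refine Lp.ext ((ofRealL2_coeFn _).trans ?_)
  filter_upwards [hf.coeFn_toLp, (memLp_ofReal hf).coeFn_toLp] with t h1 h2
  rw [h1, h2]

lemma hilbertSchwartz_ae_eq (φ : 𝓢(ℝ, ℝ)) :
    (fun x => (hilbertSchwartz φ x : ℂ)) =ᵐ[volume]
      hilbertL2 (ofRealL2 (φ.toLp 2 (volume : Measure ℝ))) := by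
  have hm : MemLp (fun ξ => hilbertMult ξ * (𝓕 (toComplex φ)) ξ) 2 volume :=
    (lpBounded_hilbertMult _ ((𝓕 (toComplex φ)).memLp 2 volume)).1
  have hi : Integrable (fun ξ => hilbertMult ξ * (𝓕 (toComplex φ)) ξ) volume :=
    (𝓕 (toComplex φ)).integrable.bdd_mul measurable_hilbertMult.aestronglyMeasurable
      (.of_forall norm_hilbertMult_le)
  have h1 := fourierInv_toLp_ae_eq hi hm
  have h2 : ofRealL2 (φ.toLp 2 (volume : Measure ℝ)) = (toComplex φ).toLp 2 := by
    refine Lp.ext ((ofRealL2_coeFn _).trans ?_)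
    filter_upwards [φ.coeFn_toLp 2 volume, (toComplex φ).coeFn_toLp 2 volume] with t h1 h2
    rw [h1, h2]; rfl
  have h3 : hm.toLp _ = multL2 (𝓕 ((toComplex φ).toLp 2 (volume : Measure ℝ))) := by
    refine Lp.ext (hm.coeFn_toLp.trans (EventuallyEq.trans ?_ (multL2_coeFn _).symm))
    rw [SchwartzMap.toLp_fourier_eq]
    filter_upwards [(𝓕 (toComplex φ)).coeFn_toLp 2 volume] with ξ h
    rw [h]
  rw [hilbertL2_apply, h2, ← h3]
  refine EventuallyEq.trans (.of_forall fun x => ?_) h1.symm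
  exact hilbertSchwartz_eq φ x

lemma hilbertSchwartz_ae_eq_hilbertR (φ : 𝓢(ℝ, ℝ)) :
    hilbertSchwartz φ =ᵐ[volume] hilbertR (φ.toLp 2 (volume : Measure ℝ)) := by
  rw [hilbertR_apply]
  filter_upwards [hilbertSchwartz_ae_eq φ, reL2_coeFn (hilbertL2 (ofRealL2
    (φ.toLp 2 (volume : Measure ℝ))))] with x h1 h2
  rw [h2, ← h1, Complex.ofReal_re]

/-- On Schwartz functions the transform is the restriction of a bounded operator, so the limit does
not depend on the approximating sequence. The choice made in `hilbert` is therefore harmless up to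
null sets. -/
lemma IsHilbertTransform.toLp_eq {f g : ℝ → ℝ} (h : IsHilbertTransform f g) :
    h.2.1.toLp g = hilbertR (h.1.toLp f) := by
  obtain ⟨hf, hg, φ, h1, h2⟩ := h
  have t1 : Tendsto (fun n => (φ n).toLp 2 (volume : Measure ℝ)) atTop (𝓝 (hf.toLp f)) := by
    rw [Lp.tendsto_Lp_iff_tendsto_eLpNorm']
    refine h1.congr fun n => eLpNorm_congr_ae ?_
    filter_upwards [(φ n).coeFn_toLp 2 volume, hf.coeFn_toLp] with x hx hx'
    rw [Pi.sub_apply, hx, hx']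
  have t2 : Tendsto (fun n => hilbertR ((φ n).toLp 2 (volume : Measure ℝ))) atTop
      (𝓝 (hg.toLp g)) := by
    rw [Lp.tendsto_Lp_iff_tendsto_eLpNorm']
    refine h2.congr fun n => eLpNorm_congr_ae ?_
    filter_upwards [hilbertSchwartz_ae_eq_hilbertR (φ n), hg.coeFn_toLp] with x hx hx'
    rw [Pi.sub_apply, hx, hx']
  exact tendsto_nhds_unique t2 ((hilbertR.continuous.tendsto _).comp t1)

lemma exists_schwartz_tendsto {f : ℝ → ℝ} (hf : MemLp f 2 volume) :
    ∃ φ : ℕ → 𝓢(ℝ, ℝ), Tendsto (fun n => (φ n).toLp 2 (volume : Measure ℝ)) atTop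
      (𝓝 (hf.toLp f)) := by
  have hd := SchwartzMap.denseRange_toLpCLM (F := ℝ) (p := 2) (μ := (volume : Measure ℝ))
    ENNReal.ofNat_ne_top
  obtain ⟨u, hu, hlim⟩ := mem_closure_iff_seq_limit.1 (hd (hf.toLp f))
  choose φ hφ using hu
  exact ⟨φ, hlim.congr fun n => (hφ n).symm⟩

lemma isHilbertTransform_hilbertR {f : ℝ → ℝ} (hf : MemLp f 2 volume) :
    IsHilbertTransform f (hilbertR (hf.toLp f)) := by
  obtain ⟨φ, hφ⟩ := exists_schwartz_tendsto hf
  refine ⟨hf, Lp.memLp _, φ, ?_, ?_⟩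
  · have := hφ
    rw [Lp.tendsto_Lp_iff_tendsto_eLpNorm'] at this
    refine this.congr fun n => eLpNorm_congr_ae ?_
    filter_upwards [(φ n).coeFn_toLp 2 volume, hf.coeFn_toLp] with x hx hx'
    rw [Pi.sub_apply, hx, hx']
  · have := (hilbertR.continuous.tendsto _).comp hφ
    rw [Lp.tendsto_Lp_iff_tendsto_eLpNorm'] at this
    refine this.congr fun n => eLpNorm_congr_ae ?_
    filter_upwards [hilbertSchwartz_ae_eq_hilbertR (φ n)] with x hx
    rw [Pi.sub_apply, Function.comp_apply, hx]

lemma hilbert_ae_eq {f : ℝ → ℝ} (hf : MemLp f 2 volume) :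
    hilbert f =ᵐ[volume] hilbertR (hf.toLp f) := by
  have he : ∃ g, IsHilbertTransform f g := ⟨_, isHilbertTransform_hilbertR hf⟩
  rw [hilbert, dif_pos he]
  have h := he.choose_spec.toLp_eq
  filter_upwards [he.choose_spec.2.1.coeFn_toLp] with x hx
  rw [← hx, h]

lemma memLp_hilbert {f : ℝ → ℝ} (hf : MemLp f 2 volume) : MemLp (hilbert f) 2 volume :=
  (memLp_congr_ae (hilbert_ae_eq hf)).2 (Lp.memLp _)

lemma hilbert_congr_ae {f g : ℝ → ℝ} (hf : MemLp f 2 volume) (h : f =ᵐ[volume] g) :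
    hilbert f =ᵐ[volume] hilbert g := by
  have hg : MemLp g 2 volume := (memLp_congr_ae h).1 hf
  refine (hilbert_ae_eq hf).trans (EventuallyEq.trans ?_ (hilbert_ae_eq hg).symm)
  rw [(MemLp.toLp_eq_toLp_iff hf hg).2 h]

lemma inner_reL2 (a : Lp ℝ 2 (volume : Measure ℝ)) (z : Lp ℂ 2 (volume : Measure ℝ)) :
    inner ℝ a (reL2 z) = (inner ℂ (ofRealL2 a) z : ℂ).re := by
  rw [L2.inner_def, L2.inner_def, ← RCLike.re_eq_complex_re, ← integral_re (L2.integrable_inner _ _)]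
  refine integral_congr_ae ?_
  filter_upwards [reL2_coeFn z, ofRealL2_coeFn a] with x h1 h2
  rw [h1, h2]
  simp [mul_comm]

/-- Plancherel: on the Fourier side the Hilbert transform becomes multiplication by iπ sign ξ. -/
lemma inner_hilbertR (a b : Lp ℝ 2 (volume : Measure ℝ)) :
    inner ℝ a (hilbertR b) = (inner ℂ (𝓕 (ofRealL2 a)) (multL2 (𝓕 (ofRealL2 b))) : ℂ).re := by
  rw [hilbertR_apply, inner_reL2, hilbertL2_apply, ← Lp.inner_fourier_eq,
    FourierTransform.fourier_fourierInv_eq]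

lemma conj_hilbertMult (ξ : ℝ) : starRingEnd ℂ (hilbertMult ξ) = -hilbertMult ξ := by
  simp [hilbertMult]

lemma inner_multL2 (x y : Lp ℂ 2 (volume : Measure ℝ)) :
    inner ℂ x (multL2 y) = -inner ℂ (multL2 x) y := by
  rw [L2.inner_def, L2.inner_def, ← integral_neg]
  refine integral_congr_ae ?_
  filter_upwards [multL2_coeFn x, multL2_coeFn y] with ξ h1 h2
  rw [h1, h2]
  simp only [RCLike.inner_apply, map_mul, conj_hilbertMult]
  ring

/-- The multiplier is purely imaginary, so its adjoint is its negative. -/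
lemma inner_hilbertR_antisymm (a b : Lp ℝ 2 (volume : Measure ℝ)) :
    inner ℝ a (hilbertR b) = -inner ℝ b (hilbertR a) := by
  rw [inner_hilbertR, inner_hilbertR, inner_multL2, Complex.neg_re, ← inner_conj_symm,
    Complex.conj_re]

lemma integral_mul_hilbert_antisymm {f g : ℝ → ℝ} (hf : MemLp f 2 volume)
    (hg : MemLp g 2 volume) : ∫ x, f x * hilbert g x = -∫ x, g x * hilbert f x := by
  have key : ∀ {f g : ℝ → ℝ} (hf : MemLp f 2 volume) (hg : MemLp g 2 volume),
      ∫ x, f x * hilbert g x = inner ℝ (hf.toLp f) (hilbertR (hg.toLp g)) := by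
    intro f g hf hg
    rw [L2.inner_def]
    refine integral_congr_ae ?_
    filter_upwards [hf.coeFn_toLp, hilbert_ae_eq hg] with x h1 h2
    rw [h1, h2]
    simp [mul_comm]
  rw [key hf hg, key hg hf, inner_hilbertR_antisymm]

/-! ### The Fourier transform of weakly differentiable functions -/

lemma fourierInt_eq_fourier (f : ℝ → ℝ) (ξ : ℝ) :
    fourierInt f ξ = 𝓕 (fun t => (f t : ℂ)) (ξ / (2 * π)) := by
  rw [Real.fourier_real_eq_integral_exp_smul, fourierInt]
  congr 1
  ext t
  rw [smul_eq_mul, mul_comm]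
  congr 2
  have : (π : ℂ) ≠ 0 := by exact_mod_cast Real.pi_ne_zero
  push_cast
  field_simp

lemma fourierInt_eq_cos_sin {f : ℝ → ℝ} (hf : Integrable f) (ξ : ℝ) :
    fourierInt f ξ = ((∫ t, f t * Real.cos (ξ * t) : ℝ) : ℂ) -
      Complex.I * ((∫ t, f t * Real.sin (ξ * t) : ℝ) : ℂ) := by
  have i1 : Integrable fun t => f t * Real.cos (ξ * t) :=
    hf.mul_bdd (c := 1) (by fun_prop) (.of_forall fun t => Real.abs_cos_le_one _)
  have i2 : Integrable fun t => f t * Real.sin (ξ * t) :=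
    hf.mul_bdd (c := 1) (by fun_prop) (.of_forall fun t => Real.abs_sin_le_one _)
  rw [← integral_complex_ofReal, ← integral_complex_ofReal, ← integral_const_mul,
    ← integral_sub i1.ofReal (i2.ofReal.const_mul _), fourierInt]
  congr 1
  ext t
  rw [show -(Complex.I * t * ξ) = (-(ξ * t : ℝ) : ℂ) * Complex.I by push_cast; ring,
    Complex.exp_mul_I]
  simp only [Complex.cos_neg, Complex.sin_neg]
  push_cast
  ring

/-- Weak derivatives are tested on real functions, so the exponential is split into cosine and sine.
These lack compact support but are bounded with bounded derivatives, which suffices when f and g are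
integrable. -/
lemma HasWeakDeriv.fourierInt_eq {f g : ℝ → ℝ} (h : HasWeakDeriv f g) (hf : Integrable f)
    (hg : Integrable g) (ξ : ℝ) : fourierInt g ξ = Complex.I * ξ * fourierInt f ξ := by
  have hdc : ∀ t, HasDerivAt (fun t => Real.cos (ξ * t)) (-ξ * Real.sin (ξ * t)) t := fun t => by
    have := ((hasDerivAt_id' t).const_mul ξ).cos
    convert this using 1
    ring
  have hds : ∀ t, HasDerivAt (fun t => Real.sin (ξ * t)) (ξ * Real.cos (ξ * t)) t := fun t => by
    have := ((hasDerivAt_id' t).const_mul ξ).sin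
    convert this using 1
    ring
  have hC : (1 : ℝ) ≤ 1 + |ξ| := by linarith [abs_nonneg ξ]
  have hc1 : ∀ s, |Real.cos s| ≤ 1 := Real.abs_cos_le_one
  have hs1 : ∀ s, |Real.sin s| ≤ 1 := Real.abs_sin_le_one
  have e1 := h.integral_mul_deriv hf hg (b := fun t => Real.cos (ξ * t)) (C := 1 + |ξ|)
    (by fun_prop) (fun t => (hc1 _).trans hC) (fun t => by
      rw [(hdc t).deriv, abs_mul, abs_neg]
      nlinarith [hs1 (ξ * t), abs_nonneg ξ, abs_nonneg (Real.sin (ξ * t))])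
  have e2 := h.integral_mul_deriv hf hg (b := fun t => Real.sin (ξ * t)) (C := 1 + |ξ|)
    (by fun_prop) (fun t => (hs1 _).trans hC) (fun t => by
      rw [(hds t).deriv, abs_mul]
      nlinarith [hc1 (ξ * t), abs_nonneg ξ, abs_nonneg (Real.cos (ξ * t))])
  simp only [(hdc _).deriv, (hds _).deriv] at e1 e2
  have e1' : ∫ t, g t * Real.cos (ξ * t) = ξ * ∫ t, f t * Real.sin (ξ * t) := by
    rw [← integral_const_mul, ← neg_eq_iff_eq_neg.2 e1, ← integral_neg]
    congr 1; ext t; ring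
  have e2' : ∫ t, g t * Real.sin (ξ * t) = -(ξ * ∫ t, f t * Real.cos (ξ * t)) := by
    rw [← integral_const_mul, ← neg_eq_iff_eq_neg.2 e2, neg_inj]
    congr 1; ext t; ring
  rw [fourierInt_eq_cos_sin hf, fourierInt_eq_cos_sin hg, e1', e2']
  push_cast
  linear_combination ((ξ : ℂ) * (∫ t, f t * Real.sin (ξ * t) : ℝ)) * Complex.I_sq

lemma HasWeakDeriv.fourier_eq {f g : ℝ → ℝ} (h : HasWeakDeriv f g) (hf : Integrable f)
    (hg : Integrable g) (ξ : ℝ) :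
    𝓕 (fun t => (g t : ℂ)) ξ = 2 * π * Complex.I * ξ * 𝓕 (fun t => (f t : ℂ)) ξ := by
  have h1 := h.fourierInt_eq hf hg (2 * π * ξ)
  have h2 : 2 * π * ξ / (2 * π) = ξ := by have := Real.pi_ne_zero; field_simp
  rw [fourierInt_eq_fourier, fourierInt_eq_fourier, h2] at h1
  rw [h1]
  push_cast
  ring

lemma memLp_fourier {f : ℝ → ℝ} (h1 : Integrable f) (h2 : MemLp f 2 volume) :
    MemLp (𝓕 (fun t => (f t : ℂ))) 2 volume :=
  (memLp_congr_ae (fourier_toLp_ae_eq h1.ofReal (memLp_ofReal h2))).1 (Lp.memLp _)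

/-- A function of class `H¹` has its Fourier transform in `L²(|ξ| dξ)`. -/
lemma HasWeakDeriv.integrable_fourierInt {f g : ℝ → ℝ} (h : HasWeakDeriv f g) (hf : Integrable f)
    (hg : Integrable g) (hf2 : MemLp f 2 volume) (hg2 : MemLp g 2 volume) :
    Integrable fun ξ => |ξ| * ‖fourierInt f ξ‖ ^ 2 := by
  -- Up to scaling, |ξ||f̂|² is |ĝ||f̂|, a product of two L² functions.
  have h1 : Integrable fun ξ => ‖𝓕 (fun t => (g t : ℂ)) ξ‖ * ‖𝓕 (fun t => (f t : ℂ)) ξ‖ :=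
    (memLp_fourier hg hg2).norm.integrable_mul (memLp_fourier hf hf2).norm
  have hp := Real.pi_pos
  have h3 := h1.comp_div (R := 2 * π) (by positivity)
  refine h3.congr (.of_forall fun ξ => ?_)
  simp only
  rw [h.fourier_eq hf hg, fourierInt_eq_fourier]
  simp only [norm_mul, Complex.norm_I, Complex.norm_real, Complex.norm_ofNat, Real.norm_eq_abs,
    abs_of_pos hp, Complex.ofReal_div, norm_div, mul_one, Complex.ofReal_mul,
    Complex.ofReal_ofNat]
  field_simp

/-- The `L²(|ξ| dξ)` pairing of Fourier transforms in terms of the Hilbert transform. -/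
lemma HasWeakDeriv.integral_mul_hilbert {f f' g : ℝ → ℝ} (h : HasWeakDeriv f f')
    (hf : Integrable f) (hf' : Integrable f') (hf'2 : MemLp f' 2 volume)
    (hg : Integrable g) (hg2 : MemLp g 2 volume) :
    (∫ ξ : ℝ, ((|ξ| : ℝ) : ℂ) * (fourierInt f ξ * starRingEnd ℂ (fourierInt g ξ))).re =
      2 * ∫ x, f' x * hilbert g x := by
  have hp := Real.pi_pos
  have e1 : ∫ x, f' x * hilbert g x = inner ℝ (hf'2.toLp f') (hilbertR (hg2.toLp g)) := by
    rw [L2.inner_def]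
    refine integral_congr_ae ?_
    filter_upwards [hf'2.coeFn_toLp, hilbert_ae_eq hg2] with x h1 h2
    rw [h1, h2]
    simp [mul_comm]
  -- The derivative contributes 2πiξ and the Hilbert transform iπ sign ξ; after conjugating the
  -- first, the product is 2π²|ξ|.
  have e2 : (inner ℂ (𝓕 (ofRealL2 (hf'2.toLp f'))) (multL2 (𝓕 (ofRealL2 (hg2.toLp g)))) : ℂ) =
      2 * π ^ 2 * ∫ ξ : ℝ, ((|ξ| : ℝ) : ℂ) * (starRingEnd ℂ (𝓕 (fun t => (f t : ℂ)) ξ) *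
        𝓕 (fun t => (g t : ℂ)) ξ) := by
    rw [L2.inner_def, ← integral_const_mul]
    refine integral_congr_ae ?_
    have a1 := fourier_toLp_ae_eq (f := fun t => (f' t : ℂ)) hf'.ofReal (memLp_ofReal hf'2)
    have a2 := fourier_toLp_ae_eq (f := fun t => (g t : ℂ)) hg.ofReal (memLp_ofReal hg2)
    rw [← ofRealL2_toLp hf'2] at a1
    rw [← ofRealL2_toLp hg2] at a2
    filter_upwards [a1, a2, multL2_coeFn (𝓕 (ofRealL2 (hg2.toLp g)))] with ξ b1 b2 b3
    rw [b1, b3, b2]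
    have hF := h.fourier_eq hf hf' ξ
    rw [hF]
    have hs : ((|ξ| : ℝ) : ℂ) = ξ * Real.sign ξ := by
      rcases lt_trichotomy ξ 0 with h | rfl | h
      · rw [Real.sign_of_neg h, abs_of_neg h]; simp
      · simp
      · rw [Real.sign_of_pos h, abs_of_pos h]; simp
    rw [hs, hilbertMult]
    simp only [RCLike.inner_apply, map_mul, Complex.conj_ofReal, Complex.conj_I, map_ofNat]
    linear_combination (-2 * π ^ 2 * ξ * Real.sign ξ * starRingEnd ℂ (𝓕 (fun t => (f t : ℂ)) ξ) *
      𝓕 (fun t => (g t : ℂ)) ξ) * Complex.I_sq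
  set G : ℝ → ℂ := fun ξ => ((|ξ| : ℝ) : ℂ) * (starRingEnd ℂ (𝓕 (fun t => (f t : ℂ)) ξ) *
        𝓕 (fun t => (g t : ℂ)) ξ) with hG
  -- Passing between the two Fourier conventions rescales ξ by 2π, once in |ξ| and once in dξ,
  -- whence 4π². The quotient 4π²/2π² is the factor 2 in the statement.
  have e3 : ∫ ξ : ℝ, ((|ξ| : ℝ) : ℂ) * (fourierInt f ξ * starRingEnd ℂ (fourierInt g ξ)) =
      4 * π ^ 2 * starRingEnd ℂ (∫ ξ, G ξ) := by
    have hs := Measure.integral_comp_div (fun ξ => starRingEnd ℂ (G ξ)) (2 * π)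
    rw [← integral_conj]
    have : ∀ ξ : ℝ, ((|ξ| : ℝ) : ℂ) * (fourierInt f ξ * starRingEnd ℂ (fourierInt g ξ)) =
        2 * π * starRingEnd ℂ (G (ξ / (2 * π))) := fun ξ => by
      rw [fourierInt_eq_fourier, fourierInt_eq_fourier, hG]
      simp only [map_mul, Complex.conj_conj, Complex.conj_ofReal, abs_div, abs_mul, abs_two,
        abs_of_pos hp]
      have : (π : ℂ) ≠ 0 := by exact_mod_cast Real.pi_ne_zero
      push_cast
      field_simp
    simp only [this]
    rw [integral_const_mul, hs, abs_of_pos (by positivity : 0 < 2 * π), Complex.real_smul]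
    push_cast
    ring
  rw [e1, inner_hilbertR, e2, e3]
  have r1 : (4 * π ^ 2 : ℂ) = ((4 * π ^ 2 : ℝ) : ℂ) := by push_cast; ring
  have r2 : (2 * π ^ 2 : ℂ) = ((2 * π ^ 2 : ℝ) : ℂ) := by push_cast; ring
  rw [r1, r2, Complex.re_ofReal_mul, Complex.re_ofReal_mul, Complex.conj_re]
  ring

end fourier

/-! ### The logarithmic kernel -/

/-- The negative part of `log |t|`. -/
def negLog (t : ℝ) : ℝ := max 0 (-Real.log |t|)

lemma negLog_nonneg (t : ℝ) : 0 ≤ negLog t := le_max_left _ _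

lemma measurable_negLog : Measurable negLog := by
  unfold negLog
  fun_prop

lemma integrable_negLog : Integrable negLog := by
  have h1 : IntegrableOn Real.log (Set.Icc (-1) 1) := by
    have := (intervalIntegral.intervalIntegrable_log' (a := -1) (b := 1))
    rwa [intervalIntegrable_iff_integrableOn_Icc_of_le (by norm_num)] at this
  have h2 : IntegrableOn negLog (Set.Icc (-1) 1) := by
    refine h1.norm.mono' measurable_negLog.aestronglyMeasurable (.of_forall fun t => ?_)
    rw [Real.norm_eq_abs, abs_of_nonneg (negLog_nonneg t), negLog, Real.log_abs, Real.norm_eq_abs]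
    exact max_le (abs_nonneg _) (neg_le_abs _)
  refine h2.integrable_of_forall_notMem_eq_zero fun t ht => ?_
  rw [negLog, max_eq_left]
  have : 1 ≤ |t| := by
    by_contra! h
    exact ht (abs_le.1 h.le)
  linarith [Real.log_nonneg this]

lemma log_abs_le (t : ℝ) : Real.log |t| ≤ Real.log (1 + |t|) := by
  rcases eq_or_ne t 0 with rfl | h
  · simp
  · exact Real.log_le_log (abs_pos.2 h) (by linarith [abs_nonneg t])

lemma log_one_add_abs_nonneg (t : ℝ) : 0 ≤ Real.log (1 + |t|) :=
  Real.log_nonneg (by linarith [abs_nonneg t])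

/-- The bracket on the right is the positive part of log|t|. -/
lemma log_one_add_le (t : ℝ) : Real.log (1 + |t|) ≤ Real.log 2 + (Real.log |t| + negLog t) := by
  have h0 : 0 ≤ Real.log |t| + negLog t := by
    have : -Real.log |t| ≤ negLog t := le_max_right _ _
    linarith
  rcases le_or_gt |t| 1 with h | h
  · have := Real.log_le_log (by linarith [abs_nonneg t]) (by linarith : 1 + |t| ≤ 2)
    linarith
  · have h1 : Real.log (1 + |t|) ≤ Real.log (2 * |t|) :=
      Real.log_le_log (by linarith) (by linarith)
    rw [Real.log_mul two_ne_zero (by linarith)] at h1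
    linarith [negLog_nonneg t]

/-- Splits the kernel into a part of logarithmic growth and an integrable singularity at 0. -/
lemma abs_log_abs_le (t : ℝ) : |(Real.log |t|)| ≤ Real.log (1 + |t|) + negLog t := by
  rw [abs_le]
  constructor
  · have := log_one_add_abs_nonneg t
    have : -Real.log |t| ≤ negLog t := le_max_right _ _
    linarith
  · linarith [log_abs_le t, negLog_nonneg t]

lemma log_one_add_sub_le (x y : ℝ) :
    Real.log (1 + |x - y|) ≤ Real.log (1 + |x|) + Real.log (1 + |y|) := by
  rw [← Real.log_mul (by positivity) (by positivity)]
  refine Real.log_le_log (by positivity) ?_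
  nlinarith [abs_sub x y, abs_nonneg x, abs_nonneg y, mul_nonneg (abs_nonneg x) (abs_nonneg y)]

lemma log_one_add_le_add (x y : ℝ) :
    Real.log (1 + |y|) ≤ Real.log (1 + |x|) + Real.log (1 + |x - y|) := by
  have := log_one_add_sub_le x (x - y)
  rwa [sub_sub_cancel] at this

lemma measurable_logKernel : Measurable fun z : ℝ × ℝ => Real.log |z.1 - z.2| := by fun_prop

/-- Integrability of the logarithmic kernel against a bounded and an arbitrary density. -/
lemma integrable_logKernel {f g : ℝ → ℝ} (hf : Integrable f) (hg : Integrable g)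
    (hfl : Integrable fun x => Real.log (1 + |x|) * f x)
    (hgl : Integrable fun x => Real.log (1 + |x|) * g x) {K : ℝ} (hK : ∀ᵐ x, |f x| ≤ K) :
    Integrable (fun z : ℝ × ℝ => Real.log |z.1 - z.2| * (f z.1 * g z.2))
      (volume.prod volume) := by
  have i1 := hfl.norm.mul_prod hg.norm
  have i2 := hf.norm.mul_prod hgl.norm
  -- The singular part is dominated by K times a convolution integrand; this is where boundedness of
  -- one factor is needed.
  have i3 := (Integrable.convolution_integrand (ContinuousLinearMap.mul ℝ ℝ) hg.norm
    integrable_negLog).const_mul K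
  refine ((i1.add i2).add i3).mono'
    (measurable_logKernel.aestronglyMeasurable.mul (hf.1.comp_fst.mul hg.1.comp_snd)) ?_
  have hK' : ∀ᵐ z : ℝ × ℝ ∂(volume.prod volume), |f z.1| ≤ K :=
    Measure.quasiMeasurePreserving_fst.ae hK
  filter_upwards [hK'] with z hz
  simp only [Pi.add_apply, ContinuousLinearMap.mul_apply', Real.norm_eq_abs, abs_mul,
    abs_of_nonneg (log_one_add_abs_nonneg _)]
  have h1 := abs_log_abs_le (z.1 - z.2)
  have h2 := log_one_add_sub_le z.1 z.2
  have h3 : |(Real.log |z.1 - z.2|)| * (|f z.1| * |g z.2|) ≤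
      (Real.log (1 + |z.1|) + Real.log (1 + |z.2|) + negLog (z.1 - z.2)) *
        (|f z.1| * |g z.2|) := by gcongr; linarith
  have h4 : negLog (z.1 - z.2) * |f z.1| * |g z.2| ≤ negLog (z.1 - z.2) * K * |g z.2| := by
    gcongr; exact negLog_nonneg _
  linarith

/-! ### The energy in terms of densities -/

/-- `r` is the density of a probability measure of finite energy. -/
structure Admissible (V : ℝ → ℝ) (r : ℝ → ℝ) : Prop where
  measurable : Measurable r
  nonneg : ∀ x, 0 ≤ r x
  integrable : Integrable r
  integral_eq : ∫ x, r x = 1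
  entropy : Integrable fun x => r x * (V x + Real.log (r x))
  interaction : Integrable (fun z : ℝ × ℝ => Real.log |z.1 - z.2| * (r z.1 * r z.2))
    (volume.prod volume)

/-- The energy of a density. -/
def densityEnergy (V : ℝ → ℝ) (P : ℝ) (r : ℝ → ℝ) : ℝ :=
  (∫ x, r x * (V x + Real.log (r x))) -
    P * ∫ z : ℝ × ℝ, Real.log |z.1 - z.2| * (r z.1 * r z.2) ∂(volume.prod volume)

section withDensity

variable {r : ℝ → ℝ}

lemma isProbabilityMeasure_withDensity (h0 : ∀ x, 0 ≤ r x) (hi : Integrable r)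
    (h1 : ∫ x, r x = 1) :
    IsProbabilityMeasure (volume.withDensity fun x => ENNReal.ofReal (r x)) := by
  constructor
  rw [withDensity_apply _ MeasurableSet.univ, Measure.restrict_univ,
    ← ofReal_integral_eq_lintegral_ofReal hi (.of_forall h0), h1, ENNReal.ofReal_one]

lemma integrable_withDensity_ofReal (hm : Measurable r) (h0 : ∀ x, 0 ≤ r x) {f : ℝ → ℝ} :
    Integrable f (volume.withDensity fun x => ENNReal.ofReal (r x)) ↔
      Integrable fun x => r x * f x := by
  rw [integrable_withDensity_iff_integrable_smul' hm.ennreal_ofReal (.of_forall fun x => by simp)]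
  simp only [ENNReal.toReal_ofReal (h0 _), smul_eq_mul]

lemma integral_withDensity_ofReal (hm : Measurable r) (h0 : ∀ x, 0 ≤ r x) (f : ℝ → ℝ) :
    ∫ x, f x ∂(volume.withDensity fun x => ENNReal.ofReal (r x)) = ∫ x, r x * f x := by
  rw [integral_withDensity_eq_integral_toReal_smul hm.ennreal_ofReal (.of_forall fun x => by simp)]
  simp only [ENNReal.toReal_ofReal (h0 _), smul_eq_mul]

lemma prod_withDensity_ofReal (hm : Measurable r) (h0 : ∀ x, 0 ≤ r x) :
    (volume.withDensity fun x => ENNReal.ofReal (r x)).prod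
      (volume.withDensity fun x => ENNReal.ofReal (r x)) =
    (volume.prod volume).withDensity fun z : ℝ × ℝ => ENNReal.ofReal (r z.1 * r z.2) := by
  rw [prod_withDensity hm.ennreal_ofReal hm.ennreal_ofReal]
  simp only [ENNReal.ofReal_mul (h0 _)]

lemma integrable_prod_withDensity_ofReal (hm : Measurable r) (h0 : ∀ x, 0 ≤ r x)
    {f : ℝ × ℝ → ℝ} :
    Integrable f ((volume.withDensity fun x => ENNReal.ofReal (r x)).prod
      (volume.withDensity fun x => ENNReal.ofReal (r x))) ↔
      Integrable (fun z => f z * (r z.1 * r z.2)) (volume.prod volume) := by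
  have hm2 : Measurable fun z : ℝ × ℝ => ENNReal.ofReal (r z.1 * r z.2) :=
    ((hm.comp measurable_fst).mul (hm.comp measurable_snd)).ennreal_ofReal
  rw [prod_withDensity_ofReal hm h0,
    integrable_withDensity_iff_integrable_smul' hm2 (.of_forall fun x => by simp)]
  simp only [ENNReal.toReal_ofReal (mul_nonneg (h0 _) (h0 _)), smul_eq_mul, mul_comm (f _)]

lemma integral_prod_withDensity_ofReal (hm : Measurable r) (h0 : ∀ x, 0 ≤ r x) (f : ℝ × ℝ → ℝ) :
    ∫ z, f z ∂((volume.withDensity fun x => ENNReal.ofReal (r x)).prod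
      (volume.withDensity fun x => ENNReal.ofReal (r x))) =
      ∫ z, f z * (r z.1 * r z.2) ∂(volume.prod volume) := by
  have hm2 : Measurable fun z : ℝ × ℝ => ENNReal.ofReal (r z.1 * r z.2) :=
    ((hm.comp measurable_fst).mul (hm.comp measurable_snd)).ennreal_ofReal
  rw [prod_withDensity_ofReal hm h0,
    integral_withDensity_eq_integral_toReal_smul hm2 (.of_forall fun x => by simp)]
  simp only [ENNReal.toReal_ofReal (mul_nonneg (h0 _) (h0 _)), smul_eq_mul, mul_comm (f _)]

lemma density_withDensity (hm : Measurable r) (h0 : ∀ x, 0 ≤ r x) :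
    density (volume.withDensity fun x => ENNReal.ofReal (r x)) =ᵐ[volume] r := by
  filter_upwards [Measure.rnDeriv_withDensity volume hm.ennreal_ofReal] with x hx
  rw [density, hx, ENNReal.toReal_ofReal (h0 x)]

lemma Admissible.energy_eq {V : ℝ → ℝ} (h : Admissible V r) (P : ℝ) :
    energy V P (volume.withDensity fun x => ENNReal.ofReal (r x)) = densityEnergy V P r := by
  have hae : ∀ᵐ x, r x * (V x + Real.log
      (density (volume.withDensity fun x => ENNReal.ofReal (r x)) x)) =
      r x * (V x + Real.log (r x)) := by
    filter_upwards [density_withDensity h.measurable h.nonneg] with x hx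
    rw [hx]
  rw [energy, if_pos, integral_withDensity_ofReal h.measurable h.nonneg,
    integral_prod_withDensity_ofReal h.measurable h.nonneg, integral_congr_ae hae, densityEnergy]
  refine ⟨withDensity_absolutelyContinuous _ _, ?_, ?_⟩
  · rw [integrable_withDensity_ofReal h.measurable h.nonneg]
    exact h.entropy.congr (hae.mono fun x hx => hx.symm)
  · rw [integrable_prod_withDensity_ofReal h.measurable h.nonneg]
    exact h.interaction

end withDensity

/-- The uniform density on [0, 1] has finite energy, so the minimum is finite and the equilibrium
measure cannot fall in the infinite case of `energy`. -/
lemma exists_admissible {V : ℝ → ℝ} (hV : Continuous V) : ∃ r, Admissible V r := by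
  set r : ℝ → ℝ := (Set.Icc (0 : ℝ) 1).indicator 1 with hr
  have hm : Measurable r := measurable_one.indicator measurableSet_Icc
  have hi : Integrable r := (integrable_indicator_iff measurableSet_Icc).2
    (integrableOn_const (C := (1 : ℝ)) (by simp))
  have hr1 : ∀ x, |r x| ≤ 1 := fun x => by
    by_cases hx : x ∈ Set.Icc (0 : ℝ) 1 <;> simp [hr, hx]
  -- Outside [0, 1] this relies on the convention log 0 = 0.
  have hlog : ∀ x, Real.log (r x) = 0 := fun x => by
    by_cases hx : x ∈ Set.Icc (0 : ℝ) 1 <;> simp [hr, hx]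
  have hcont : ∀ g : ℝ → ℝ, Continuous g → Integrable fun x => g x * r x := fun g hg => by
    have h1 : IntegrableOn g (Set.Icc 0 1) := hg.integrableOn_Icc
    refine ((integrable_indicator_iff measurableSet_Icc).2 h1).congr (.of_forall fun x => ?_)
    by_cases hx : x ∈ Set.Icc (0 : ℝ) 1 <;> simp [hr, hx]
  have hl : Integrable fun x => Real.log (1 + |x|) * r x := hcont _ <|
    Continuous.log (by fun_prop) fun x => by positivity
  refine ⟨r, hm, fun x => Set.indicator_nonneg (fun _ _ => zero_le_one) x, hi, ?_, ?_,
    integrable_logKernel hi hi hl hl (.of_forall hr1)⟩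
  · rw [hr, integral_indicator measurableSet_Icc]
    simp
  · simp only [hlog, add_zero]
    simpa only [mul_comm] using hcont V hV

lemma density_nonneg (μ : Measure ℝ) (x : ℝ) : 0 ≤ density μ x := ENNReal.toReal_nonneg

lemma measurable_density (μ : Measure ℝ) : Measurable (density μ) :=
  (Measure.measurable_rnDeriv μ volume).ennreal_toReal

lemma withDensity_density {μ : Measure ℝ} [IsFiniteMeasure μ] (h : μ ≪ volume) :
    volume.withDensity (fun x => ENNReal.ofReal (density μ x)) = μ := by
  conv_rhs => rw [← Measure.withDensity_rnDeriv_eq μ volume h]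
  refine withDensity_congr_ae ?_
  filter_upwards [Measure.rnDeriv_lt_top μ volume] with x hx
  rw [density, ENNReal.ofReal_toReal hx.ne]

lemma integral_eq_density {μ : Measure ℝ} [IsFiniteMeasure μ] (h : μ ≪ volume) (f : ℝ → ℝ) :
    ∫ x, f x ∂μ = ∫ x, density μ x * f x := by
  conv_lhs => rw [← withDensity_density h]
  exact integral_withDensity_ofReal (measurable_density μ) (density_nonneg μ) f

lemma integrable_iff_density {μ : Measure ℝ} [IsFiniteMeasure μ] (h : μ ≪ volume) {f : ℝ → ℝ} :
    Integrable f μ ↔ Integrable fun x => density μ x * f x := by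
  conv_lhs => rw [← withDensity_density h]
  exact integrable_withDensity_ofReal (measurable_density μ) (density_nonneg μ)

/-- The density of the equilibrium measure minimizes the energy among densities. -/
lemma IsEquilibriumMeasure.admissible {V : ℝ → ℝ} {P : ℝ} {μ : Measure ℝ}
    (hμ : IsEquilibriumMeasure V P μ) (hV : Continuous V) :
    μ ≪ volume ∧ Admissible V (density μ) ∧
      ∀ r, Admissible V r → densityEnergy V P (density μ) ≤ densityEnergy V P r := by
  have hprob := hμ.1
  obtain ⟨r0, hr0⟩ := exists_admissible hV
  have hlt : energy V P μ < ⊤ := by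
    have h1 := hμ.2 _ (isProbabilityMeasure_withDensity hr0.nonneg hr0.integrable hr0.integral_eq)
    rw [hr0.energy_eq] at h1
    exact h1.trans_lt (EReal.coe_lt_top _)
  have hcond : μ ≪ volume ∧ Integrable (fun x => V x + Real.log (density μ x)) μ ∧
      Integrable (fun z : ℝ × ℝ => Real.log |z.1 - z.2|) (μ.prod μ) := by
    by_contra hc
    rw [energy, if_neg hc] at hlt
    exact lt_irrefl _ hlt
  obtain ⟨hac, hent, hint⟩ := hcond
  have hd := withDensity_density hac
  have hadm : Admissible V (density μ) := by
    refine ⟨measurable_density μ, density_nonneg μ, ?_, ?_, (integrable_iff_density hac).1 hent, ?_⟩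
    · simpa using (integrable_iff_density hac (f := fun _ => 1)).1 (integrable_const 1)
    · simpa using (integral_eq_density hac (fun _ => 1)).symm
    · rw [← integrable_prod_withDensity_ofReal (measurable_density μ) (density_nonneg μ)]
      rwa [hd]
  refine ⟨hac, hadm, fun r hr => ?_⟩
  have h1 := hμ.2 _ (isProbabilityMeasure_withDensity hr.nonneg hr.integrable hr.integral_eq)
  have h2 := hadm.energy_eq P
  rw [hd] at h2
  rw [h2, hr.energy_eq] at h1
  exact EReal.coe_le_coe_iff.1 h1

/-! ### The Euler–Lagrange equation -/

/-- If a ≠ 0, a small ε of sign opposite to a makes the linear term beat the quadratic one. -/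
lemma eq_zero_of_forall_small {a b : ℝ} (h : ∀ ε : ℝ, |ε| ≤ 1 / 2 → 0 ≤ ε * a + ε ^ 2 * b) :
    a = 0 := by
  by_contra ha
  have hb : 0 < |b| + 1 := by positivity
  have hp : 0 < |a| := abs_pos.2 ha
  set s := min (1 / 2) (|a| / (2 * (|b| + 1))) with hs
  have hs0 : 0 < s := lt_min (by norm_num) (by positivity)
  have hs1 : s ≤ 1 / 2 := min_le_left _ _
  have hs2 : s * (2 * (|b| + 1)) ≤ |a| := by
    rw [← le_div_iff₀ (by positivity)]; exact min_le_right _ _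
  have hb' := le_abs_self b
  have key : s * |a| - s ^ 2 * b > 0 := by nlinarith
  rcases lt_or_gt_of_ne ha with h' | h'
  · have := h s (by rwa [abs_of_pos hs0])
    rw [abs_of_neg h'] at key
    nlinarith [h s (by rwa [abs_of_pos hs0]), mul_pos hs0 hs0, abs_of_neg h']
  · have := h (-s) (by rwa [abs_neg, abs_of_pos hs0])
    rw [abs_of_pos h'] at key hs2
    nlinarith

/-- The inequality log s ≤ s - 1 applied at 1/s and at s. -/
lemma mul_log_bounds {s : ℝ} (hs : 0 < s) :
    s - 1 ≤ s * Real.log s ∧ s * Real.log s ≤ s * (s - 1) := by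
  refine ⟨?_, mul_le_mul_of_nonneg_left (Real.log_le_sub_one_of_pos hs) hs.le⟩
  have := Real.log_le_sub_one_of_pos (inv_pos.2 hs)
  rw [Real.log_inv] at this
  have h2 := mul_le_mul_of_nonneg_left this hs.le
  rw [mul_sub, mul_inv_cancel₀ hs.ne'] at h2
  linarith

lemma integral_add_three {α : Type*} [MeasurableSpace α] {m : Measure α} {f g h : α → ℝ}
    (hf : Integrable f m) (hg : Integrable g m) (hh : Integrable h m) :
    ∫ x, (f x + g x + h x) ∂m = (∫ x, f x ∂m) + (∫ x, g x ∂m) + ∫ x, h x ∂m := by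
  have h1 : Integrable (fun x => f x + g x) m := hf.add hg
  rw [integral_add h1 hh, integral_add hf hg]

lemma integral_add_four {α : Type*} [MeasurableSpace α] {m : Measure α} {f g h k : α → ℝ}
    (hf : Integrable f m) (hg : Integrable g m) (hh : Integrable h m) (hk : Integrable k m) :
    ∫ x, (f x + g x + h x + k x) ∂m =
      (∫ x, f x ∂m) + (∫ x, g x ∂m) + (∫ x, h x ∂m) + ∫ x, k x ∂m := by
  have h1 : Integrable (fun x => f x + g x + h x) m := (hf.add hg).add hh
  rw [integral_add h1 hk, integral_add_three hf hg hh]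

/-- The logarithmic potential of a density. -/
def logPot (ρ : ℝ → ℝ) (x : ℝ) : ℝ := ∫ y, Real.log |x - y| * ρ y

section EulerLagrange

variable {V ρ : ℝ → ℝ} {P : ℝ}

/-- First variation of the energy at a minimizer. -/
lemma first_variation (hρ : Admissible V ρ)
    (hmin : ∀ r, Admissible V r → densityEnergy V P ρ ≤ densityEnergy V P r) {h : ℝ → ℝ}
    (hm : Measurable h) (hb : ∀ x, |h x| ≤ 1) (h0 : ∫ x, h x * ρ x = 0) :
    (∫ x, h x * (ρ x * (V x + Real.log (ρ x)))) -
      P * (∫ z : ℝ × ℝ, (h z.1 + h z.2) * (Real.log |z.1 - z.2| * (ρ z.1 * ρ z.2))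
        ∂(volume.prod volume)) = 0 := by
  set S : ℝ → ℝ := fun x => ρ x * (V x + Real.log (ρ x)) with hS
  set Lk : ℝ × ℝ → ℝ := fun z => Real.log |z.1 - z.2| * (ρ z.1 * ρ z.2) with hLk
  have hSi : Integrable S := hρ.entropy
  have hLi : Integrable Lk (volume.prod volume) := hρ.interaction
  have hm1 : Measurable fun z : ℝ × ℝ => h z.1 := hm.comp measurable_fst
  have hm2 : Measurable fun z : ℝ × ℝ => h z.2 := hm.comp measurable_snd
  have ihS : Integrable fun x => h x * S x := hSi.bdd_mul hm.aestronglyMeasurable (.of_forall hb)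
  have ihρ : Integrable fun x => h x * ρ x :=
    hρ.integrable.bdd_mul hm.aestronglyMeasurable (.of_forall hb)
  have iL1 : Integrable (fun z : ℝ × ℝ => (h z.1 + h z.2) * Lk z) (volume.prod volume) :=
    hLi.bdd_mul (c := 2) (hm1.add hm2).aestronglyMeasurable (.of_forall fun z =>
      (norm_add_le _ _).trans (by
        have h1 := hb z.1
        have h2 := hb z.2
        simp only [Real.norm_eq_abs]
        linarith))
  have iL2 : Integrable (fun z : ℝ × ℝ => (h z.1 * h z.2) * Lk z) (volume.prod volume) :=
    hLi.bdd_mul (c := 1) (hm1.mul hm2).aestronglyMeasurable (.of_forall fun z => by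
      rw [norm_mul]; exact mul_le_one₀ (hb _) (norm_nonneg _) (hb _))
  -- The competitor is (1 + εh)ρ. In the quadratic coefficient, 1 bounds the entropy remainder and
  -- the integral is the interaction of hρ with itself.
  refine eq_zero_of_forall_small (b := 1 - P * ∫ z : ℝ × ℝ, (h z.1 * h z.2) * Lk z
    ∂(volume.prod volume)) fun ε hε => ?_
  have hεh : ∀ x, |ε * h x| ≤ 1 / 2 := fun x => by
    rw [abs_mul]
    nlinarith [hb x, abs_nonneg (h x), abs_nonneg ε]
  have hs : ∀ x, 1 / 2 ≤ 1 + ε * h x ∧ 1 + ε * h x ≤ 3 / 2 := fun x => by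
    have := abs_le.1 (hεh x); constructor <;> linarith
  set E : ℝ → ℝ := fun x => (1 + ε * h x) * Real.log (1 + ε * h x) with hE
  have hEm : Measurable E := by fun_prop
  have hEb : ∀ x, ‖E x‖ ≤ 1 := fun x => by
    have h1 := mul_log_bounds (s := 1 + ε * h x) (by linarith [(hs x).1])
    have := hs x
    rw [Real.norm_eq_abs, abs_le]
    constructor <;> nlinarith
  have iE : Integrable fun x => E x * ρ x := hρ.integrable.bdd_mul hEm.aestronglyMeasurable
    (.of_forall hEb)
  set r : ℝ → ℝ := fun x => (1 + ε * h x) * ρ x with hr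
  -- Because the perturbation is multiplicative the logarithm splits; where ρ vanishes every term
  -- carries a factor 0, so the value of log 0 does not matter.
  have hrS : ∀ x, r x * (V x + Real.log (r x)) = S x + ε * (h x * S x) + E x * ρ x := fun x => by
    simp only [hr, hS, hE]
    rcases eq_or_ne (ρ x) 0 with h' | h'
    · simp [h']
    · rw [Real.log_mul (by linarith [(hs x).1]) h']
      ring
  have hrL : ∀ z : ℝ × ℝ, Real.log |z.1 - z.2| * (r z.1 * r z.2) =
      Lk z + ε * ((h z.1 + h z.2) * Lk z) + ε ^ 2 * ((h z.1 * h z.2) * Lk z) := fun z => by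
    simp only [hr, hLk]; ring
  have hadm : Admissible V r := by
    refine ⟨by have := hρ.measurable; fun_prop, fun x => mul_nonneg (by linarith [(hs x).1])
      (hρ.nonneg x), ?_, ?_, ?_, ?_⟩
    · refine (hρ.integrable.add (ihρ.const_mul ε)).congr (.of_forall fun x => ?_)
      simp only [hr, Pi.add_apply]; ring
    · have : ∀ x, r x = ρ x + ε * (h x * ρ x) := fun x => by simp only [hr]; ring
      simp only [this]
      rw [integral_add hρ.integrable (ihρ.const_mul ε), integral_const_mul, h0, hρ.integral_eq]
      simp
    · simp only [hrS]
      exact (hSi.add (ihS.const_mul ε)).add iE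
    · simp only [hrL]
      exact (hLi.add (iL1.const_mul ε)).add (iL2.const_mul _)
  have hJ := hmin r hadm
  have e1 : ∫ x, r x * (V x + Real.log (r x)) =
      (∫ x, S x) + ε * (∫ x, h x * S x) + ∫ x, E x * ρ x := by
    simp only [hrS]
    rw [integral_add_three hSi (ihS.const_mul ε) iE, integral_const_mul]
  have e2 : ∫ z : ℝ × ℝ, Real.log |z.1 - z.2| * (r z.1 * r z.2) ∂(volume.prod volume) =
      (∫ z, Lk z ∂(volume.prod volume)) +
        ε * (∫ z : ℝ × ℝ, (h z.1 + h z.2) * Lk z ∂(volume.prod volume)) +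
        ε ^ 2 * ∫ z : ℝ × ℝ, (h z.1 * h z.2) * Lk z ∂(volume.prod volume) := by
    simp only [hrL]
    rw [integral_add_three hLi (iL1.const_mul ε) (iL2.const_mul _), integral_const_mul,
      integral_const_mul]
  have e3 : ∫ x, E x * ρ x ≤ ε ^ 2 := by
    have : ∫ x, E x * ρ x ≤ ∫ x, (ε * (h x * ρ x) + ε ^ 2 * ρ x) := by
      refine integral_mono iE ((ihρ.const_mul ε).add (hρ.integrable.const_mul _)) fun x => ?_
      have h1 := (mul_log_bounds (s := 1 + ε * h x) (by linarith [(hs x).1])).2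
      have h2 : (ε * h x) ^ 2 ≤ ε ^ 2 := by
        rw [mul_pow]
        have : (h x) ^ 2 ≤ 1 := by rw [← sq_abs]; nlinarith [hb x, abs_nonneg (h x)]
        nlinarith [sq_nonneg ε]
      have h3 : E x ≤ ε * h x + ε ^ 2 := by simp only [hE]; nlinarith
      have := mul_le_mul_of_nonneg_right h3 (hρ.nonneg x)
      simp only
      linarith
    rw [integral_add (ihρ.const_mul ε) (hρ.integrable.const_mul _), integral_const_mul,
      integral_const_mul, h0, hρ.integral_eq] at this
    linarith
  rw [densityEnergy, densityEnergy, e1, e2] at hJ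
  simp only [hS, hLk] at *
  nlinarith

lemma Admissible.integrable_logPot (hρ : Admissible V ρ) :
    Integrable fun x => ρ x * logPot ρ x := by
  refine hρ.interaction.integral_prod_left.congr (.of_forall fun x => ?_)
  simp only [logPot]
  rw [← integral_const_mul]
  congr 1; ext y; ring

lemma integral_swap_logKernel {h : ℝ → ℝ} :
    ∫ z : ℝ × ℝ, h z.2 * (Real.log |z.1 - z.2| * (ρ z.1 * ρ z.2)) ∂(volume.prod volume) =
    ∫ z : ℝ × ℝ, h z.1 * (Real.log |z.1 - z.2| * (ρ z.1 * ρ z.2)) ∂(volume.prod volume) := by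
  rw [← integral_prod_swap]
  refine integral_congr_ae (.of_forall fun z => ?_)
  simp only [Prod.fst_swap, Prod.snd_swap]
  rw [abs_sub_comm]
  ring

/-- By symmetry of the kernel the first variation is ∫hG with G = ρ(V + log ρ - 2P U), and it
vanishes whenever ∫hρ = 0. Taking h = 1_A - ∫_A ρ gives ∫_A G = (∫G)(∫_A ρ) for every measurable A,
so G = cρ with c = ∫G. -/
lemma euler_lagrange_on_support (hρ : Admissible V ρ)
    (hmin : ∀ r, Admissible V r → densityEnergy V P ρ ≤ densityEnergy V P r) :
    ∃ c : ℝ, ∀ᵐ x, ρ x ≠ 0 → V x + Real.log (ρ x) - 2 * P * logPot ρ x = c := by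
  set S : ℝ → ℝ := fun x => ρ x * (V x + Real.log (ρ x)) with hS
  have hSi : Integrable S := hρ.entropy
  set G : ℝ → ℝ := fun x => S x - 2 * P * (ρ x * logPot ρ x) with hG
  have hGi : Integrable G := hSi.sub (hρ.integrable_logPot.const_mul _)
  have key : ∀ h : ℝ → ℝ, Measurable h → (∀ x, |h x| ≤ 1) → ∫ x, h x * ρ x = 0 →
      ∫ x, h x * G x = 0 := fun h hm hb h0 => by
    have h1 := first_variation hρ hmin hm hb h0
    have hLi := hρ.interaction
    have i1 : Integrable (fun z : ℝ × ℝ => h z.1 * (Real.log |z.1 - z.2| * (ρ z.1 * ρ z.2)))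
      (volume.prod volume) := hLi.bdd_mul (c := 1) (hm.comp measurable_fst).aestronglyMeasurable
        (.of_forall fun z => hb z.1)
    have i2 : Integrable (fun z : ℝ × ℝ => h z.2 * (Real.log |z.1 - z.2| * (ρ z.1 * ρ z.2)))
      (volume.prod volume) := hLi.bdd_mul (c := 1) (hm.comp measurable_snd).aestronglyMeasurable
        (.of_forall fun z => hb z.2)
    simp only [add_mul] at h1
    rw [integral_add i1 i2, integral_swap_logKernel, integral_prod _ i1] at h1
    have e1 : ∀ x, ∫ y, h x * (Real.log |x - y| * (ρ x * ρ y)) = h x * (ρ x * logPot ρ x) :=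
      fun x => by
        rw [integral_const_mul, logPot, ← integral_const_mul (ρ x)]
        congr 2; ext y; ring
    simp only [e1] at h1
    have i3 : Integrable fun x => h x * S x :=
      hSi.bdd_mul hm.aestronglyMeasurable (.of_forall hb)
    have i4 : Integrable fun x => h x * (ρ x * logPot ρ x) :=
      hρ.integrable_logPot.bdd_mul hm.aestronglyMeasurable (.of_forall hb)
    have : ∀ x, h x * G x = h x * S x - 2 * P * (h x * (ρ x * logPot ρ x)) := fun x => by
      simp only [hG]; ring
    simp only [this]
    rw [integral_sub i3 (i4.const_mul _), integral_const_mul]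
    linarith
  set c := ∫ x, G x with hc
  refine ⟨c, ?_⟩
  have hi : Integrable fun x => G x - c * ρ x := hGi.sub (hρ.integrable.const_mul c)
  have hz := hi.ae_eq_zero_of_forall_setIntegral_eq_zero fun A hA _ => by
    set m := ∫ x in A, ρ x with hmdef
    have hm0 : 0 ≤ m := integral_nonneg hρ.nonneg
    have hm1 : m ≤ 1 := by
      rw [← hρ.integral_eq]
      exact setIntegral_le_integral hρ.integrable (.of_forall hρ.nonneg)
    have hind : ∀ f : ℝ → ℝ, ∀ x, (A.indicator (1 : ℝ → ℝ) x - m) * f x =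
        A.indicator f x - m * f x := fun f x => by
      by_cases hx : x ∈ A <;> simp [hx]; ring
    have h1 := key (fun x => A.indicator 1 x - m) ((measurable_one.indicator hA).sub_const m)
      (fun x => by by_cases hx : x ∈ A <;> simp [hx, abs_le] <;> constructor <;> linarith) (by
        simp only [hind]
        rw [integral_sub (hρ.integrable.indicator hA) (hρ.integrable.const_mul m),
          integral_indicator hA, integral_const_mul, hρ.integral_eq]
        simp [m])
    simp only [hind] at h1
    rw [integral_sub (hGi.indicator hA) (hGi.const_mul m), integral_indicator hA,
      integral_const_mul] at h1
    rw [integral_sub hGi.integrableOn (hρ.integrable.const_mul c).integrableOn,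
      integral_const_mul]
    linarith
  filter_upwards [hz] with x hx hne
  simp only [hG, hS, Pi.zero_apply] at hx
  have : ρ x * (V x + Real.log (ρ x) - 2 * P * logPot ρ x - c) = 0 := by linarith
  rcases mul_eq_zero.1 this with h | h
  · exact absurd h hne
  · linarith

/-- A density of finite energy has a finite logarithmic moment. -/
lemma Admissible.integrable_log_moment (hρ : Admissible V ρ) :
    Integrable fun x => Real.log (1 + |x|) * ρ x := by
  have h1 := hρ.interaction.prod_right_ae
  -- By Fubini almost every slice of the interaction is integrable, and some such slice has ρ(x₀) ≠
  -- 0 because ρ has mass 1; that slice controls log(1+|y|)ρ(y).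
  obtain ⟨x0, hx0, hne⟩ : ∃ x0, Integrable (fun y => Real.log |x0 - y| * (ρ x0 * ρ y)) ∧
      ρ x0 ≠ 0 := by
    by_contra! hcon
    have : ∀ᵐ x, ρ x = 0 := by
      filter_upwards [h1] with x hx using hcon x hx
    have h2 := hρ.integral_eq
    rw [integral_congr_ae this] at h2
    simp at h2
  have h2 : Integrable fun y => Real.log |x0 - y| * ρ y := by
    refine (hx0.const_mul (ρ x0)⁻¹).congr (.of_forall fun y => ?_)
    simp only; field_simp
  have hm : Measurable fun x => Real.log (1 + |x|) := by fun_prop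
  refine ((hρ.integrable.const_mul (Real.log (1 + |x0|) + Real.log 2)).add h2.norm).mono'
    (hm.mul hρ.measurable).aestronglyMeasurable (.of_forall fun y => ?_)
  have h0 := hρ.nonneg y
  simp only [Pi.add_apply, norm_mul, Real.norm_eq_abs, abs_of_nonneg h0,
    abs_of_nonneg (log_one_add_abs_nonneg y)]
  rw [← add_mul]
  gcongr
  have h3 := log_one_add_le_add x0 y
  have h4 := log_one_add_le (x0 - y)
  have h5 : Real.log |x0 - y| + negLog (x0 - y) ≤ |(Real.log |x0 - y|)| := by
    rw [negLog]
    rcases le_total 0 (Real.log |x0 - y|) with h | h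
    · rw [abs_of_nonneg h, max_eq_left (by linarith)]; linarith
    · rw [abs_of_nonpos h, max_eq_right (by linarith)]; linarith
  linarith

/-- Mixing into ρ a mass ε spread uniformly over a set where ρ vanishes changes the energy by at
most ε log ε + O(ε), which is negative for small ε. Minimality thus forbids a zero set of positive
measure. -/
lemma density_pos_ae (hV : Continuous V) (hρ : Admissible V ρ)
    (hmin : ∀ r, Admissible V r → densityEnergy V P ρ ≤ densityEnergy V P r) :
    ∀ᵐ x, 0 < ρ x := by
  have hSi : Integrable fun x => ρ x * (V x + Real.log (ρ x)) := hρ.entropy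
  have hZm : MeasurableSet {x | ρ x = 0} := hρ.measurable (measurableSet_singleton 0)
  suffices hZ : volume {x | ρ x = 0} = 0 by
    have : ∀ᵐ x, ρ x ≠ 0 := by rw [ae_iff]; simpa using hZ
    filter_upwards [this] with x hx using lt_of_le_of_ne (hρ.nonneg x) (Ne.symm hx)
  by_contra hpos
  -- Truncation to a bounded set makes V and the logarithmic moment integrable against the uniform
  -- density.
  obtain ⟨N, hN⟩ : ∃ N : ℕ, volume ({x | ρ x = 0} ∩ Set.Icc (-N : ℝ) N) ≠ 0 := by
    by_contra! hcon
    refine hpos (measure_mono_null (fun x hx => ?_) (measure_iUnion_null hcon))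
    obtain ⟨N, hN⟩ := exists_nat_ge |x|
    exact Set.mem_iUnion.2 ⟨N, hx, abs_le.1 hN⟩
  set B := {x | ρ x = 0} ∩ Set.Icc (-N : ℝ) N with hB
  have hBm : MeasurableSet B := hZm.inter measurableSet_Icc
  have hBt : volume B ≠ ⊤ :=
    ((measure_mono Set.inter_subset_right).trans_lt (by simp)).ne
  set v := (volume B).toReal with hv
  have hv0 : 0 < v := ENNReal.toReal_pos hN hBt
  set s : ℝ → ℝ := B.indicator fun _ => v⁻¹ with hs
  have hsm : Measurable s := measurable_const.indicator hBm
  have hs0 : ∀ x, 0 ≤ s x := fun x => Set.indicator_nonneg (fun _ _ => by positivity) x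
  have hsc : ∀ g : ℝ → ℝ, Continuous g → Integrable fun x => g x * s x := fun g hg => by
    have h1 : IntegrableOn (fun x => g x * v⁻¹) B :=
      ((hg.integrableOn_Icc (a := (-N : ℝ)) (b := N)).mono_set Set.inter_subset_right).mul_const _
    refine ((integrable_indicator_iff hBm).2 h1).congr (.of_forall fun x => ?_)
    by_cases hx : x ∈ B <;> simp [hs, hx]
  have hsi : Integrable s := by simpa using hsc (fun _ => 1) continuous_const
  have hs1 : ∫ x, s x = 1 := by
    rw [hs, integral_indicator hBm, setIntegral_const, smul_eq_mul, Measure.real, ← hv,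
      mul_inv_cancel₀ hv0.ne']
  have hsb : ∀ x, |s x| ≤ v⁻¹ := fun x => by
    by_cases hx : x ∈ B <;> simp [hs, hx, abs_of_pos hv0, hv0.le]
  have hsl : Integrable fun x => Real.log (1 + |x|) * s x := hsc _ <|
    Continuous.log (by fun_prop) fun x => by positivity
  have i12 := integrable_logKernel hsi hρ.integrable hsl hρ.integrable_log_moment (.of_forall hsb)
  have i21 : Integrable (fun z : ℝ × ℝ => Real.log |z.1 - z.2| * (ρ z.1 * s z.2))
      (volume.prod volume) := by
    refine i12.swap.congr (.of_forall fun z => ?_)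
    simp only [Function.comp_apply, Prod.fst_swap, Prod.snd_swap]
    rw [abs_sub_comm]; ring
  have i22 := integrable_logKernel hsi hsi hsl hsl (.of_forall hsb)
  have i11 := hρ.interaction
  set I := ∫ z : ℝ × ℝ, Real.log |z.1 - z.2| * (ρ z.1 * ρ z.2) ∂(volume.prod volume)
  set I1 := ∫ z : ℝ × ℝ, Real.log |z.1 - z.2| * (s z.1 * ρ z.2) ∂(volume.prod volume)
  set I2 := ∫ z : ℝ × ℝ, Real.log |z.1 - z.2| * (ρ z.1 * s z.2) ∂(volume.prod volume)
  set I3 := ∫ z : ℝ × ℝ, Real.log |z.1 - z.2| * (s z.1 * s z.2) ∂(volume.prod volume)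
  set a := ∫ x, ρ x * (V x + Real.log (ρ x))
  have iVs : Integrable fun x => (V x + Real.log v⁻¹) * s x :=
    hsc _ (hV.add continuous_const)
  set b := ∫ x, (V x + Real.log v⁻¹) * s x
  have hvar : ∀ ε : ℝ, 0 < ε → ε ≤ 1 / 2 → 0 ≤ ε * (b - a + Real.log ε) -
      P * ((ε ^ 2 - 2 * ε) * I + ε * (1 - ε) * (I1 + I2) + ε ^ 2 * I3) := by
    intro ε h0 h12
    set r : ℝ → ℝ := fun x => (1 - ε) * ρ x + ε * s x with hr
    have h1ε : 0 < 1 - ε := by linarith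
    -- The two components have disjoint supports, so the logarithm of the mixture splits exactly on
    -- `B` and off `B`.
    have hrS : ∀ x, r x * (V x + Real.log (r x)) = (1 - ε) * (ρ x * (V x + Real.log (ρ x))) +
        (1 - ε) * Real.log (1 - ε) * ρ x + ε * ((V x + Real.log v⁻¹) * s x) +
        ε * Real.log ε * s x := fun x => by
      by_cases hx : x ∈ B
      · have h1 : ρ x = 0 := hx.1
        have h2 : s x = v⁻¹ := by simp [hs, hx]
        simp only [hr, h1, h2, mul_zero, zero_add, zero_mul]
        rw [Real.log_mul h0.ne' (inv_ne_zero hv0.ne')]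
        ring
      · have h2 : s x = 0 := by simp [hs, hx]
        simp only [hr, h2, mul_zero, add_zero]
        rcases eq_or_ne (ρ x) 0 with h' | h'
        · simp [h']
        · rw [Real.log_mul h1ε.ne' h']
          ring
    have hrL : ∀ z : ℝ × ℝ, Real.log |z.1 - z.2| * (r z.1 * r z.2) =
        (1 - ε) ^ 2 * (Real.log |z.1 - z.2| * (ρ z.1 * ρ z.2)) +
        ε * (1 - ε) * (Real.log |z.1 - z.2| * (s z.1 * ρ z.2)) +
        ε * (1 - ε) * (Real.log |z.1 - z.2| * (ρ z.1 * s z.2)) +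
        ε ^ 2 * (Real.log |z.1 - z.2| * (s z.1 * s z.2)) := fun z => by
      simp only [hr]; ring
    have j1 := hSi.const_mul (1 - ε)
    have j2 := hρ.integrable.const_mul ((1 - ε) * Real.log (1 - ε))
    have j3 := iVs.const_mul ε
    have j4 := hsi.const_mul (ε * Real.log ε)
    have k1 := i11.const_mul ((1 - ε) ^ 2)
    have k2 := i12.const_mul (ε * (1 - ε))
    have k3 := i21.const_mul (ε * (1 - ε))
    have k4 := i22.const_mul (ε ^ 2)
    have hadm : Admissible V r := by
      refine ⟨by have := hρ.measurable; fun_prop, fun x => ?_,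
        (hρ.integrable.const_mul _).add (hsi.const_mul _), ?_, ?_, ?_⟩
      · have := hρ.nonneg x
        have := hs0 x
        positivity
      · simp only [hr]
        rw [integral_add (hρ.integrable.const_mul _) (hsi.const_mul _), integral_const_mul,
          integral_const_mul, hρ.integral_eq, hs1]
        ring
      · simp only [hrS]
        exact ((j1.add j2).add j3).add j4
      · simp only [hrL]
        exact ((k1.add k2).add k3).add k4
    have hJ := hmin r hadm
    rw [densityEnergy, densityEnergy] at hJ
    simp only [hrS, hrL] at hJ
    rw [integral_add_four j1 j2 j3 j4, integral_add_four k1 k2 k3 k4] at hJ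
    simp only [integral_const_mul, hρ.integral_eq, hs1] at hJ
    -- This part of the entropy is favourable and is simply dropped.
    have hl : (1 - ε) * Real.log (1 - ε) ≤ 0 :=
      mul_nonpos_of_nonneg_of_nonpos h1ε.le (Real.log_nonpos h1ε.le (by linarith))
    have := hJ
    linarith
  set Q := |b - a| + |P| * (2 * |I| + |I1 + I2| + |I3|) with hQ
  have hup : ∀ ε : ℝ, 0 < ε → ε ≤ 1 / 2 → 0 ≤ ε * (Q + Real.log ε) := by
    intro ε h0 h12
    refine (hvar ε h0 h12).trans ?_
    have h1 : |(ε ^ 2 - 2 * ε) * I + ε * (1 - ε) * (I1 + I2) + ε ^ 2 * I3| ≤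
        ε * (2 * |I| + |I1 + I2| + |I3|) := by
      refine (abs_add_three _ _ _).trans ?_
      rw [abs_mul _ I, abs_mul _ (I1 + I2), abs_mul _ I3, abs_of_nonpos (by nlinarith : ε ^ 2 - 2 * ε ≤ 0),
        abs_of_nonneg (by nlinarith : 0 ≤ ε * (1 - ε)), abs_of_nonneg (by positivity : 0 ≤ ε ^ 2)]
      have a1 := mul_le_mul_of_nonneg_right (by nlinarith : -(ε ^ 2 - 2 * ε) ≤ 2 * ε) (abs_nonneg I)
      have a2 := mul_le_mul_of_nonneg_right (by nlinarith : ε * (1 - ε) ≤ ε) (abs_nonneg (I1 + I2))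
      have a3 := mul_le_mul_of_nonneg_right (by nlinarith : ε ^ 2 ≤ ε) (abs_nonneg I3)
      linarith
    have h2 := neg_abs_le (P * ((ε ^ 2 - 2 * ε) * I + ε * (1 - ε) * (I1 + I2) + ε ^ 2 * I3))
    rw [abs_mul] at h2
    have h3 := mul_le_mul_of_nonneg_left h1 (abs_nonneg P)
    have h4 := mul_le_mul_of_nonneg_left (le_abs_self (b - a)) h0.le
    simp only [hQ]
    linarith
  -- With this ε one has Q + log ε ≤ -1, contradicting `hup`.
  set ε := min (1 / 2) (Real.exp (-Q - 1)) with hε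
  have h0 : 0 < ε := lt_min (by norm_num) (Real.exp_pos _)
  have h1 := hup ε h0 (min_le_left _ _)
  have h2 : Real.log ε ≤ -Q - 1 := by
    rw [← Real.log_exp (-Q - 1)]
    exact Real.log_le_log h0 (min_le_right _ _)
  nlinarith

end EulerLagrange

/-! ### Bounds on the equilibrium density -/

/-- The comparison weight `e^{-V} (1 + x²)^P`. -/
def weight (V : ℝ → ℝ) (P : ℝ) (x : ℝ) : ℝ := Real.exp (-V x + P * Real.log (1 + x ^ 2))

lemma weight_pos (V : ℝ → ℝ) (P x : ℝ) : 0 < weight V P x := Real.exp_pos _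

lemma continuous_log_one_add_sq : Continuous fun x : ℝ => Real.log (1 + x ^ 2) :=
  Continuous.log (by fun_prop) fun x => by positivity

lemma continuous_weight {V : ℝ → ℝ} (hV : Continuous V) (P : ℝ) : Continuous (weight V P) :=
  Real.continuous_exp.comp (hV.neg.add (continuous_log_one_add_sq.const_mul P))

lemma weight_bounded {V : ℝ → ℝ} {P : ℝ} (hP : 0 < P) (hV : Continuous V)
    (hdecay : (fun x => Real.exp (-V x)) =o[cocompact ℝ] fun x => |x| ^ (-(2 * P))) :
    ∃ K : ℝ, 0 < K ∧ ∀ x, weight V P x ≤ K := by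
  have h1 := hdecay.bound (c := 1) one_pos
  have h2 : ∀ᶠ x : ℝ in cocompact ℝ, 1 ≤ |x| :=
    (tendsto_norm_cocompact_atTop (E := ℝ)).eventually_ge_atTop 1
  have h3 : ∀ᶠ x in cocompact ℝ, weight V P x ≤ Real.exp (P * Real.log 2) := by
    filter_upwards [h1, h2] with x hx hx1
    have hx0 : 0 < |x| := by linarith
    rw [Real.norm_eq_abs, abs_of_pos (Real.exp_pos _), one_mul, Real.norm_eq_abs,
      abs_of_pos (Real.rpow_pos_of_pos hx0 _), Real.rpow_def_of_pos hx0, Real.exp_le_exp] at hx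
    rw [weight, Real.exp_le_exp]
    have h4 : Real.log (1 + x ^ 2) ≤ Real.log 2 + 2 * Real.log |x| := by
      have h5 : Real.log (2 * |x| ^ 2) = Real.log 2 + 2 * Real.log |x| := by
        rw [Real.log_mul two_ne_zero (by positivity), Real.log_pow]; norm_num
      rw [← h5]
      refine Real.log_le_log (by positivity) ?_
      rw [← sq_abs x]
      nlinarith
    nlinarith
  obtain ⟨s, hs, hs'⟩ := mem_cocompact.1 h3
  obtain ⟨B, hB⟩ := hs.exists_bound_of_continuousOn (continuous_weight hV P).continuousOn
  refine ⟨max (Real.exp (P * Real.log 2)) B, lt_max_of_lt_left (Real.exp_pos _), fun x => ?_⟩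
  by_cases hx : x ∈ s
  · exact (le_abs_self _).trans ((hB x hx).trans (le_max_right _ _))
  · exact (hs' hx : weight V P x ≤ _).trans (le_max_left _ _)

lemma log_one_add_sq_bounds (x : ℝ) : Real.log (1 + x ^ 2) ≤ 2 * Real.log (1 + |x|) ∧
    2 * Real.log (1 + |x|) ≤ Real.log 2 + Real.log (1 + x ^ 2) := by
  have h : 2 * Real.log (1 + |x|) = Real.log ((1 + |x|) ^ 2) := by rw [Real.log_pow]; norm_num
  rw [h, ← Real.log_mul two_ne_zero (by positivity)]
  have h0 := abs_nonneg x
  constructor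
  · refine Real.log_le_log (by positivity) ?_
    rw [← sq_abs x]
    nlinarith
  · refine Real.log_le_log (by positivity) ?_
    rw [← sq_abs x]
    nlinarith [sq_nonneg (|x| - 1)]

lemma logPot_le {ρ : ℝ → ℝ} (h0 : ∀ x, 0 ≤ ρ x) (hi : Integrable ρ) (h1 : ∫ x, ρ x = 1)
    (hl : Integrable fun x => Real.log (1 + |x|) * ρ x) (x : ℝ) :
    logPot ρ x ≤ Real.log (1 + |x|) + ∫ y, Real.log (1 + |y|) * ρ y := by
  have hr : ∫ y, (Real.log (1 + |x|) * ρ y + Real.log (1 + |y|) * ρ y) =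
      Real.log (1 + |x|) + ∫ y, Real.log (1 + |y|) * ρ y := by
    rw [integral_add (hi.const_mul _) hl, integral_const_mul, h1, mul_one]
  rw [logPot, ← hr]
  by_cases hint : Integrable fun y => Real.log |x - y| * ρ y
  · refine integral_mono hint ((hi.const_mul _).add hl) fun y => ?_
    simp only
    rw [← add_mul]
    exact mul_le_mul_of_nonneg_right ((log_abs_le _).trans (log_one_add_sub_le x y)) (h0 y)
  -- If the kernel is not integrable at x the potential takes the default value 0, still below the
  -- nonnegative right-hand side.
  · rw [integral_undef hint]
    refine integral_nonneg fun y => ?_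
    have := log_one_add_abs_nonneg x
    have := log_one_add_abs_nonneg y
    have := h0 y
    positivity

lemma integrable_logKernel_right {ρ : ℝ → ℝ} (h0 : ∀ x, 0 ≤ ρ x) (hi : Integrable ρ)
    (hl : Integrable fun x => Real.log (1 + |x|) * ρ x) {K : ℝ} (hK : ∀ᵐ x, ρ x ≤ K) (x : ℝ) :
    Integrable fun y => Real.log |x - y| * ρ y := by
  have hn : Integrable fun y => negLog (x - y) := integrable_negLog.comp_sub_left x
  refine (((hi.const_mul (Real.log (1 + |x|))).add hl).add (hn.mul_const K)).mono' ?_ ?_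
  · have : Measurable fun y => Real.log |x - y| := by fun_prop
    exact this.aestronglyMeasurable.mul hi.1
  · filter_upwards [hK] with y hy
    have h1 := h0 y
    simp only [Pi.add_apply, norm_mul, Real.norm_eq_abs, abs_of_nonneg h1]
    have h2 := abs_log_abs_le (x - y)
    have h3 := log_one_add_sub_le x y
    have h4 : |(Real.log |x - y|)| * ρ y ≤
      (Real.log (1 + |x|) + Real.log (1 + |y|) + negLog (x - y)) * ρ y := by gcongr; linarith
    have h5 := mul_le_mul_of_nonneg_left hy (negLog_nonneg (x - y))
    linarith

/-- From log(1+|x|) ≤ log(1+|y|) + log(1+|x-y|), averaged against ρ(y)dy; replacing log(1+|x-y|) by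
log|x-y| costs log 2 and the singular part, and the latter is at most K∫negLog since ρ ≤ K. Together
with `logPot_le`, the potential is log(1+|x|) + O(1). -/
lemma le_logPot {ρ : ℝ → ℝ} (h0 : ∀ x, 0 ≤ ρ x) (hi : Integrable ρ) (h1 : ∫ x, ρ x = 1)
    (hl : Integrable fun x => Real.log (1 + |x|) * ρ x) {K : ℝ} (hK : ∀ᵐ x, ρ x ≤ K) (x : ℝ) :
    Real.log (1 + |x|) ≤ logPot ρ x + (Real.log 2 + (∫ y, Real.log (1 + |y|) * ρ y) +
      K * ∫ y, negLog y) := by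
  have hn : Integrable fun y => negLog (x - y) := integrable_negLog.comp_sub_left x
  have hk := integrable_logKernel_right h0 hi hl hK x
  have e1 : ∫ y, (Real.log |x - y| * ρ y + Real.log 2 * ρ y + Real.log (1 + |y|) * ρ y +
      K * negLog (x - y)) = logPot ρ x + (Real.log 2 + (∫ y, Real.log (1 + |y|) * ρ y) +
      K * ∫ y, negLog y) := by
    rw [integral_add_four hk (hi.const_mul _) hl (hn.const_mul K), integral_const_mul,
      integral_const_mul, h1, integral_sub_left_eq_self negLog volume x, logPot]
    ring
  have e2 : ∫ y, Real.log (1 + |x|) * ρ y = Real.log (1 + |x|) := by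
    rw [integral_const_mul, h1, mul_one]
  rw [← e1, ← e2]
  refine integral_mono_ae (hi.const_mul _)
    (((hk.add (hi.const_mul _)).add hl).add (hn.const_mul K)) ?_
  filter_upwards [hK] with y hy
  have h3 := log_one_add_le_add (x - y) x
  rw [show x - y - x = -y by ring, abs_neg] at h3
  have h4 := log_one_add_le (x - y)
  have h5 := mul_le_mul_of_nonneg_right (h3.trans (add_le_add_left h4 _)) (h0 y)
  have h6 := mul_le_mul_of_nonneg_left hy (negLog_nonneg (x - y))
  linarith

/-- The properties of the equilibrium density on which the operator theory relies. -/
structure GibbsDensity (V : ℝ → ℝ) (P : ℝ) (μ : Measure ℝ) : Prop where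
  ac : μ ≪ volume
  ac' : volume ≪ μ
  weight_bdd : ∃ K : ℝ, 0 < K ∧ ∀ x, weight V P x ≤ K
  comparable : ∃ C : ℝ, 0 < C ∧ ∀ᵐ x, C⁻¹ * weight V P x ≤ density μ x ∧
    density μ x ≤ C * weight V P x
  log_moment : Integrable fun x => Real.log (1 + |x|) * density μ x
  formula : ∃ c : ℝ, ∀ᵐ x, density μ x = Real.exp (c - V x + 2 * P * logPot (density μ) x)

/-- Positivity lets the Euler–Lagrange equation be exponentiated into the Gibbs formula, and the
bounds on the potential turn it into comparability with the weight. The upper bound must come first: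
it bounds ρ, which the lower bound on the potential requires. -/
theorem IsEquilibriumMeasure.gibbsDensity {V : ℝ → ℝ} {P : ℝ} {μ : Measure ℝ} (hP : 0 < P)
    (hμ : IsEquilibriumMeasure V P μ) (hV : PotentialAssumptions V μ) : GibbsDensity V P μ := by
  have hVc : Continuous V := hV.contDiff.continuous
  obtain ⟨hac, hadm, hmin⟩ := hμ.admissible hVc
  have hpos := density_pos_ae hVc hadm hmin
  obtain ⟨c, hc⟩ := euler_lagrange_on_support hadm hmin
  have hform : ∀ᵐ x, density μ x = Real.exp (c - V x + 2 * P * logPot (density μ) x) := by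
    filter_upwards [hpos, hc] with x h1 h2
    rw [show c - V x + 2 * P * logPot (density μ) x = Real.log (density μ x) by
      linarith [h2 h1.ne'], Real.exp_log h1]
  have hprob := hμ.1
  have hlm := hadm.integrable_log_moment
  set M := ∫ y, Real.log (1 + |y|) * density μ y with hM
  have hwb : ∃ K : ℝ, 0 < K ∧ ∀ x, weight V P x ≤ K := by
    refine weight_bounded hP hVc ?_
    simpa using hV.decay 1 (2 * P) (by positivity)
  obtain ⟨K, hK0, hK⟩ := hwb
  have hup : ∀ᵐ x, density μ x ≤ Real.exp (c + 2 * P * M + P * Real.log 2) * weight V P x := by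
    filter_upwards [hform] with x hx
    rw [hx, weight, ← Real.exp_add, Real.exp_le_exp]
    have h1 := logPot_le (density_nonneg μ) hadm.integrable hadm.integral_eq hlm x
    have h2 := (log_one_add_sq_bounds x).2
    nlinarith
  set K' := Real.exp (c + 2 * P * M + P * Real.log 2) * K with hK'
  have hbd : ∀ᵐ x, density μ x ≤ K' := by
    filter_upwards [hup] with x hx
    exact hx.trans (mul_le_mul_of_nonneg_left (hK x) (Real.exp_pos _).le)
  set N := Real.log 2 + M + K' * ∫ y, negLog y with hN
  have hlow : ∀ᵐ x, Real.exp (c - 2 * P * N) * weight V P x ≤ density μ x := by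
    filter_upwards [hform] with x hx
    rw [hx, weight, ← Real.exp_add, Real.exp_le_exp]
    have h1 := le_logPot (density_nonneg μ) hadm.integrable hadm.integral_eq hlm hbd x
    have h2 := (log_one_add_sq_bounds x).1
    nlinarith
  refine ⟨hac, ?_, ⟨K, hK0, hK⟩, ?_, hlm, c, hform⟩
  · rw [← withDensity_density hac]
    refine withDensity_absolutelyContinuous' (measurable_density μ).ennreal_ofReal.aemeasurable ?_
    filter_upwards [hpos] with x hx
    simpa using hx
  · set a := Real.exp (c + 2 * P * M + P * Real.log 2)
    set b := Real.exp (c - 2 * P * N)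
    have ha : 0 < a := Real.exp_pos _
    have hb : 0 < b := Real.exp_pos _
    refine ⟨max a b⁻¹, lt_max_of_lt_left ha, ?_⟩
    filter_upwards [hup, hlow] with x h1 h2
    have hw := weight_pos V P x
    constructor
    · refine le_trans (mul_le_mul_of_nonneg_right ?_ hw.le) h2
      exact inv_le_of_inv_le₀ hb (le_max_right _ _)
    · exact h1.trans (mul_le_mul_of_nonneg_right (le_max_left _ _) hw.le)

/-! ### The weak derivative of the logarithmic potential -/

/-- Folding the line at x matches ordinary integrals with the symmetrised form of the Hilbert
transform. -/
lemma integral_eq_integral_Ioi_add {G : ℝ → ℝ} (hG : Integrable G) (x : ℝ) :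
    ∫ y, G y = ∫ t in Set.Ioi (0 : ℝ), (G (x + t) + G (x - t)) := by
  have h1 : Integrable fun t => G (x + t) := hG.comp_add_left x
  have h2 : Integrable fun t => G (x - t) := hG.comp_sub_left x
  rw [integral_add h1.integrableOn h2.integrableOn, ← integral_add_left_eq_self G x,
    ← integral_add_compl measurableSet_Ioi h1, Set.compl_Ioi]
  congr 1
  have := integral_comp_neg_Ioi 0 (fun t => G (x + t))
  rw [neg_zero] at this
  rw [← this]
  simp only [sub_eq_add_neg]

/-- After folding at y, integration by parts on (0, ∞) moves the derivative onto log t and produces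
the kernel 1/t. -/
lemma integral_log_mul_deriv (ψ : 𝓢(ℝ, ℝ)) (hc : HasCompactSupport ψ) (y : ℝ) :
    ∫ x, Real.log |x - y| * deriv ψ x = -hilbertSchwartz ψ y := by
  have hψd : ∀ x, HasDerivAt ψ (deriv ψ x) x := fun x => (ψ.differentiable x).hasDerivAt
  have hdc : Continuous (deriv ψ) := (ψ.smooth 1).continuous_deriv le_rfl
  obtain ⟨D, hD⟩ := hdc.bounded_above_of_compact_support hc.deriv
  have hdi : Integrable (deriv ψ) := hdc.integrable_of_hasCompactSupport hc.deriv
  have hloc : ∀ s : Set ℝ, IsCompact s → IntegrableOn (fun x => Real.log |x - y|) s := by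
    intro s hs
    have hn : Integrable fun x => negLog (x - y) := integrable_negLog.comp_sub_right y
    have hl : IntegrableOn (fun x => Real.log (1 + |x - y|)) s :=
      (Continuous.log (by fun_prop) fun x => by positivity).continuousOn.integrableOn_compact hs
    have hm : Measurable fun x => Real.log |x - y| := by fun_prop
    refine (hl.add hn.integrableOn).mono' hm.aestronglyMeasurable (.of_forall fun x => ?_)
    exact abs_log_abs_le _
  have hli : Integrable fun x => Real.log |x - y| * deriv ψ x := by
    have h1 : IntegrableOn (fun x => Real.log |x - y| * deriv ψ x) (tsupport (deriv ψ)) :=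
      (hloc _ hc.deriv).mul_bdd (c := D) hdc.aestronglyMeasurable (.of_forall hD)
    refine h1.integrable_of_forall_notMem_eq_zero fun x hx => ?_
    rw [image_eq_zero_of_notMem_tsupport hx, mul_zero]
  rw [integral_eq_integral_Ioi_add hli y]
  have e1 : ∀ t : ℝ, Real.log |y + t - y| * deriv ψ (y + t) +
      Real.log |y - t - y| * deriv ψ (y - t) =
      Real.log t * (deriv ψ (y + t) + deriv ψ (y - t)) := fun t => by
    rw [show y + t - y = t by ring, show y - t - y = -t by ring, abs_neg, Real.log_abs]
    ring
  have hv : ∀ t, HasDerivAt (fun t => ψ (y + t) - ψ (y - t)) (deriv ψ (y + t) + deriv ψ (y - t)) t :=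
    fun t => by
      have h1 : HasDerivAt (fun t => ψ (y + t)) (deriv ψ (y + t)) t :=
        HasDerivAt.comp_const_add y t (hψd _)
      have h2 : HasDerivAt (fun t => ψ (y - t)) (-deriv ψ (y - t)) t :=
        HasDerivAt.comp_const_sub y t (hψd _)
      exact (h1.sub h2).congr_deriv (by ring)
  obtain ⟨C, hC0, hC⟩ := exists_abs_sub_le ψ
  have hibp := integral_Ioi_mul_deriv_eq_deriv_mul (a := 0) (a' := 0) (b' := 0)
    (u := Real.log) (u' := fun t => t⁻¹) (v := fun t => ψ (y + t) - ψ (y - t))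
    (v' := fun t => deriv ψ (y + t) + deriv ψ (y - t))
    (fun t ht => Real.hasDerivAt_log (ne_of_gt ht)) (fun t _ => hv t) ?_ ?_ ?_ ?_
  · simp only [e1]
    rw [hibp, hilbertSchwartz, sub_zero, zero_sub]
    congr 1
    refine integral_congr_ae (.of_forall fun t => ?_)
    simp only
    rw [div_eq_inv_mul]
  · have h1 := hli.comp_add_left y
    have h2 := hli.comp_sub_left y
    refine ((h1.add h2).integrableOn (s := Set.Ioi 0)).congr (.of_forall fun t => ?_)
    simp only [Pi.add_apply, Pi.mul_apply]
    exact e1 t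
  · refine (integrable_hilbert_kernel ψ y).congr (.of_forall fun t => ?_)
    simp only [Pi.mul_apply]
    rw [div_eq_inv_mul]
  -- The difference ψ(y+t) - ψ(y-t) is O(t), so the boundary term at 0 is O(t log t).
  · have h1 : Tendsto (fun t : ℝ => 2 * C * |t * Real.log t|) (𝓝[>] 0) (𝓝 0) := by
      have := ((Real.continuous_mul_log.tendsto 0).abs.const_mul (2 * C)).mono_left
        (nhdsWithin_le_nhds (s := Set.Ioi (0 : ℝ)))
      simpa using this
    refine squeeze_zero_norm (fun t => ?_) h1
    simp only [Pi.mul_apply, norm_mul, Real.norm_eq_abs, abs_mul]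
    have := hC (y + t) (y - t)
    rw [show y + t - (y - t) = 2 * t by ring, abs_mul, abs_two] at this
    nlinarith [abs_nonneg (Real.log t)]
  · have h1 : ∀ᶠ t : ℝ in atTop, ψ (y + t) - ψ (y - t) = 0 := by
      obtain ⟨R, hR, hs⟩ := exists_support_subset_Ioo hc
      filter_upwards [eventually_ge_atTop (R + |y|)] with t ht
      have hy := neg_abs_le y
      have hy' := le_abs_self y
      rw [image_eq_zero_of_notMem_tsupport (f := ψ) fun h => by linarith [(hs h).2],
        image_eq_zero_of_notMem_tsupport (f := ψ) fun h => by linarith [(hs h).1], sub_zero]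
    refine tendsto_const_nhds.congr' ?_
    filter_upwards [h1] with t ht
    rw [Pi.mul_apply, ht, mul_zero]

/-- Fubini reduces the test integral to -∫ρ ℋ[ψ], and antisymmetry of ℋ moves the transform onto ρ.
-/
lemma hasWeakDeriv_logPot {ρ : ℝ → ℝ} (hi : Integrable ρ)
    (hl : Integrable fun x => Real.log (1 + |x|) * ρ x) (h2 : MemLp ρ 2 volume)
    (hUloc : LocallyIntegrable (logPot ρ)) :
    HasWeakDeriv (logPot ρ) (fun x => -hilbert ρ x) := by
  have hH := memLp_hilbert h2
  refine ⟨hUloc, (hH.locallyIntegrable (by norm_num)).neg, fun ψ hψ hc => ?_⟩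
  set Ψ : 𝓢(ℝ, ℝ) := hc.toSchwartzMap hψ with hΨ
  have hΨψ : (Ψ : ℝ → ℝ) = ψ := rfl
  have hdc : Continuous (deriv ψ) := hψ.continuous_deriv (by simp)
  obtain ⟨D, hD⟩ := hdc.bounded_above_of_compact_support hc.deriv
  have hdi : Integrable (deriv ψ) := hdc.integrable_of_hasCompactSupport hc.deriv
  have hdl : Integrable fun x => Real.log (1 + |x|) * deriv ψ x :=
    Continuous.integrable_of_hasCompactSupport
      ((Continuous.log (by fun_prop) fun x => by positivity).mul hdc) hc.deriv.mul_left
  have hint := integrable_logKernel hdi hi hdl hl (.of_forall hD)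
  have e1 : ∫ x, logPot ρ x * deriv ψ x =
      ∫ x, ∫ y, Real.log |x - y| * (deriv ψ x * ρ y) := by
    congr 1; ext x
    rw [logPot, ← integral_mul_const]
    congr 1; ext y; ring
  rw [e1, integral_integral_swap (f := fun x y => Real.log |x - y| * (deriv ψ x * ρ y)) hint]
  have e2 : ∀ y, ∫ x, Real.log |x - y| * (deriv ψ x * ρ y) = -(ρ y * hilbertSchwartz Ψ y) := by
    intro y
    have := integral_log_mul_deriv Ψ (hΨψ ▸ hc) y
    rw [hΨψ] at this
    rw [show -(ρ y * hilbertSchwartz Ψ y) = ρ y * -hilbertSchwartz Ψ y by ring, ← this,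
      ← integral_const_mul]
    congr 1; ext x; ring
  simp only [e2]
  have hΨ2 : MemLp ψ 2 volume := Ψ.memLp 2 volume
  have e3 : ∫ y, ρ y * hilbertSchwartz Ψ y = ∫ y, ρ y * hilbert ψ y := by
    refine integral_congr_ae ?_
    filter_upwards [hilbertSchwartz_ae_eq_hilbertR Ψ, hilbert_ae_eq hΨ2] with y h3 h4
    rw [h3, h4]
    rfl
  rw [integral_neg, e3, integral_mul_hilbert_antisymm h2 hΨ2, neg_neg, ← integral_neg]
  congr 1; ext x; ring

lemma locallyIntegrable_logPot {ρ : ℝ → ℝ} (h0 : ∀ x, 0 ≤ ρ x) (hi : Integrable ρ)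
    (h1 : ∫ x, ρ x = 1) (hl : Integrable fun x => Real.log (1 + |x|) * ρ x) {K : ℝ}
    (hK : ∀ᵐ x, ρ x ≤ K) : LocallyIntegrable (logPot ρ) := by
  have hm : AEStronglyMeasurable (logPot ρ) volume := by
    have : AEStronglyMeasurable (fun z : ℝ × ℝ => Real.log |z.1 - z.2| * ρ z.2)
        (volume.prod volume) :=
      measurable_logKernel.aestronglyMeasurable.mul hi.1.comp_snd
    exact this.integral_prod_right'
  set N := ∫ y, Real.log (1 + |y|) * ρ y
  set N' := Real.log 2 + N + K * ∫ y, negLog y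
  have hc : Continuous fun x : ℝ => Real.log (1 + |x|) + |N| + |N'| :=
    ((Continuous.log (by fun_prop) fun x => by positivity).add continuous_const).add
      continuous_const
  refine hc.locallyIntegrable.mono hm (.of_forall fun x => ?_)
  have h3 := logPot_le h0 hi h1 hl x
  have h4 := le_logPot h0 hi h1 hl hK x
  have h5 := log_one_add_abs_nonneg x
  have h6 := le_abs_self N
  have h7 := le_abs_self N'
  have h8 := abs_nonneg N
  have h9 := abs_nonneg N'
  rw [Real.norm_eq_abs, Real.norm_eq_abs, abs_le, abs_of_nonneg (by positivity)]
  constructor <;> linarith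

/-! ### Bounds and weak derivative of the equilibrium density. -/

section density

variable {V : ℝ → ℝ} {P : ℝ} {μ : Measure ℝ}

lemma GibbsDensity.bounded (h : GibbsDensity V P μ) :
    ∃ K : ℝ, 0 < K ∧ ∀ᵐ x, density μ x ≤ K := by
  obtain ⟨K, hK, hw⟩ := h.weight_bdd
  obtain ⟨C, hC, hc⟩ := h.comparable
  refine ⟨C * K, by positivity, ?_⟩
  filter_upwards [hc] with x hx
  exact hx.2.trans (mul_le_mul_of_nonneg_left (hw x) hC.le)

lemma GibbsDensity.pos (h : GibbsDensity V P μ) : ∀ᵐ x, 0 < density μ x := by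
  obtain ⟨C, hC, hc⟩ := h.comparable
  filter_upwards [hc] with x hx
  exact (mul_pos (inv_pos.2 hC) (weight_pos V P x)).trans_le hx.1

variable [IsProbabilityMeasure μ]

lemma integrable_density : Integrable (density μ) :=
  Measure.integrable_toReal_rnDeriv

lemma GibbsDensity.integral_density (h : GibbsDensity V P μ) : ∫ x, density μ x = 1 := by
  have := integral_eq_density h.ac (fun _ => (1 : ℝ))
  simpa using this.symm

lemma memLp_two_of_bounded {f : ℝ → ℝ} (hf : Integrable f) {K : ℝ} (hK : ∀ᵐ x, |f x| ≤ K) :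
    MemLp f 2 volume := by
  rw [memLp_two_iff_integrable_sq hf.1]
  refine (hf.norm.const_mul K).mono' (hf.1.pow 2) ?_
  filter_upwards [hK] with x hx
  rw [Real.norm_eq_abs, abs_pow, Real.norm_eq_abs, sq]
  exact mul_le_mul_of_nonneg_right hx (abs_nonneg _)

lemma GibbsDensity.memLp_density (h : GibbsDensity V P μ) : MemLp (density μ) 2 volume := by
  obtain ⟨K, -, hK⟩ := h.bounded
  refine memLp_two_of_bounded integrable_density (K := K) ?_
  filter_upwards [hK] with x hx
  rwa [abs_of_nonneg (density_nonneg μ x)]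

/-- The chain rule applied to the Gibbs formula ρ = exp(c - V + 2P U), with U' = -ℋ[ρ]. -/
lemma GibbsDensity.hasWeakDeriv_density (h : GibbsDensity V P μ) (hV : ContDiff ℝ 1 V) :
    HasWeakDeriv (density μ)
      (fun x => density μ x * (-deriv V x - 2 * P * hilbert (density μ) x)) := by
  obtain ⟨K, -, hK⟩ := h.bounded
  obtain ⟨c, hc⟩ := h.formula
  have hU := hasWeakDeriv_logPot integrable_density h.log_moment h.memLp_density
    (locallyIntegrable_logPot (density_nonneg μ) integrable_density h.integral_density
      h.log_moment hK)
  have hcV : HasWeakDeriv (fun x => c - V x) (deriv fun x => c - V x) :=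
    hasWeakDeriv_of_contDiff (contDiff_const.sub hV)
  have hs := hcV.add (hU.smul (2 * P))
  refine hs.exp.congr ?_ ?_
  · filter_upwards [hc] with x hx
    rw [hx]
    simp
  · filter_upwards [hc] with x hx
    simp only [Pi.add_apply, Pi.smul_apply, smul_eq_mul]
    rw [← hx, deriv_const_sub]
    ring

end density

/-! ### The commutator of the Hilbert transform with multiplication -/

/-- The operator with kernel `(χ(x) - χ(y)) / (x - y)`. -/
def commKer (χ φ : ℝ → ℝ) (x : ℝ) : ℝ := ∫ y, φ y * ((χ x - χ y) / (x - y))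

section commutator

variable {χ : ℝ → ℝ}

lemma exists_abs_sub_le_of_compact (hχ : ContDiff ℝ 1 χ) (hc : HasCompactSupport χ) :
    ∃ C : ℝ, 0 ≤ C ∧ ∀ x y, |χ x - χ y| ≤ C * |x - y| := by
  obtain ⟨C, hC⟩ := hχ.lipschitzWith_of_hasCompactSupport hc one_ne_zero
  refine ⟨C, C.2, fun x y => ?_⟩
  simpa [Real.dist_eq] using hC.dist_le_mul x y

lemma exists_abs_quotient_le (hχ : ContDiff ℝ 1 χ) (hc : HasCompactSupport χ) :
    ∃ C : ℝ, 0 ≤ C ∧ ∀ x y, |(χ x - χ y) / (x - y)| ≤ C := by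
  obtain ⟨C, h0, hC⟩ := exists_abs_sub_le_of_compact hχ hc
  refine ⟨C, h0, fun x y => ?_⟩
  rw [abs_div]
  exact div_le_of_le_mul₀ (abs_nonneg _) h0 (hC x y)

lemma measurable_quotient (hχ : Continuous χ) (x : ℝ) :
    Measurable fun y => (χ x - χ y) / (x - y) :=
  (measurable_const.sub hχ.measurable).div (measurable_const.sub measurable_id)

/-- The quotient is at most the Lipschitz constant C and at most 2B/|x-y|, so its square is below
(C² + 4B²)/(1 + (x-y)²). -/
lemma memLp_quotient (hχ : ContDiff ℝ 1 χ) (hc : HasCompactSupport χ) (x : ℝ) :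
    MemLp (fun y => (χ x - χ y) / (x - y)) 2 volume := by
  obtain ⟨C, h0, hC⟩ := exists_abs_quotient_le hχ hc
  obtain ⟨B, hB⟩ := hχ.continuous.bounded_above_of_compact_support hc
  have hm := measurable_quotient hχ.continuous x
  rw [memLp_two_iff_integrable_sq hm.aestronglyMeasurable]
  have hi : Integrable fun y : ℝ => (1 + (x - y) ^ 2)⁻¹ :=
    integrable_inv_one_add_sq.comp_sub_left x
  refine (hi.const_mul (C ^ 2 + (2 * B) ^ 2)).mono' (hm.pow_const 2).aestronglyMeasurable
    (.of_forall fun y => ?_)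
  rw [Real.norm_eq_abs, abs_of_nonneg (sq_nonneg _), ← div_eq_mul_inv,
    le_div_iff₀ (by positivity), mul_add, mul_one]
  have h1 : ((χ x - χ y) / (x - y)) ^ 2 ≤ C ^ 2 := by
    rw [← sq_abs]
    exact pow_le_pow_left₀ (abs_nonneg _) (hC x y) 2
  have h2 : ((χ x - χ y) / (x - y)) ^ 2 * (x - y) ^ 2 ≤ (2 * B) ^ 2 := by
    rw [← mul_pow]
    have h3 : |(χ x - χ y) / (x - y) * (x - y)| ≤ 2 * B := by
      have hx := hB x
      have hy := hB y
      rw [Real.norm_eq_abs] at hx hy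
      have h4 := abs_sub (χ x) (χ y)
      by_cases hxy : x - y = 0
      · rw [hxy, mul_zero, abs_zero]
        linarith [abs_nonneg (χ x)]
      · rw [div_mul_cancel₀ _ hxy]
        linarith
    rw [← sq_abs]
    exact pow_le_pow_left₀ (abs_nonneg _) h3 2
  linarith

/-- Once the commutator integral is folded at x, the identity holds pointwise under the integral
over t > 0. -/
lemma hilbertSchwartz_mul (hχ : ContDiff ℝ ∞ χ) (hc : HasCompactSupport χ) (φ ψ : 𝓢(ℝ, ℝ))
    (hψ : ∀ x, ψ x = χ x * φ x) (x : ℝ) :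
    hilbertSchwartz ψ x = χ x * hilbertSchwartz φ x + commKer χ φ x := by
  have h1 : ContDiff ℝ 1 χ := hχ.of_le (by simp)
  have hG : Integrable fun y => φ y * ((χ x - χ y) / (x - y)) :=
    (φ.memLp 2 volume).integrable_mul (memLp_quotient h1 hc x)
  rw [commKer, integral_eq_integral_Ioi_add hG x, hilbertSchwartz, hilbertSchwartz,
    ← integral_const_mul, ← integral_add ((integrable_hilbert_kernel φ x).const_mul _)]
  · refine setIntegral_congr_fun measurableSet_Ioi fun t ht => ?_
    have ht0 : t ≠ 0 := ne_of_gt ht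
    simp only [hψ]
    rw [show x - (x + t) = -t by ring, show x - (x - t) = t by ring]
    field_simp
    ring
  · exact ((hG.comp_add_left x).add (hG.comp_sub_left x)).integrableOn

/-- Multiplication by a bounded function is bounded on `L²`. -/
lemma lpBounded_mulFun {α : Type*} [MeasurableSpace α] {m : Measure α} {f : α → ℝ}
    (hf : AEStronglyMeasurable f m) {B : ℝ} (hB : ∀ᵐ x ∂m, ‖f x‖ ≤ B) :
    LpBounded m m (mulFun f) B := fun g hg => by
  have hm : AEStronglyMeasurable (mulFun f g) m := hf.mul hg.1
  have hb : ∀ᵐ x ∂m, ‖mulFun f g x‖ ≤ B * ‖g x‖ := by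
    filter_upwards [hB] with x hx
    change ‖f x * g x‖ ≤ _
    rw [norm_mul]
    gcongr
  exact ⟨hg.of_le_mul hm hb, eLpNorm_le_mul_eLpNorm_of_ae_le_mul hb 2⟩

/-- For fixed x this is an inner product with a fixed L² function, so L² convergence gives
convergence at every point. -/
lemma tendsto_commKer (hχ : ContDiff ℝ 1 χ) (hc : HasCompactSupport χ) {f : ℕ → ℝ → ℝ}
    {g : ℝ → ℝ} (hf : ∀ n, MemLp (f n) 2 volume) (hg : MemLp g 2 volume)
    (h : Tendsto (fun n => (hf n).toLp (f n)) atTop (𝓝 (hg.toLp g))) (x : ℝ) :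
    Tendsto (fun n => commKer χ (f n) x) atTop (𝓝 (commKer χ g x)) := by
  have hk := memLp_quotient hχ hc x
  have h1 : ∀ (u : ℝ → ℝ) (hu : MemLp u 2 volume),
      inner ℝ (hk.toLp _) (hu.toLp u) = commKer χ u x := fun u hu => by
    rw [L2.inner_def, commKer]
    refine integral_congr_ae ?_
    filter_upwards [hk.coeFn_toLp, hu.coeFn_toLp] with y h2 h3
    rw [h2, h3]
    simp
  simp only [← h1 _ hg, ← h1 _ (hf _)]
  exact tendsto_const_nhds.inner h

/-- The commutator of ℋ with χ is bounded on L² and is given by the kernel on Schwartz functions.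
Along an approximating sequence it converges almost everywhere on a subsequence, while the kernel
integrals converge everywhere, so the two limits agree. -/
lemma hilbert_mul_ae_eq (hχ : ContDiff ℝ ∞ χ) (hc : HasCompactSupport χ) {f : ℝ → ℝ}
    (hf : MemLp f 2 volume) :
    hilbert (fun x => χ x * f x) =ᵐ[volume] fun x => χ x * hilbert f x + commKer χ f x := by
  have h1 : ContDiff ℝ 1 χ := hχ.of_le (by simp)
  obtain ⟨B, hB⟩ := hχ.continuous.bounded_above_of_compact_support hc
  have hbd := lpBounded_mulFun (m := volume) hχ.continuous.aestronglyMeasurable (.of_forall hB)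
  set Mχ := lpMap (mulFun χ) B hbd with hM
  have hMae : ∀ u : Lp ℝ 2 (volume : Measure ℝ), Mχ u =ᵐ[volume] fun x => χ x * u x :=
    lpMap_coeFn hbd
  have hMto : ∀ (u : ℝ → ℝ) (hu : MemLp u 2 volume) (hu' : MemLp (fun x => χ x * u x) 2 volume),
      Mχ (hu.toLp u) = hu'.toLp _ := fun u hu hu' => by
    refine Lp.ext ?_
    filter_upwards [hMae (hu.toLp u), hu.coeFn_toLp, hu'.coeFn_toLp] with x h2 h3 h4
    rw [h2, h3, h4]
  obtain ⟨φ, hφ⟩ := exists_schwartz_tendsto hf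
  have hφ2 : ∀ n, MemLp (φ n) 2 volume := fun n => (φ n).memLp 2 volume
  set E : Lp ℝ 2 (volume : Measure ℝ) →L[ℝ] Lp ℝ 2 (volume : Measure ℝ) :=
    hilbertR ∘L Mχ - Mχ ∘L hilbertR with hE
  have hEt : Tendsto (fun n => E ((φ n).toLp 2 (volume : Measure ℝ))) atTop
      (𝓝 (E (hf.toLp f))) := (E.continuous.tendsto _).comp hφ
  have hEφ : ∀ n, E ((φ n).toLp 2 (volume : Measure ℝ)) =ᵐ[volume] commKer χ (φ n) := fun n => by
    set ψ : 𝓢(ℝ, ℝ) := (hc.mul_right (f' := φ n)).toSchwartzMap (hχ.mul ((φ n).smooth _)) with hψ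
    have hψχ : ∀ x, ψ x = χ x * φ n x := fun x => rfl
    have e1 : Mχ ((φ n).toLp 2 (volume : Measure ℝ)) = ψ.toLp 2 (volume : Measure ℝ) :=
      hMto _ (hφ2 n) (ψ.memLp 2 volume)
    have e2 : E ((φ n).toLp 2 (volume : Measure ℝ)) = hilbertR (ψ.toLp 2 (volume : Measure ℝ)) -
        Mχ (hilbertR ((φ n).toLp 2 (volume : Measure ℝ))) := by rw [← e1]; rfl
    rw [e2]
    filter_upwards [Lp.coeFn_sub (hilbertR (ψ.toLp 2 (volume : Measure ℝ)))
      (Mχ (hilbertR ((φ n).toLp 2 (volume : Measure ℝ)))),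
      hMae (hilbertR ((φ n).toLp 2 (volume : Measure ℝ))),
      hilbertSchwartz_ae_eq_hilbertR ψ, hilbertSchwartz_ae_eq_hilbertR (φ n)] with x h2 h3 h4 h5
    rw [h2, Pi.sub_apply, h3, ← h4, ← h5, hilbertSchwartz_mul hχ hc (φ n) ψ hψχ x]
    ring
  obtain ⟨ns, hmono, hns⟩ := (tendstoInMeasure_of_tendsto_Lp hEt).exists_seq_tendsto_ae
  have hlim := tendsto_commKer h1 hc hφ2 hf hφ
  have hχf : MemLp (fun x => χ x * f x) 2 volume := (hbd f hf).1
  have e3 : E (hf.toLp f) = hilbertR (hχf.toLp _) - Mχ (hilbertR (hf.toLp f)) := by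
    rw [← hMto f hf hχf]; rfl
  have hns' : ∀ᵐ x, E (hf.toLp f) x = commKer χ f x := by
    filter_upwards [hns, ae_all_iff.2 hEφ] with x h2 h3
    refine tendsto_nhds_unique h2 ?_
    simp only [h3]
    exact (hlim x).comp hmono.tendsto_atTop
  rw [e3] at hns'
  filter_upwards [hns', Lp.coeFn_sub (hilbertR (hχf.toLp _)) (Mχ (hilbertR (hf.toLp f))),
    hMae (hilbertR (hf.toLp f)), hilbert_ae_eq hf, hilbert_ae_eq hχf] with x h2 h3 h4 h5 h6
  rw [h3, Pi.sub_apply, h4, ← h5, ← h6] at h2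
  linarith

lemma quotient_eq_integral (hχ : ContDiff ℝ 1 χ) {x y : ℝ} (hxy : x ≠ y) :
    (χ x - χ y) / (x - y) = ∫ s in (0 : ℝ)..1, deriv χ (y + s * (x - y)) := by
  have h := intervalIntegral.mul_integral_comp_add_mul (f := deriv χ) (a := 0) (b := 1) (x - y) y
  rw [mul_zero, add_zero, mul_one, add_sub_cancel, intervalIntegral.integral_deriv_eq_sub
    (fun t _ => hχ.differentiable one_ne_zero t)
    ((hχ.continuous_deriv le_rfl).intervalIntegrable _ _)] at h
  rw [← h, mul_div_cancel_left₀ _ (sub_ne_zero.2 hxy)]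
  simp only [mul_comm]

/-- The quotient is the mean of χ' over the segment from y to x, and χ' is Lipschitz. On the
diagonal the quotient is 0 by convention rather than χ'(y), hence the exclusions. -/
lemma exists_quotient_lipschitz (hχ : ContDiff ℝ 2 χ) (hc : HasCompactSupport χ) :
    ∃ C : ℝ, 0 ≤ C ∧ ∀ x x' y, x ≠ y → x' ≠ y →
      |(χ x - χ y) / (x - y) - (χ x' - χ y) / (x' - y)| ≤ C * |x - x'| := by
  have h1 : ContDiff ℝ 1 χ := hχ.of_le (by norm_num)
  have hd : ContDiff ℝ 1 (deriv χ) := by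
    have : ContDiff ℝ (1 + 1) χ := by simpa [one_add_one_eq_two] using hχ
    exact (contDiff_succ_iff_deriv.1 this).2.2
  have hdc : Continuous (deriv χ) := hd.continuous
  obtain ⟨C, h0, hC⟩ := exists_abs_sub_le_of_compact hd hc.deriv
  refine ⟨C, h0, fun x x' y hx hx' => ?_⟩
  rw [quotient_eq_integral h1 hx, quotient_eq_integral h1 hx', ← intervalIntegral.integral_sub
    (Continuous.intervalIntegrable (by fun_prop) _ _)
    (Continuous.intervalIntegrable (by fun_prop) _ _)]
  have := intervalIntegral.norm_integral_le_of_norm_le_const (a := (0 : ℝ)) (b := 1)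
    (f := fun s => deriv χ (y + s * (x - y)) - deriv χ (y + s * (x' - y)))
    (C := C * |x - x'|) fun s hs => ?_
  · simpa using this
  · rw [Set.uIoc_of_le zero_le_one] at hs
    refine (hC _ _).trans ?_
    rw [show y + s * (x - y) - (y + s * (x' - y)) = s * (x - x') by ring, abs_mul,
      abs_of_pos hs.1]
    have h3 : s * |x - x'| ≤ 1 * |x - x'| :=
      mul_le_mul_of_nonneg_right hs.2 (abs_nonneg _)
    rw [one_mul] at h3
    exact mul_le_mul_of_nonneg_left h3 h0

lemma integrable_commKer (hχ : ContDiff ℝ 1 χ) (hc : HasCompactSupport χ) {f : ℝ → ℝ}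
    (hf : Integrable f) (x : ℝ) : Integrable fun y => f y * ((χ x - χ y) / (x - y)) := by
  obtain ⟨C, h0, hC⟩ := exists_abs_quotient_le hχ hc
  exact hf.mul_bdd (c := C) (measurable_quotient hχ.continuous x).aestronglyMeasurable
    (.of_forall fun y => hC x y)

lemma exists_abs_commKer_le (hχ : ContDiff ℝ 1 χ) (hc : HasCompactSupport χ) {f : ℝ → ℝ}
    (hf : Integrable f) : ∃ C, ∀ x, |commKer χ f x| ≤ C := by
  obtain ⟨C, h0, hC⟩ := exists_abs_quotient_le hχ hc
  refine ⟨∫ y, |f y| * C, fun x => ?_⟩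
  rw [commKer, ← Real.norm_eq_abs]
  refine norm_integral_le_of_norm_le (hf.abs.mul_const C) (.of_forall fun y => ?_)
  rw [norm_mul, Real.norm_eq_abs]
  exact mul_le_mul_of_nonneg_left (hC x y) (abs_nonneg _)

/-- Needed so that Ξ[φ'] has a weak derivative in L²(μ): its nonlocal term is Lipschitz, hence has a
bounded derivative. -/
lemma exists_lipschitzWith_commKer (hχ : ContDiff ℝ 2 χ) (hc : HasCompactSupport χ) {f : ℝ → ℝ}
    (hf : Integrable f) : ∃ K, LipschitzWith K (commKer χ f) := by
  have h1 : ContDiff ℝ 1 χ := hχ.of_le (by norm_num)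
  obtain ⟨C, h0, hC⟩ := exists_quotient_lipschitz hχ hc
  refine ⟨Real.toNNReal (C * ∫ y, |f y|), LipschitzWith.of_dist_le' fun x x' => ?_⟩
  rw [Real.dist_eq, Real.dist_eq, commKer, commKer,
    ← integral_sub (integrable_commKer h1 hc hf x) (integrable_commKer h1 hc hf x')]
  rw [show C * (∫ y, |f y|) * |x - x'| = ∫ y, |f y| * (C * |x - x'|) by
    rw [integral_mul_const]; ring]
  rw [← Real.norm_eq_abs]
  refine norm_integral_le_of_norm_le (hf.abs.mul_const _) ?_
  have hn : ∀ z : ℝ, ∀ᵐ y, z ≠ y := fun z => by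
    have : ∀ᵐ y : ℝ, y ≠ z := by simp [ae_iff]
    filter_upwards [this] with y hy using hy.symm
  filter_upwards [hn x, hn x'] with y hy hy'
  rw [← mul_sub, norm_mul, Real.norm_eq_abs]
  exact mul_le_mul_of_nonneg_left (hC x x' y hy hy') (abs_nonneg _)

lemma locAC_of_lipschitzWith {F : ℝ → ℝ} {K : NNReal} (h : LipschitzWith K F) : LocAC F :=
  fun _ _ => h.lipschitzOnWith.absolutelyContinuousOnInterval

lemma hasWeakDeriv_of_lipschitzWith {F : ℝ → ℝ} {K : NNReal} (h : LipschitzWith K F) :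
    HasWeakDeriv F (deriv F) :=
  (locAC_of_lipschitzWith h).hasWeakDeriv (h.ae_differentiableAt_real.mono fun _ hx => hx.hasDerivAt)

end commutator

/-! ### Products of weakly differentiable functions -/

lemma HasWeakDeriv.mul {f g u v : ℝ → ℝ} (h : HasWeakDeriv f g) (k : HasWeakDeriv u v) :
    HasWeakDeriv (fun x => f x * u x) (fun x => g x * u x + f x * v x) := by
  obtain ⟨F, hF, hfF, hF', -⟩ := h.exists_locAC
  obtain ⟨U, hU, huU, hU', -⟩ := k.exists_locAC
  have hd : ∀ᵐ x, HasDerivAt (F * U) (g x * U x + F x * v x) x := by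
    filter_upwards [hF', hU'] with x h1 h2 using h1.mul h2
  refine ((hF.mul hU).hasWeakDeriv hd).congr ?_ ?_
  · filter_upwards [hfF, huU] with x h1 h2
    rw [Pi.mul_apply, h1, h2]
  · filter_upwards [hfF, huU] with x h1 h2
    rw [h1, h2]

lemma HasWeakDeriv.integral_eq_zero {f g : ℝ → ℝ} (h : HasWeakDeriv f g) (hf : Integrable f)
    (hg : Integrable g) : ∫ x, g x = 0 := by
  have := h.integral_mul_deriv hf hg (b := fun _ => 1) contDiff_const (C := 1) (by simp) (by simp)
  simpa using this

/-- An integrable function with integrable weak derivative has derivative of integral zero; no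
separate decay of the factors is required, only integrability of the three products. -/
lemma HasWeakDeriv.integral_mul_add {f g u v : ℝ → ℝ} (h : HasWeakDeriv f g)
    (k : HasWeakDeriv u v) (h1 : Integrable fun x => f x * u x)
    (h2 : Integrable fun x => g x * u x) (h3 : Integrable fun x => f x * v x) :
    (∫ x, g x * u x) + ∫ x, f x * v x = 0 := by
  rw [← integral_add h2 h3]
  exact (h.mul k).integral_eq_zero h1 (h2.add h3)

/-! ### The space `H` is complete -/

section space

variable {V : ℝ → ℝ} {P : ℝ} {μ : Measure ℝ}

/-- The weight is continuous and positive, hence bounded below on compact sets; locally, L²(μ) thus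
controls L²(dx). -/
lemma GibbsDensity.exists_le_density (h : GibbsDensity V P μ) (hV : Continuous V) (R : ℝ) :
    ∃ c : ℝ, 0 < c ∧ ∀ᵐ x, x ∈ Set.Icc (-R) R → c ≤ density μ x := by
  obtain ⟨C, hC, hc⟩ := h.comparable
  obtain ⟨c, hc0, hcR⟩ : ∃ c : ℝ, 0 < c ∧ ∀ x ∈ Set.Icc (-R) R, c ≤ weight V P x := by
    rcases (Set.Icc (-R) R).eq_empty_or_nonempty with he | hne
    · exact ⟨1, one_pos, by simp [he]⟩
    · obtain ⟨x, -, hx⟩ := isCompact_Icc.exists_isMinOn hne (continuous_weight hV P).continuousOn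
      exact ⟨weight V P x, weight_pos V P x, fun y hy => hx hy⟩
  refine ⟨C⁻¹ * c, by positivity, ?_⟩
  filter_upwards [hc] with x hx hxR
  exact (mul_le_mul_of_nonneg_left (hcR x hxR) (by positivity)).trans hx.1

lemma GibbsDensity.ae_iff (h : GibbsDensity V P μ) {p : ℝ → Prop} :
    (∀ᵐ x ∂μ, p x) ↔ ∀ᵐ x, p x :=
  ⟨fun hp => h.ac'.ae_le hp, fun hp => h.ac.ae_le hp⟩

variable [IsProbabilityMeasure μ]

lemma GibbsDensity.locallyIntegrable (h : GibbsDensity V P μ) (hV : Continuous V) {f : ℝ → ℝ}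
    (hf : Integrable f μ) : LocallyIntegrable f volume := by
  have hf' := (integrable_iff_density h.ac).1 hf
  rw [locallyIntegrable_iff]
  intro k hk
  obtain ⟨R, hR⟩ := hk.isBounded.subset_closedBall 0
  rw [Real.closedBall_eq_Icc, zero_sub, zero_add] at hR
  obtain ⟨c, hc0, hc⟩ := h.exists_le_density hV R
  refine Integrable.mono' (g := fun x => c⁻¹ * |density μ x * f x|)
    (hf'.abs.const_mul c⁻¹).integrableOn (hf.1.mono_ac h.ac').restrict ?_
  rw [ae_restrict_iff' hk.measurableSet]
  filter_upwards [hc] with x hx hxk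
  rw [abs_mul, abs_of_nonneg (density_nonneg μ x), Real.norm_eq_abs, ← mul_assoc]
  have : 1 ≤ c⁻¹ * density μ x := by
    rw [inv_mul_eq_div, one_le_div hc0]
    exact hx (hR hxk)
  nlinarith [abs_nonneg (f x)]

/-- `ψ / ρ` for a compactly supported function `ψ`. -/
lemma GibbsDensity.memLp_div (h : GibbsDensity V P μ) (hV : Continuous V) {ψ : ℝ → ℝ}
    (hψ : Continuous ψ) (hc : HasCompactSupport ψ) :
    MemLp (fun x => ψ x / density μ x) 2 μ := by
  obtain ⟨R, hR, hs⟩ := exists_support_subset_Ioo hc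
  obtain ⟨B, hB⟩ := hψ.bounded_above_of_compact_support hc
  obtain ⟨c, hc0, hcR⟩ := h.exists_le_density hV R
  refine MemLp.of_bound (C := B / c)
    (hψ.measurable.div (measurable_density μ)).aestronglyMeasurable ?_ 
  rw [h.ae_iff]
  filter_upwards [hcR] with x hx
  rw [norm_div, Real.norm_eq_abs (density μ x), abs_of_nonneg (density_nonneg μ x)]
  by_cases hxs : x ∈ tsupport ψ
  · exact div_le_div₀ ((norm_nonneg _).trans (hB x)) (hB x) hc0
      (hx (Set.Ioo_subset_Icc_self (hs hxs)))
  · rw [image_eq_zero_of_notMem_tsupport hxs, norm_zero, zero_div]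
    exact div_nonneg ((norm_nonneg _).trans (hB x)) hc0.le

/-- Lebesgue pairing with a test function is a continuous functional on L²(μ), represented by ψ/ρ;
weak-derivative conditions are therefore closed in L²(μ). -/
lemma GibbsDensity.integral_mul_eq_inner (h : GibbsDensity V P μ) (hV : Continuous V)
    {ψ : ℝ → ℝ} (hψ : Continuous ψ) (hc : HasCompactSupport ψ) (f : Lp ℝ 2 μ) :
    ∫ x, f x * ψ x = inner ℝ ((h.memLp_div hV hψ hc).toLp _) f := by
  rw [L2.inner_def, integral_eq_density h.ac]
  refine integral_congr_ae ?_
  filter_upwards [h.ae_iff.1 (h.memLp_div hV hψ hc).coeFn_toLp, h.pos] with x hx hx0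
  rw [hx]
  simp only [RCLike.inner_apply, conj_trivial]
  field_simp

lemma integrable_coeFn (f : Lp ℝ 2 μ) : Integrable f μ := (Lp.memLp f).integrable (by norm_num)

lemma inner_one_eq_integral (f : Lp ℝ 2 μ) :
    inner ℝ ((memLp_const (1 : ℝ)).toLp _ : Lp ℝ 2 μ) f = ∫ x, f x ∂μ := by
  rw [L2.inner_def]
  refine integral_congr_ae ?_
  filter_upwards [(memLp_const (1 : ℝ) : MemLp _ 2 μ).coeFn_toLp] with x hx
  rw [hx]
  simp

lemma GibbsDensity.mem_HSubmodule_iff (h : GibbsDensity V P μ) (p : Lp ℝ 2 μ × Lp ℝ 2 μ) :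
    p ∈ HSubmodule μ ↔ HasWeakDeriv p.1 p.2 ∧ ∫ x, p.1 x ∂μ = 0 := by
  constructor
  · rintro ⟨⟨f, g, hf, hg, hfg⟩, h0⟩
    exact ⟨hfg.congr (h.ae_iff.1 hf) (h.ae_iff.1 hg), h0⟩
  · rintro ⟨hw, h0⟩
    exact ⟨⟨p.1, p.2, .rfl, .rfl, hw⟩, h0⟩

lemma GibbsDensity.isClosed_weakDeriv (h : GibbsDensity V P μ) (hV : Continuous V) :
    IsClosed {p : Lp ℝ 2 μ × Lp ℝ 2 μ | HasWeakDeriv p.1 p.2} := by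
  have : {p : Lp ℝ 2 μ × Lp ℝ 2 μ | HasWeakDeriv p.1 p.2} =
      ⋂ (ψ : ℝ → ℝ) (hψ : ContDiff ℝ ∞ ψ) (hc : HasCompactSupport ψ),
        {p | inner ℝ ((h.memLp_div hV (hψ.continuous_deriv (by simp)) hc.deriv).toLp _) p.1 =
          -inner ℝ ((h.memLp_div hV hψ.continuous hc).toLp _) p.2} := by
    ext p
    simp only [Set.mem_ofPred_eq, Set.mem_iInter, HasWeakDeriv,
      h.locallyIntegrable hV (integrable_coeFn p.1), h.locallyIntegrable hV (integrable_coeFn p.2),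
      true_and]
    refine forall_congr' fun ψ => forall_congr' fun hψ => forall_congr' fun hc => ?_
    rw [h.integral_mul_eq_inner hV (hψ.continuous_deriv (by simp)) hc.deriv,
      h.integral_mul_eq_inner hV hψ.continuous hc]
  rw [this]
  exact isClosed_iInter fun ψ => isClosed_iInter fun hψ => isClosed_iInter fun hc =>
    isClosed_eq (by fun_prop) (by fun_prop)

lemma GibbsDensity.isClosed_HSubmodule (h : GibbsDensity V P μ) (hV : Continuous V) :
    IsClosed (HSubmodule μ : Set (Lp ℝ 2 μ × Lp ℝ 2 μ)) := by
  have : (HSubmodule μ : Set (Lp ℝ 2 μ × Lp ℝ 2 μ)) =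
      {p : Lp ℝ 2 μ × Lp ℝ 2 μ | HasWeakDeriv p.1 p.2} ∩
        {p | inner ℝ ((memLp_const (1 : ℝ)).toLp _ : Lp ℝ 2 μ) p.1 = 0} := by
    ext p
    rw [SetLike.mem_coe, h.mem_HSubmodule_iff, Set.mem_inter_iff, Set.mem_ofPred_eq,
      Set.mem_ofPred_eq, inner_one_eq_integral]
  rw [this]
  exact (h.isClosed_weakDeriv hV).inter (isClosed_eq (by fun_prop) (by fun_prop))

variable (μ) in
/-- The pairs `(h, h')` with `h` a test function. -/
def testPairs : Submodule ℝ (WithLp 2 (Lp ℝ 2 μ × Lp ℝ 2 μ)) where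
  carrier := {p | ∃ h : ℝ → ℝ, ContDiff ℝ ∞ h ∧ HasCompactSupport h ∧
    h =ᵐ[μ] p.fst ∧ deriv h =ᵐ[μ] p.snd}
  zero_mem' := ⟨0, contDiff_const, HasCompactSupport.zero, (Lp.coeFn_zero ℝ 2 μ).symm, by
    have : deriv (0 : ℝ → ℝ) = 0 := by ext; simp [Pi.zero_def]
    rw [this]
    exact (Lp.coeFn_zero ℝ 2 μ).symm⟩
  add_mem' := by
    rintro p q ⟨f, hf, hfc, h1, h2⟩ ⟨g, hg, hgc, h3, h4⟩
    refine ⟨f + g, hf.add hg, hfc.add hgc, (h1.add h3).trans (Lp.coeFn_add _ _).symm, ?_⟩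
    have : deriv (f + g) = deriv f + deriv g := by
      ext x
      exact deriv_add (hf.differentiable (by simp) x) (hg.differentiable (by simp) x)
    rw [this]
    exact (h2.add h4).trans (Lp.coeFn_add _ _).symm
  smul_mem' := by
    rintro c p ⟨f, hf, hfc, h1, h2⟩
    refine ⟨c • f, contDiff_const.smul hf, hfc.smul_left (f := fun _ => c),
      (h1.const_smul c).trans (Lp.coeFn_smul _ _).symm, ?_⟩
    have : deriv (c • f) = c • deriv f := by
      ext x
      exact deriv_const_smul c (hf.differentiable (by simp) x)
    rw [this]
    exact (h2.const_smul c).trans (Lp.coeFn_smul _ _).symm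

lemma GibbsDensity.integrable_mul_density (h : GibbsDensity V P μ) {f g : ℝ → ℝ}
    (hf : MemLp f 2 μ) (hg : MemLp g 2 μ) : Integrable fun x => f x * (g x * density μ x) := by
  refine ((integrable_iff_density h.ac).1 (hf.integrable_mul hg)).congr (.of_forall fun x => ?_)
  simp only [Pi.mul_apply]
  ring

lemma GibbsDensity.integral_mul_density (h : GibbsDensity V P μ) (f g : Lp ℝ 2 μ) :
    ∫ x, f x * (g x * density μ x) = inner ℝ f g := by
  rw [L2.inner_def, integral_eq_density h.ac]
  refine integral_congr_ae (.of_forall fun x => ?_)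
  simp only [RCLike.inner_apply, conj_trivial]
  ring

/-- A closed condition on `(u, u')` that holds for test functions holds in general. -/
lemma GibbsDensity.closed_induction (h : GibbsDensity V P μ) {C : Set (Lp ℝ 2 μ × Lp ℝ 2 μ)}
    (hC : IsClosed C)
    (htest : ∀ f : ℝ → ℝ, ContDiff ℝ ∞ f → HasCompactSupport f → ∀ p : Lp ℝ 2 μ × Lp ℝ 2 μ,
      f =ᵐ[μ] p.1 → deriv f =ᵐ[μ] p.2 → p ∈ C)
    {p : Lp ℝ 2 μ × Lp ℝ 2 μ} (hp : HasWeakDeriv p.1 p.2) : p ∈ C := by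
  have hcl : WithLp.toLp 2 p ∈ (testPairs μ).topologicalClosure := by
    -- Density by duality: if (z₁, z₂) is orthogonal to all test pairs, then (z₂ρ)' = z₁ρ weakly,
    -- and integrating by parts against p shows that p is orthogonal to z. No truncation or
    -- mollification of p is involved.
    rw [← Submodule.orthogonal_orthogonal_eq_closure, Submodule.mem_orthogonal']
    intro z hz
    rw [Submodule.mem_orthogonal'] at hz
    have hw : HasWeakDeriv (fun x => z.snd x * density μ x) (fun x => z.fst x * density μ x) := by
      have hl : ∀ f : Lp ℝ 2 μ, LocallyIntegrable (fun x => f x * density μ x) volume := fun f => by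
        have := (integrable_iff_density h.ac).1 (integrable_coeFn f)
        simp only [mul_comm (density μ _)] at this
        exact this.locallyIntegrable
      refine ⟨hl _, hl _, fun ψ hψ hc => ?_⟩
      have h1 : MemLp ψ 2 μ := hψ.continuous.memLp_of_hasCompactSupport hc
      have h2 : MemLp (deriv ψ) 2 μ :=
        (hψ.continuous_deriv (by simp)).memLp_of_hasCompactSupport hc.deriv
      have h3 := hz (WithLp.toLp 2 (h1.toLp _, h2.toLp _))
        ⟨ψ, hψ, hc, h1.coeFn_toLp.symm, h2.coeFn_toLp.symm⟩
      rw [WithLp.prod_inner_apply] at h3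
      simp only at h3
      rw [← h.integral_mul_density, ← h.integral_mul_density] at h3
      have e1 : ∫ x, z.snd x * density μ x * deriv ψ x =
          ∫ x, z.snd x * ((h2.toLp _ : Lp ℝ 2 μ) x * density μ x) := by
        refine integral_congr_ae ?_
        filter_upwards [h.ae_iff.1 h2.coeFn_toLp] with x hx
        rw [hx]; ring
      have e2 : ∫ x, z.fst x * density μ x * ψ x =
          ∫ x, z.fst x * ((h1.toLp _ : Lp ℝ 2 μ) x * density μ x) := by
        refine integral_congr_ae ?_
        filter_upwards [h.ae_iff.1 h1.coeFn_toLp] with x hx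
        rw [hx]; ring
      rw [e1, e2]
      exact eq_neg_of_add_eq_zero_right h3
    rw [WithLp.prod_inner_apply]
    simp only
    rw [← h.integral_mul_density, ← h.integral_mul_density, add_comm]
    exact hp.integral_mul_add hw (h.integrable_mul_density (Lp.memLp _) (Lp.memLp _))
      (h.integrable_mul_density (Lp.memLp _) (Lp.memLp _))
      (h.integrable_mul_density (Lp.memLp _) (Lp.memLp _))
  have hC' : IsClosed ((WithLp.ofLp : WithLp 2 (Lp ℝ 2 μ × Lp ℝ 2 μ) → _) ⁻¹' C) :=
    hC.preimage (WithLp.prod_continuous_ofLp 2 _ _)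
  exact closure_minimal (fun q hq => by
    obtain ⟨f, hf, hfc, h1, h2⟩ := hq
    exact htest f hf hfc _ h1 h2) hC' hcl

/-! ### The Poincaré inequality on `H` and completeness -/

lemma norm_sq_sub_sq_eq (f : Lp ℝ 2 μ) :
    ∫ x, (f x - ∫ y, f y ∂μ) ^ 2 ∂μ = ‖f‖ ^ 2 - (∫ y, f y ∂μ) ^ 2 := by
  set m := ∫ y, f y ∂μ with hm
  have h2 : Integrable (fun x => (f x) ^ 2) μ := (Lp.memLp f).integrable_sq
  have h1 := integrable_coeFn f
  have e : ∀ x, (f x - m) ^ 2 = (f x) ^ 2 + (-(2 * m)) * f x + m ^ 2 := fun x => by ring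
  simp only [e]
  rw [integral_add_three h2 (h1.const_mul _) (integrable_const _), integral_const_mul, ← hm,
    ← real_inner_self_eq_norm_sq, L2.inner_def]
  simp only [RCLike.inner_apply, conj_trivial, integral_const, probReal_univ, one_smul, ← sq]
  ring

/-- The variance is ‖f‖² - ⟨1, f⟩², continuous on L²(μ), so the Poincaré inequality is a closed
condition and extends from test functions. -/
lemma GibbsDensity.exists_norm_le (h : GibbsDensity V P μ) (hp : Poincare μ) :
    ∃ C : ℝ, 0 < C ∧ ∀ p ∈ HSubmodule μ, ‖p.1‖ ^ 2 ≤ C * ‖p.2‖ ^ 2 := by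
  obtain ⟨C, hC, hP⟩ := hp
  refine ⟨C, hC, fun p hp => ?_⟩
  rw [h.mem_HSubmodule_iff] at hp
  have hcl : IsClosed {q : Lp ℝ 2 μ × Lp ℝ 2 μ |
      ‖q.1‖ ^ 2 - (inner ℝ ((memLp_const (1 : ℝ)).toLp _ : Lp ℝ 2 μ) q.1) ^ 2 ≤
        C * ‖q.2‖ ^ 2} := isClosed_le (by fun_prop) (by fun_prop)
  have := h.closed_induction hcl (fun f hf hfc q h1 h2 => ?_) hp.1
  · rw [Set.mem_ofPred_eq, inner_one_eq_integral, hp.2] at this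
    simpa using this
  · rw [Set.mem_ofPred_eq, inner_one_eq_integral, ← norm_sq_sub_sq_eq,
      ← real_inner_self_eq_norm_sq q.2, L2.inner_def]
    have e1 : ∫ x, (q.1 x - ∫ y, q.1 y ∂μ) ^ 2 ∂μ = ∫ x, (f x - ∫ y, f y ∂μ) ^ 2 ∂μ := by
      rw [integral_congr_ae h1]
      refine integral_congr_ae ?_
      filter_upwards [h1] with x hx
      rw [hx]
    have e2 : ∫ x, inner ℝ (q.2 x) (q.2 x) ∂μ = ∫ x, (deriv f x) ^ 2 ∂μ := by
      refine integral_congr_ae ?_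
      filter_upwards [h2] with x hx
      simp [hx, sq]
    rw [e1, e2]
    exact hP f (hf.of_le (by simp)) hfc

lemma HSpace.inner_eq (u v : HSpace μ) : inner ℝ u v = inner ℝ u.d v.d := rfl

lemma HSpace.ext {u v : HSpace μ} (h1 : u.fn = v.fn) (h2 : u.d = v.d) : u = v :=
  Subtype.ext (Prod.ext h1 h2)

lemma GibbsDensity.hasWeakDeriv_fn (h : GibbsDensity V P μ) (u : HSpace μ) :
    HasWeakDeriv u.fn u.d := ((h.mem_HSubmodule_iff u.1).1 u.2).1

lemma HSpace.integral_fn (u : HSpace μ) : ∫ x, u.fn x ∂μ = 0 := u.2.2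

lemma GibbsDensity.eq_of_fn_eq (h : GibbsDensity V P μ) {u v : HSpace μ} (huv : u.fn = v.fn) :
    u = v := by
  refine HSpace.ext huv (Lp.ext (h.ae_iff.2 ?_))
  have h1 := h.hasWeakDeriv_fn u
  rw [huv] at h1
  exact h1.unique (h.hasWeakDeriv_fn v)

lemma GibbsDensity.eq_zero_of_norm_eq_zero (h : GibbsDensity V P μ) (hp : Poincare μ)
    (u : HSpace μ) (hu : ‖u‖ = 0) : u = 0 := by
  obtain ⟨C, -, hC⟩ := h.exists_norm_le hp
  have h1 := hC u.1 u.2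
  have h2 : ‖u.1.2‖ = 0 := hu
  rw [h2] at h1
  have h3 : ‖u.1.1‖ = 0 := by nlinarith [norm_nonneg u.1.1]
  exact HSpace.ext (norm_eq_zero.1 h3) (norm_eq_zero.1 h2)

/-- With the product norm the space of pairs is closed, hence complete. The Poincaré inequality
makes u ↦ u' antilipschitz for that norm, so its range in L²(μ) is complete, and the seminorm of H
is induced from this range. -/
lemma GibbsDensity.completeSpace (h : GibbsDensity V P μ) (hV : Continuous V) (hp : Poincare μ) :
    CompleteSpace (HSpace μ) := by
  obtain ⟨C, hC0, hC⟩ := h.exists_norm_le hp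
  have hc : CompleteSpace (HSubmodule μ) := (h.isClosed_HSubmodule hV).completeSpace_coe
  let ι : HSubmodule μ →L[ℝ] Lp ℝ 2 μ :=
    (ContinuousLinearMap.snd ℝ (Lp ℝ 2 μ) (Lp ℝ 2 μ)) ∘L (HSubmodule μ).subtypeL
  have hι : AntilipschitzWith (Real.toNNReal (√C + 1)) ι := by
    refine ι.antilipschitz_of_bound fun p => ?_
    rw [Real.coe_toNNReal _ (by positivity)]
    change max ‖p.1.1‖ ‖p.1.2‖ ≤ (√C + 1) * ‖p.1.2‖
    have h1 : ‖p.1.1‖ ≤ √C * ‖p.1.2‖ := by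
      refine abs_le_of_sq_le_sq' ?_ (by positivity) |>.2
      rw [mul_pow, Real.sq_sqrt hC0.le]
      exact hC p.1 p.2
    have h2 := norm_nonneg p.1.2
    have h3 := Real.sqrt_nonneg C
    refine max_le ?_ ?_ <;> nlinarith
  have hrange : IsComplete (Set.range (HSpace.dₗ μ)) := by
    have : Set.range (HSpace.dₗ μ) = Set.range ι := rfl
    rw [this]
    exact (hι.isClosed_range ι.uniformContinuous).isComplete
  have hui : IsUniformInducing (HSpace.dₗ μ) := ⟨rfl⟩
  rw [completeSpace_iff_isComplete_univ, ← hui.isComplete_iff, Set.image_univ]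
  exact hrange

end space

/-! ### Tail estimate -/

lemma hasDerivAt_weight {V : ℝ → ℝ} (hV : Differentiable ℝ V) (P x : ℝ) :
    HasDerivAt (weight V P) (weight V P x * (-deriv V x + P * (2 * x / (1 + x ^ 2)))) x := by
  have h1 : HasDerivAt (fun x : ℝ => 1 + x ^ 2) (2 * x) x := by
    simpa using (hasDerivAt_pow 2 x).const_add 1
  exact ((hV x).hasDerivAt.neg.add ((h1.log (by positivity)).const_mul P)).exp

/-- The constant C is fixed before Λ, so that Λ may later be chosen in terms of C. -/
lemma exists_tail_bounds {V : ℝ → ℝ}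
    (hV' : Tendsto (fun x => |deriv V x|) (cocompact ℝ) atTop)
    (hV2 : (fun x => iteratedDeriv 2 V x / deriv V x) =O[cocompact ℝ] fun _ => (1 : ℝ)) :
    ∃ C : ℝ, 0 ≤ C ∧ ∀ Λ : ℝ, ∃ R : ℝ, 1 ≤ R ∧ ∀ x, R ≤ |x| →
      Λ ≤ |deriv V x| ∧ |deriv (deriv V) x| ≤ C * |deriv V x| := by
  obtain ⟨C, hC0, hC⟩ := hV2.exists_nonneg
  refine ⟨C, hC0, fun Λ => ?_⟩
  have h1 := (hC.bound.and (hV'.eventually_ge_atTop (max Λ 1)))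
  rw [← Metric.cobounded_eq_cocompact, ← comap_norm_atTop] at h1
  obtain ⟨t, ht, hts⟩ := h1
  obtain ⟨R, hR⟩ := mem_atTop_sets.1 ht
  refine ⟨max R 1, le_max_right _ _, fun x hx => ?_⟩
  obtain ⟨h2, h3⟩ := hts (show x ∈ norm ⁻¹' t from hR _ ((le_max_left R 1).trans hx))
  have h4 : 0 < |deriv V x| := lt_of_lt_of_le one_pos ((le_max_right _ _).trans h3)
  refine ⟨(le_max_left _ _).trans h3, ?_⟩
  rw [norm_div, norm_one, mul_one, Real.norm_eq_abs, Real.norm_eq_abs, div_le_iff₀ h4,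
    iteratedDeriv_succ, iteratedDeriv_one] at h2
  exact h2

/-- The derivative of f² s w integrates to zero, where w is the weight and s is arctan V' cut off
near the origin. Differentiating w produces s V', which in the tail is at least |V'|/2 and so
arbitrarily large; the remaining terms are bounded multiples of f² + f'². The arctangent keeps the
sign of V' while being bounded, and its derivative V''/(1+V'²) is bounded because V'' = O(V'). -/
lemma exists_tail_le {V : ℝ → ℝ} (P : ℝ) (hP : 0 < P) (hV : ContDiff ℝ 2 V)
    (hV' : Tendsto (fun x => |deriv V x|) (cocompact ℝ) atTop)
    (hV2 : (fun x => iteratedDeriv 2 V x / deriv V x) =O[cocompact ℝ] fun _ => (1 : ℝ))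
    {ε : ℝ} (hε : 0 < ε) :
    ∃ R : ℝ, 0 < R ∧ ∀ f : ℝ → ℝ, ContDiff ℝ 1 f → HasCompactSupport f →
      ∫ x in {x : ℝ | R ≤ |x|}, f x ^ 2 * weight V P x ≤
        ε * ∫ x, (f x ^ 2 + deriv f x ^ 2) * weight V P x := by
  obtain ⟨C, hC0, hC⟩ := exists_tail_bounds hV' hV2
  obtain ⟨C', hC0', hC'⟩ := exists_deriv_cutoff_bound
  set D := 2 + (2 * C' + C) with hD
  have hD0 : 0 < D := by positivity
  -- Chosen so that |V'|/2 - 2P ≥ D/ε where |V'| ≥ Λ; the 2P pays for the derivative of (1+x²)^P,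
  -- and the added 1 ensures |V'| ≥ 1.
  set Λ := 2 * (D / ε + 2 * P) + 1 with hΛ
  obtain ⟨R, hR1, hR⟩ := hC Λ
  have hR0 : 0 < R := by linarith
  -- The cutoff vanishes only beyond 2R, so the full strength of s is available from there on.
  refine ⟨2 * R, by positivity, fun f hf hfc => ?_⟩
  have hVd : Differentiable ℝ V := hV.differentiable (by norm_num)
  have hV1 : ContDiff ℝ 1 (deriv V) := by
    have : ContDiff ℝ (1 + 1) V := by simpa [one_add_one_eq_two] using hV
    exact (contDiff_succ_iff_deriv.1 this).2.2
  have hVc : Continuous (deriv V) := hV1.continuous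
  have hVc2 : Continuous (deriv (deriv V)) := hV1.continuous_deriv le_rfl
  have hwc : Continuous (weight V P) := continuous_weight hV.continuous P
  have hfc0 : Continuous f := hf.continuous
  have hfc1 : Continuous (deriv f) := hf.continuous_deriv le_rfl
  have hχ := cutoff_contDiff R
  have hχc : Continuous (cutoff R) := hχ.continuous
  have hχc1 : Continuous (deriv (cutoff R)) := hχ.continuous_deriv (by simp)
  set s : ℝ → ℝ := fun x => (1 - cutoff R x) * Real.arctan (deriv V x) with hs
  set s' : ℝ → ℝ := fun x => -deriv (cutoff R) x * Real.arctan (deriv V x) +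
    (1 - cutoff R x) * (1 / (1 + deriv V x ^ 2) * deriv (deriv V) x) with hs'
  have hsd : ∀ x, HasDerivAt s (s' x) x := fun x => by
    have h1 : HasDerivAt (cutoff R) (deriv (cutoff R) x) x :=
      (hχ.differentiable (by simp) x).hasDerivAt
    have h2 : HasDerivAt (deriv V) (deriv (deriv V) x) x :=
      (hV1.differentiable one_ne_zero x).hasDerivAt
    exact (h1.const_sub 1).mul h2.arctan
  have hsc : Continuous s := (continuous_const.sub hχc).mul (Real.continuous_arctan.comp hVc)
  have hsc' : Continuous s' := by
    refine (hχc1.neg.mul (Real.continuous_arctan.comp hVc)).add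
      ((continuous_const.sub hχc).mul (Continuous.mul ?_ hVc2))
    exact continuous_const.div (by fun_prop) fun x => by positivity
  have hat : ∀ y : ℝ, |Real.arctan y| ≤ 2 := fun y => by
    rw [abs_le]
    have h1 := Real.neg_pi_div_two_lt_arctan y
    have h2 := Real.arctan_lt_pi_div_two y
    have h3 := Real.pi_lt_four
    constructor <;> linarith
  have hcut : ∀ x, 0 ≤ 1 - cutoff R x ∧ 1 - cutoff R x ≤ 1 := fun x => by
    have := cutoff_mem_Icc R x
    constructor <;> linarith [this.1, this.2]
  have hcut0 : ∀ x, |x| < R → 1 - cutoff R x = 0 := fun x hx => by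
    rw [cutoff_eq_one hR0 hx.le, sub_self]
  have hsb : ∀ x, |s x| ≤ 2 := fun x => by
    rw [hs]
    simp only [abs_mul, abs_of_nonneg (hcut x).1]
    nlinarith [hat (deriv V x), hcut x, abs_nonneg (Real.arctan (deriv V x))]
  have hsb' : ∀ x, |s' x| ≤ 2 * C' + C := fun x => by
    have h1 : |-deriv (cutoff R) x * Real.arctan (deriv V x)| ≤ C' * 2 := by
      rw [abs_mul, abs_neg]
      refine mul_le_mul ((hC' R hR0 x).trans ?_) (hat _) (abs_nonneg _) hC0'
      exact div_le_self hC0' hR1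
    have h2 : |(1 - cutoff R x) * (1 / (1 + deriv V x ^ 2) * deriv (deriv V) x)| ≤ C := by
      rcases lt_or_ge |x| R with hx | hx
      · rw [hcut0 x hx, zero_mul, abs_zero]
        exact hC0
      · have h3 := (hR x hx).2
        rw [abs_mul, abs_mul, abs_of_nonneg (hcut x).1,
          abs_of_nonneg (by positivity : 0 ≤ 1 / (1 + deriv V x ^ 2)), one_div_mul_eq_div]
        refine (mul_le_of_le_one_left (by positivity) (hcut x).2).trans ?_
        rw [div_le_iff₀ (by positivity)]
        refine h3.trans (mul_le_mul_of_nonneg_left ?_ hC0)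
        rw [← sq_abs (deriv V x)]
        nlinarith [sq_nonneg (|deriv V x| - 1), abs_nonneg (deriv V x)]
    refine (abs_add_le _ _).trans ?_
    linarith
  set p : ℝ → ℝ := fun x => P * (2 * x / (1 + x ^ 2)) with hp
  have hpc : Continuous p :=
    continuous_const.mul (Continuous.div (by fun_prop) (by fun_prop) fun x => by positivity)
  have hpb : ∀ x, |p x| ≤ P := fun x => by
    rw [hp]
    simp only [abs_mul, abs_of_pos hP, abs_div]
    refine mul_le_of_le_one_right hP.le ?_
    rw [abs_of_pos (by positivity : (0 : ℝ) < 1 + x ^ 2), abs_two, div_le_one (by positivity),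
      ← sq_abs x]
    nlinarith [sq_nonneg (|x| - 1)]
  have hG : ∀ x, HasDerivAt (fun x => f x ^ 2 * s x * weight V P x)
      ((2 * f x * deriv f x * s x + f x ^ 2 * s' x) * weight V P x -
        f x ^ 2 * (s x * (deriv V x - p x)) * weight V P x) x := fun x => by
    have h1 : HasDerivAt f (deriv f x) x := (hf.differentiable one_ne_zero x).hasDerivAt
    refine (((h1.pow 2).mul (hsd x)).mul (hasDerivAt_weight hVd P x)).congr_deriv ?_
    simp only [hp, Pi.mul_apply, Pi.pow_apply]
    push_cast
    ring
  have hcs : ∀ g : ℝ → ℝ, Continuous g → HasCompactSupport g → Integrable g :=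
    fun g hg hgc => hg.integrable_of_hasCompactSupport hgc
  have hz : ∀ x, x ∉ tsupport f → f x = 0 ∧ deriv f x = 0 := fun x hx =>
    ⟨image_eq_zero_of_notMem_tsupport hx,
      image_eq_zero_of_notMem_tsupport fun h => hx (tsupport_deriv_subset h)⟩
  have hsup : ∀ g : ℝ → ℝ, (∀ x, f x = 0 → deriv f x = 0 → g x = 0) → HasCompactSupport g :=
    fun g hg => HasCompactSupport.intro hfc fun x hx => hg x (hz x hx).1 (hz x hx).2
  have i1 : Integrable fun x => (2 * f x * deriv f x * s x + f x ^ 2 * s' x) * weight V P x :=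
    hcs _ (by fun_prop) (hsup _ fun x h1 h2 => by simp [h1])
  have i2 : Integrable fun x => f x ^ 2 * (s x * (deriv V x - p x)) * weight V P x :=
    hcs _ (by fun_prop) (hsup _ fun x h1 h2 => by simp [h1])
  have i3 : Integrable fun x => f x ^ 2 * s x * weight V P x :=
    hcs _ (by fun_prop) (hsup _ fun x h1 h2 => by simp [h1])
  have i4 : Integrable fun x => (f x ^ 2 + deriv f x ^ 2) * weight V P x :=
    hcs _ (by fun_prop) (hsup _ fun x h1 h2 => by simp [h1, h2])
  have i5 : Integrable fun x => f x ^ 2 * weight V P x :=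
    hcs _ (by fun_prop) (hsup _ fun x h1 h2 => by simp [h1])
  have hint := integral_eq_zero_of_hasDerivAt_of_integrable hG (i1.sub i2) i3
  rw [integral_sub i1 i2, sub_eq_zero] at hint
  have hup : ∫ x, (2 * f x * deriv f x * s x + f x ^ 2 * s' x) * weight V P x ≤
      D * ∫ x, (f x ^ 2 + deriv f x ^ 2) * weight V P x := by
    rw [← integral_const_mul]
    refine integral_mono i1 (i4.const_mul D) fun x => ?_
    simp only
    rw [← mul_assoc D]
    refine mul_le_mul_of_nonneg_right ?_ (weight_pos V P x).le
    have h1 : 2 * f x * deriv f x * s x ≤ 2 * (f x ^ 2 + deriv f x ^ 2) := by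
      have h3 : 2 * f x * deriv f x * s x ≤ |2 * f x * deriv f x| * |s x| := by
        rw [← abs_mul]; exact le_abs_self _
      have h4 : |2 * f x * deriv f x| ≤ f x ^ 2 + deriv f x ^ 2 := by
        rw [abs_le]
        constructor <;> nlinarith [sq_nonneg (f x + deriv f x), sq_nonneg (f x - deriv f x)]
      have h5 := mul_le_mul h4 (hsb x) (abs_nonneg _) (by positivity)
      linarith
    have h2 : f x ^ 2 * s' x ≤ f x ^ 2 * (2 * C' + C) :=
      mul_le_mul_of_nonneg_left ((le_abs_self _).trans (hsb' x)) (sq_nonneg _)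
    have h3 : 0 ≤ deriv f x ^ 2 * (2 * C' + C) := by positivity
    rw [hD]
    linarith
  have hlow : D / ε * ∫ x in {x : ℝ | 2 * R ≤ |x|}, f x ^ 2 * weight V P x ≤
      ∫ x, f x ^ 2 * (s x * (deriv V x - p x)) * weight V P x := by
    have hms : MeasurableSet {x : ℝ | 2 * R ≤ |x|} :=
      measurableSet_le measurable_const continuous_abs.measurable
    rw [← integral_const_mul, ← integral_indicator hms]
    refine integral_mono ((i5.const_mul _).indicator hms) i2 fun x => ?_
    have hsx : (1 - cutoff R x) * (D / ε) ≤ s x * (deriv V x - p x) := by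
      rcases lt_or_ge |x| R with hx | hx
      · simp [hs, hcut0 x hx]
      · rw [hs]
        simp only
        rw [mul_assoc]
        refine mul_le_mul_of_nonneg_left ?_ (hcut x).1
        have h1 := (hR x hx).1
        have hDε : 0 < D / ε := by positivity
        have hΛ1 : 1 ≤ Λ := by rw [hΛ]; linarith
        -- Since |V'| ≥ 1, the arctangent is at least π/4 > 1/2 in absolute value.
        have h2 : |deriv V x| / 2 ≤ Real.arctan (deriv V x) * deriv V x := by
          have h3 : Real.arctan 1 = Real.pi / 4 := Real.arctan_one
          have hpi := Real.pi_gt_three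
          rcases le_abs'.1 (hΛ1.trans h1) with h4 | h4
          · have h5 := Real.arctan_le_arctan_iff.2 h4
            rw [Real.arctan_neg, h3] at h5
            rw [abs_of_neg (by linarith)]
            nlinarith
          · have h5 := Real.arctan_le_arctan_iff.2 h4
            rw [h3] at h5
            rw [abs_of_pos (by linarith)]
            nlinarith
        have h6 : Real.arctan (deriv V x) * p x ≤ 2 * P := by
          refine (le_abs_self _).trans ?_
          rw [abs_mul]
          exact mul_le_mul (hat _) (hpb x) (abs_nonneg _) zero_le_two
        rw [mul_sub]
        linarith
    have hw := (weight_pos V P x).le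
    have hDε : 0 < D / ε := by positivity
    by_cases hx : 2 * R ≤ |x|
    · rw [Set.indicator_of_mem (by exact hx)]
      rw [cutoff_eq_zero hR0 hx, sub_zero, one_mul] at hsx
      rw [← mul_assoc, mul_comm (D / ε)]
      exact mul_le_mul_of_nonneg_right (mul_le_mul_of_nonneg_left hsx (sq_nonneg _)) hw
    · rw [Set.indicator_of_notMem (by exact hx)]
      have : 0 ≤ s x * (deriv V x - p x) :=
        le_trans (mul_nonneg (hcut x).1 hDε.le) hsx
      positivity
  have hfin := hlow.trans (hint ▸ hup)
  rw [div_mul_eq_mul_div, div_le_iff₀ hε, mul_assoc] at hfin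
  have := le_of_mul_le_mul_left hfin hD0
  linarith

lemma norm_sq_eq_integral {m : Measure ℝ} (f : Lp ℝ 2 m) : ‖f‖ ^ 2 = ∫ x, f x ^ 2 ∂m := by
  rw [← real_inner_self_eq_norm_sq, L2.inner_def]
  simp [sq]

lemma coeFn_lp_sum {α ι : Type*} [MeasurableSpace α] {m : Measure α} (s : Finset ι)
    (f : ι → Lp ℝ 2 m) : ⇑(∑ i ∈ s, f i) =ᵐ[m] fun x => ∑ i ∈ s, f i x := by
  classical
  induction s using Finset.induction_on with
  | empty =>
    simp only [Finset.sum_empty]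
    exact Lp.coeFn_zero ℝ 2 m
  | insert a s ha ih =>
    rw [Finset.sum_insert ha]
    filter_upwards [Lp.coeFn_add (f a) (∑ i ∈ s, f i), ih] with x h1 h2
    rw [h1, Pi.add_apply, h2, Finset.sum_insert ha]

/-! ### Tails and local averages in L²(μ). -/

section compact

variable {V : ℝ → ℝ} {P : ℝ} {μ : Measure ℝ} [IsProbabilityMeasure μ]

/-- Multiplication by the indicator of `s` on `L²`. -/
def restrictL2 (μ : Measure ℝ) (s : Set ℝ) (hs : MeasurableSet s) : Lp ℝ 2 μ →L[ℝ] Lp ℝ 2 μ :=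
  lpMap (mulFun (s.indicator 1)) 1 (lpBounded_mulFun
    (measurable_one.indicator hs).aestronglyMeasurable (.of_forall fun x => by
      by_cases hx : x ∈ s <;> simp [hx]))

omit [IsProbabilityMeasure μ] in
lemma restrictL2_coeFn {s : Set ℝ} (hs : MeasurableSet s) (f : Lp ℝ 2 μ) :
    restrictL2 μ s hs f =ᵐ[μ] s.indicator f := by
  refine (lpMap_coeFn _ f).trans (.of_forall fun x => ?_)
  change s.indicator 1 x * f x = _
  by_cases hx : x ∈ s <;> simp [hx]

omit [IsProbabilityMeasure μ] in
lemma norm_restrictL2_sq {s : Set ℝ} (hs : MeasurableSet s) (f : Lp ℝ 2 μ) :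
    ‖restrictL2 μ s hs f‖ ^ 2 = ∫ x in s, f x ^ 2 ∂μ := by
  rw [norm_sq_eq_integral, ← integral_indicator hs]
  refine integral_congr_ae ?_
  filter_upwards [restrictL2_coeFn hs f] with x hx
  rw [hx]
  by_cases hxs : x ∈ s <;> simp [hxs]

lemma measurableSet_le_abs (R : ℝ) : MeasurableSet {x : ℝ | R ≤ |x|} :=
  measurableSet_le measurable_const continuous_abs.measurable

lemma GibbsDensity.exists_tail_le (h : GibbsDensity V P μ) (hP : 0 < P)
    (hV : PotentialAssumptions V μ) {ε : ℝ} (hε : 0 < ε) :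
    ∃ R : ℝ, 0 < R ∧ ∀ p : Lp ℝ 2 μ × Lp ℝ 2 μ, HasWeakDeriv p.1 p.2 →
      ‖restrictL2 μ {x : ℝ | R ≤ |x|} (measurableSet_le_abs R) p.1‖ ^ 2 ≤
        ε * (‖p.1‖ ^ 2 + ‖p.2‖ ^ 2) := by
  obtain ⟨C, hC, hcomp⟩ := h.comparable
  -- Exchanging weight and density costs a factor C on each side of the inequality, hence ε/C².
  obtain ⟨R, hR, hT⟩ := BetaEnsemble.exists_tail_le P hP (hV.contDiff.of_le (by norm_num))
    hV.tendsto_V' hV.second_bound (ε := ε / C ^ 2) (by positivity)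
  refine ⟨R, hR, fun p hp => ?_⟩
  refine h.closed_induction (C := {p | ‖restrictL2 μ {x : ℝ | R ≤ |x|} (measurableSet_le_abs R)
    p.1‖ ^ 2 ≤ ε * (‖p.1‖ ^ 2 + ‖p.2‖ ^ 2)}) (isClosed_le (by fun_prop) (by fun_prop)) ?_ hp
  intro f hf hfc q h1 h2
  have hwc : Continuous (weight V P) := continuous_weight hV.contDiff.continuous P
  have hd : Continuous (deriv f) := hf.continuous_deriv (by simp)
  replace h1 : f =ᵐ[volume] q.1 := h.ae_iff.1 h1
  replace h2 : deriv f =ᵐ[volume] q.2 := h.ae_iff.1 h2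
  have i1 : Integrable fun x => f x ^ 2 * weight V P x :=
    Continuous.integrable_of_hasCompactSupport (by have := hf.continuous; fun_prop)
      (HasCompactSupport.intro hfc fun x hx => by simp [image_eq_zero_of_notMem_tsupport hx])
  have i2 : Integrable fun x => (f x ^ 2 + deriv f x ^ 2) * weight V P x :=
    Continuous.integrable_of_hasCompactSupport (by have := hf.continuous; fun_prop)
      (HasCompactSupport.intro hfc fun x hx => by
        simp [image_eq_zero_of_notMem_tsupport hx,
          image_eq_zero_of_notMem_tsupport fun h => hx (tsupport_deriv_subset h)])
  have hsq : ∀ g : Lp ℝ 2 μ, Integrable fun x => density μ x * g x ^ 2 := fun g =>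
    (integrable_iff_density h.ac).1 (Lp.memLp g).integrable_sq
  have e1 : ‖restrictL2 μ {x : ℝ | R ≤ |x|} (measurableSet_le_abs R) q.1‖ ^ 2 ≤
      C * ∫ x in {x : ℝ | R ≤ |x|}, f x ^ 2 * weight V P x := by
    rw [norm_restrictL2_sq, ← integral_indicator (measurableSet_le_abs R),
      integral_eq_density h.ac, ← integral_indicator (measurableSet_le_abs R),
      ← integral_const_mul]
    refine integral_mono_ae ?_ ((i1.indicator (measurableSet_le_abs R)).const_mul C) ?_
    · refine ((hsq q.1).indicator (measurableSet_le_abs R)).congr (.of_forall fun x => ?_)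
      by_cases hx : x ∈ {x : ℝ | R ≤ |x|} <;> simp only [hx, Set.indicator_of_mem,
        Set.indicator_of_notMem, not_false_eq_true, mul_zero]
    · filter_upwards [h1, hcomp] with x hx1 hx2
      by_cases hx : x ∈ {x : ℝ | R ≤ |x|}
      · simp only [hx, Set.indicator_of_mem]
        rw [← hx1]
        nlinarith [sq_nonneg (f x), hx2.2]
      · simp only [hx, Set.indicator_of_notMem, not_false_eq_true, mul_zero, le_refl]
  have e2 : ∫ x, (f x ^ 2 + deriv f x ^ 2) * weight V P x ≤ C * (‖q.1‖ ^ 2 + ‖q.2‖ ^ 2) := by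
    rw [norm_sq_eq_integral, norm_sq_eq_integral, integral_eq_density h.ac,
      integral_eq_density h.ac, ← integral_add (hsq _) (hsq _), ← integral_const_mul]
    refine integral_mono_ae i2 (((hsq _).add (hsq _)).const_mul C) ?_
    filter_upwards [h1, h2, hcomp] with x hx1 hx2 hx3
    rw [← hx1, ← hx2]
    have h4 : weight V P x ≤ C * density μ x := by
      have := mul_le_mul_of_nonneg_left hx3.1 hC.le
      rwa [← mul_assoc, mul_inv_cancel₀ hC.ne', one_mul] at this
    have h5 : 0 ≤ f x ^ 2 + deriv f x ^ 2 := by positivity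
    nlinarith
  have e3 := hT f (hf.of_le (by simp)) hfc
  have e4 : ε / C ^ 2 * ∫ x, (f x ^ 2 + deriv f x ^ 2) * weight V P x ≤
      ε / C ^ 2 * (C * (‖q.1‖ ^ 2 + ‖q.2‖ ^ 2)) :=
    mul_le_mul_of_nonneg_left e2 (by positivity)
  have e5 := e1.trans (mul_le_mul_of_nonneg_left (e3.trans e4) hC.le)
  rw [Set.mem_ofPred_eq]
  refine e5.trans (le_of_eq ?_)
  field_simp

/-! ### Local averages -/

lemma GibbsDensity.memLp_indicator_div (h : GibbsDensity V P μ) {R c : ℝ} (hc0 : 0 < c)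
    (hc : ∀ᵐ x, x ∈ Set.Icc (-R) R → c ≤ density μ x) {s : Set ℝ} (hs : MeasurableSet s)
    (hsR : s ⊆ Set.Icc (-R) R) : MemLp (s.indicator fun x => (density μ x)⁻¹) 2 μ := by
  refine MemLp.of_bound (C := c⁻¹)
    ((measurable_density μ).inv.indicator hs).aestronglyMeasurable ?_
  rw [h.ae_iff]
  filter_upwards [hc] with x hx
  by_cases hxs : x ∈ s
  · rw [Set.indicator_of_mem hxs, norm_inv, Real.norm_eq_abs,
      abs_of_nonneg (density_nonneg μ x)]
    exact inv_anti₀ hc0 (hx (hsR hxs))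
  · rw [Set.indicator_of_notMem hxs, norm_zero]
    positivity

/-- Makes the Lebesgue integral over s a continuous functional on L²(μ), as the finite-rank
approximation of the embedding requires. -/
lemma GibbsDensity.inner_indicator_div (h : GibbsDensity V P μ) {s : Set ℝ}
    (hs : MeasurableSet s) (hq : MemLp (s.indicator fun x => (density μ x)⁻¹) 2 μ)
    (f : Lp ℝ 2 μ) : inner ℝ (hq.toLp _) f = ∫ x in s, f x := by
  rw [L2.inner_def, integral_eq_density h.ac, ← integral_indicator hs]
  refine integral_congr_ae ?_
  filter_upwards [h.ae_iff.1 hq.coeFn_toLp, h.pos] with x hx hx0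
  rw [hx]
  by_cases hxs : x ∈ s
  · simp only [hxs, Set.indicator_of_mem, RCLike.inner_apply, conj_trivial]
    field_simp
  · simp [hxs]

lemma GibbsDensity.abs_setIntegral_le (h : GibbsDensity V P μ) {R c δ : ℝ} (hc0 : 0 < c)
    (hc : ∀ᵐ x, x ∈ Set.Icc (-R) R → c ≤ density μ x) {s : Set ℝ} (hs : MeasurableSet s)
    (hsR : s ⊆ Set.Icc (-R) R) (hδ : volume.real s ≤ δ) (f : Lp ℝ 2 μ) :
    |∫ x in s, f x| ≤ √(δ / c) * ‖f‖ := by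
  have hq := h.memLp_indicator_div hc0 hc hs hsR
  have hδ0 : 0 ≤ δ := measureReal_nonneg.trans hδ
  rw [← h.inner_indicator_div hs hq f]
  refine (abs_real_inner_le_norm _ _).trans (mul_le_mul_of_nonneg_right ?_ (norm_nonneg _))
  refine Real.le_sqrt_of_sq_le ?_
  have hfin : volume s ≠ ⊤ := ((measure_mono hsR).trans_lt measure_Icc_lt_top).ne
  rw [norm_sq_eq_integral, integral_eq_density h.ac]
  have e1 : ∫ x, density μ x * (hq.toLp _ : Lp ℝ 2 μ) x ^ 2 ≤ ∫ x, s.indicator (fun _ => c⁻¹) x := by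
    refine integral_mono_ae ((integrable_iff_density h.ac).1 (Lp.memLp _).integrable_sq)
      ((integrable_indicator_iff hs).2 (integrableOn_const hfin)) ?_
    filter_upwards [h.ae_iff.1 hq.coeFn_toLp, h.pos, hc] with x hx hx0 hxc
    rw [hx]
    by_cases hxs : x ∈ s
    · simp only [hxs, Set.indicator_of_mem]
      rw [inv_pow, sq, mul_inv, ← mul_assoc, mul_inv_cancel₀ hx0.ne', one_mul]
      exact inv_anti₀ hc0 (hxc (hsR hxs))
    · simp [hxs]
  refine e1.trans ?_
  rw [integral_indicator hs, setIntegral_const, smul_eq_mul, div_eq_mul_inv]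
  exact mul_le_mul_of_nonneg_right hδ (by positivity)

/-- The average over an interval approximates a function with weak derivative in `L²(μ)`. -/
lemma GibbsDensity.abs_sub_average_le (h : GibbsDensity V P μ) {R c : ℝ} (hc0 : 0 < c)
    (hc : ∀ᵐ x, x ∈ Set.Icc (-R) R → c ≤ density μ x) {p : Lp ℝ 2 μ × Lp ℝ 2 μ}
    (hp : HasWeakDeriv p.1 p.2) : ∀ᵐ x, ∀ a b : ℝ, a < b → Set.Ioc a b ⊆ Set.Icc (-R) R →
      x ∈ Set.Ioc a b →
      |p.1 x - (b - a)⁻¹ * ∫ y in Set.Ioc a b, p.1 y| ≤ √((b - a) / c) * ‖p.2‖ := by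
  obtain ⟨F, hF, hfF, -, hFi⟩ := hp.exists_locAC
  -- The exceptional null set comes only from the continuous representative, so it is the same for
  -- all intervals.
  filter_upwards [hfF] with x hx a b hab hsub hxI
  have hFc := hF.continuous
  have e1 : ∫ y in Set.Ioc a b, p.1 y = ∫ y in Set.Ioc a b, F y :=
    integral_congr_ae (ae_restrict_of_ae hfF)
  have hvol : volume.real (Set.Ioc a b) = b - a := by
    rw [Real.volume_real_Ioc_of_le hab.le]
  have hba : 0 < b - a := sub_pos.2 hab
  have e2 : F x - (b - a)⁻¹ * ∫ y in Set.Ioc a b, F y =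
      (b - a)⁻¹ * ∫ y in Set.Ioc a b, (F x - F y) := by
    rw [integral_sub (integrableOn_const (μ := volume) (s := Set.Ioc a b) (by simp)).integrable
      ((hFc.integrableOn_Icc (a := a) (b := b)).mono_set Set.Ioc_subset_Icc_self).integrable,
      setIntegral_const, hvol, smul_eq_mul]
    field_simp
  rw [hx, e1, e2, abs_mul, abs_of_pos (inv_pos.2 hba), inv_mul_le_iff₀ hba, mul_comm (b - a),
    ← hvol, ← Real.norm_eq_abs]
  refine norm_setIntegral_le_of_norm_le_const measure_Ioc_lt_top fun y hy => ?_
  rw [hFi y x, Real.norm_eq_abs, intervalIntegral.abs_intervalIntegral_eq, hvol]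
  have hsub' : Set.uIoc y x ⊆ Set.Ioc a b := by
    rw [Set.uIoc]
    exact Set.Ioc_subset_Ioc (le_min hy.1.le hxI.1.le) (max_le hy.2 hxI.2)
  refine h.abs_setIntegral_le hc0 hc measurableSet_uIoc (hsub'.trans hsub) ?_ p.2
  rw [← hvol]
  exact measureReal_mono hsub' (by simp)

end compact

/-! ### Compactness of the embedding -/

section compact

variable {V : ℝ → ℝ} {P : ℝ} {μ : Measure ℝ} [IsProbabilityMeasure μ]

/-- The embedding `u ↦ u` of `H` into `L²(μ)`, which is bounded by the Poincaré inequality. -/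
def embed {C : ℝ} (hC : ∀ u : HSpace μ, ‖u.fn‖ ≤ C * ‖u‖) : HSpace μ →L[ℝ] Lp ℝ 2 μ :=
  LinearMap.mkContinuous
    { toFun := fun u => u.fn
      map_add' := fun _ _ => rfl
      map_smul' := fun _ _ => rfl } C hC

lemma embed_apply {C : ℝ} (hC : ∀ u : HSpace μ, ‖u.fn‖ ≤ C * ‖u‖) (u : HSpace μ) :
    embed hC u = u.fn := rfl

lemma GibbsDensity.exists_norm_fn_le (h : GibbsDensity V P μ) (hp : Poincare μ) :
    ∃ C : ℝ, 0 ≤ C ∧ ∀ u : HSpace μ, ‖u.fn‖ ≤ C * ‖u‖ := by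
  obtain ⟨C, hC0, hC⟩ := h.exists_norm_le hp
  refine ⟨√C, Real.sqrt_nonneg _, fun u => ?_⟩
  refine (abs_le_of_sq_le_sq' ?_ (by positivity)).2
  rw [mul_pow, Real.sq_sqrt hC0.le]
  exact hC u.1 u.2

/-- Step functions approximate the functions of `H`, uniformly on bounded sets of `H`. -/
lemma GibbsDensity.exists_finiteRank (h : GibbsDensity V P μ) (hP : 0 < P)
    (hV : PotentialAssumptions V μ) {C : ℝ} (hC : ∀ u : HSpace μ, ‖u.fn‖ ≤ C * ‖u‖)
    {ε : ℝ} (hε : 0 < ε) :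
    ∃ (N : ℕ) (q e : ℕ → Lp ℝ 2 μ), ∀ u : HSpace μ,
      ‖u.fn - ∑ i ∈ Finset.range N, inner ℝ (q i) u.fn • e i‖ ≤ ε * ‖u‖ := by
  -- The tail and the mesh each take half of ε²: as ‖u‖² ≤ C²‖u'‖² in L²(μ), this constant gives a
  -- tail of at most (ε²/2)‖u'‖², and N below makes the cell length δ satisfy δ/c ≤ ε²/2.
  obtain ⟨R, hR, hT⟩ := h.exists_tail_le hP hV (ε := ε ^ 2 / (2 * (C ^ 2 + 1))) (by positivity)
  obtain ⟨c, hc0, hc⟩ := h.exists_le_density hV.contDiff.continuous R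
  obtain ⟨N, hN⟩ := exists_nat_gt (2 * R / (ε ^ 2 / 2 * c))
  have hN0 : (0 : ℝ) < N := lt_of_le_of_lt (by positivity) hN
  set δ : ℝ := 2 * R / N with hδ
  have hδ0 : 0 < δ := by positivity
  have hδc : δ / c ≤ ε ^ 2 / 2 := by
    rw [div_lt_iff₀ (by positivity)] at hN
    rw [div_le_iff₀ hc0, hδ, div_le_iff₀ hN0]
    linarith
  have hNδ : N * δ = 2 * R := by rw [hδ]; field_simp
  set a : ℕ → ℝ := fun i => -R + i * δ with ha
  set I : ℕ → Set ℝ := fun i => Set.Ioc (a i) (a (i + 1)) with hI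
  have ha1 : ∀ i, a (i + 1) - a i = δ := fun i => by simp only [ha]; push_cast; ring
  have hlt : ∀ i, a i < a (i + 1) := fun i => by linarith [ha1 i]
  have hIm : ∀ i, MeasurableSet (I i) := fun i => measurableSet_Ioc
  have hIR : ∀ i ∈ Finset.range N, I i ⊆ Set.Icc (-R) R := fun i hi x hx => by
    have h1 : (i : ℝ) + 1 ≤ N := by exact_mod_cast Finset.mem_range.1 hi
    have h2 := mul_le_mul_of_nonneg_right h1 hδ0.le
    have h3 : (0 : ℝ) ≤ i * δ := by positivity
    have h4 := hx.1
    have h5 := hx.2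
    simp only [ha] at h4 h5
    push_cast at h5
    constructor <;> linarith
  -- For i < N the intersection changes nothing; it only keeps the functionals defined for every
  -- index.
  have hsm : ∀ i, MeasurableSet (I i ∩ Set.Icc (-R) R) := fun i => (hIm i).inter measurableSet_Icc
  have hq : ∀ i, MemLp ((I i ∩ Set.Icc (-R) R).indicator fun x => (density μ x)⁻¹) 2 μ := fun i =>
    h.memLp_indicator_div hc0 hc (hsm i) Set.inter_subset_right
  refine ⟨N, fun i => (hq i).toLp _, fun i => δ⁻¹ • indicatorConstLp 2 (hIm i)
    (measure_ne_top μ (I i)) (1 : ℝ), fun u => ?_⟩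
  have hwd := h.hasWeakDeriv_fn u
  set S := ∑ i ∈ Finset.range N, (inner ℝ ((hq i).toLp _) u.fn : ℝ) • δ⁻¹ •
    indicatorConstLp 2 (hIm i) (measure_ne_top μ (I i)) (1 : ℝ) with hS
  have hSx : ∀ᵐ x ∂μ, S x = ∑ i ∈ Finset.range N,
      (δ⁻¹ * ∫ y in I i, u.fn y) * (I i).indicator (fun _ => (1 : ℝ)) x := by
    have h1 : ∀ᵐ x ∂μ, ∀ i ∈ Finset.range N, ((inner ℝ ((hq i).toLp _) u.fn : ℝ) • δ⁻¹ •
        indicatorConstLp 2 (hIm i) (measure_ne_top μ (I i)) (1 : ℝ) : Lp ℝ 2 μ) x =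
        (δ⁻¹ * ∫ y in I i, u.fn y) * (I i).indicator (fun _ => (1 : ℝ)) x := by
      rw [Finset.eventually_all]
      intro i hi
      filter_upwards [Lp.coeFn_smul (inner ℝ ((hq i).toLp _) u.fn : ℝ) (δ⁻¹ •
        indicatorConstLp 2 (hIm i) (measure_ne_top μ (I i)) (1 : ℝ)),
        Lp.coeFn_smul δ⁻¹ (indicatorConstLp 2 (hIm i) (measure_ne_top μ (I i)) (1 : ℝ)),
        indicatorConstLp_coeFn (p := 2) (hs := hIm i) (hμs := measure_ne_top μ (I i))
          (c := (1 : ℝ))] with x h1 h2 h3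
      rw [h1, Pi.smul_apply, h2, Pi.smul_apply, h3, h.inner_indicator_div (hsm i),
        Set.inter_eq_left.2 (hIR i hi)]
      simp only [smul_eq_mul]
      ring
    filter_upwards [coeFn_lp_sum (m := μ) (Finset.range N) fun i =>
      ((inner ℝ ((hq i).toLp _) u.fn : ℝ) • δ⁻¹ •
        indicatorConstLp 2 (hIm i) (measure_ne_top μ (I i)) (1 : ℝ) : Lp ℝ 2 μ), h1] with x h2 h3
    rw [hS, h2]
    exact Finset.sum_congr rfl h3
  have hdisj : ∀ i j x, x ∈ I i → x ∈ I j → i ≤ j := fun i j x hi hj => by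
    have h1 := hi.1.trans_le hj.2
    simp only [ha] at h1
    have h2 : (i : ℝ) < ((j + 1 : ℕ) : ℝ) := by
      by_contra hcon
      have := mul_le_mul_of_nonneg_right (not_lt.1 hcon) hδ0.le
      linarith
    have h3 : i < j + 1 := by exact_mod_cast h2
    omega
  have hcover : ∀ x, -R < x → x ≤ R → ∃ i ∈ Finset.range N, x ∈ I i := fun x hx1 hx2 => by
    have hpos : 0 < (x + R) / δ := div_pos (by linarith) hδ0
    have hk0 : 0 < ⌈(x + R) / δ⌉₊ := Nat.ceil_pos.2 hpos
    obtain ⟨i, hi⟩ : ∃ i, ⌈(x + R) / δ⌉₊ = i + 1 := ⟨_, (Nat.succ_pred_eq_of_pos hk0).symm⟩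
    have h1 : (x + R) / δ ≤ ((i + 1 : ℕ) : ℝ) := hi ▸ Nat.le_ceil _
    have h2 : (i : ℝ) < (x + R) / δ := Nat.lt_ceil.1 (by omega)
    rw [div_le_iff₀ hδ0] at h1
    rw [lt_div_iff₀ hδ0] at h2
    refine ⟨i, Finset.mem_range.2 ?_, ?_, ?_⟩
    · have h3 : (i : ℝ) * δ < N * δ := by linarith
      exact_mod_cast lt_of_mul_lt_mul_right h3 hδ0.le
    · simp only [ha]; linarith
    · simp only [ha]; linarith
  set E := restrictL2 μ {x : ℝ | R ≤ |x|} (measurableSet_le_abs R) u.fn with hE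
  have hpt : ∀ᵐ x ∂μ, (u.fn - S) x ^ 2 ≤ E x ^ 2 + δ / c * ‖u‖ ^ 2 := by
    -- The point R belongs both to the last half-open cell and to the tail set, and is discarded as
    -- a null set.
    have hne : ∀ᵐ x ∂μ, x ≠ R := h.ac.ae_le (compl_mem_ae_iff.2 (measure_singleton R))
    filter_upwards [Lp.coeFn_sub u.fn S, hSx, hne,
      restrictL2_coeFn (measurableSet_le_abs R) u.fn,
      h.ac.ae_le (h.abs_sub_average_le hc0 hc (p := (u.fn, u.d)) hwd)] with x h1 h2 h3 h4 h5
    rw [h1, Pi.sub_apply, h2, h4]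
    by_cases hx : R ≤ |x|
    · have hz : ∀ i ∈ Finset.range N, x ∉ I i := fun i hi hxi => by
        have h6 := hIR i hi hxi
        have h7 : -R ≤ a i := by simp only [ha]; linarith [show (0 : ℝ) ≤ i * δ by positivity]
        rcases le_abs'.1 hx with h8 | h8
        · linarith [hxi.1]
        · exact h3 (le_antisymm h6.2 h8)
      rw [Finset.sum_eq_zero fun i hi => by rw [Set.indicator_of_notMem (hz i hi), mul_zero],
        Set.indicator_of_mem (by exact hx), sub_zero]
      have : 0 ≤ δ / c * ‖u‖ ^ 2 := by positivity
      linarith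
    · rw [not_le, abs_lt] at hx
      obtain ⟨k, hk, hxk⟩ := hcover x hx.1 hx.2.le
      have hsum : ∑ i ∈ Finset.range N,
          (δ⁻¹ * ∫ y in I i, u.fn y) * (I i).indicator (fun _ => (1 : ℝ)) x =
          δ⁻¹ * ∫ y in I k, u.fn y := by
        rw [Finset.sum_eq_single k, Set.indicator_of_mem hxk, mul_one]
        · intro i hi hik
          rw [Set.indicator_of_notMem, mul_zero]
          exact fun hxi => hik (le_antisymm (hdisj _ _ _ hxi hxk) (hdisj _ _ _ hxk hxi))
        · exact fun hk' => (hk' hk).elim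
      have h6 := h5 (a k) (a (k + 1)) (hlt k) (hIR k hk) hxk
      rw [ha1] at h6
      rw [hsum]
      have h7 : |u.fn x - δ⁻¹ * ∫ y in I k, u.fn y| ^ 2 ≤ (√(δ / c) * ‖u.d‖) ^ 2 :=
        pow_le_pow_left₀ (abs_nonneg _) h6 2
      rw [sq_abs, mul_pow, Real.sq_sqrt (by positivity)] at h7
      have h8 : ‖u‖ = ‖u.d‖ := rfl
      rw [h8]
      nlinarith [sq_nonneg (({x : ℝ | R ≤ |x|} : Set ℝ).indicator u.fn x)]
  have hsq : ‖u.fn - S‖ ^ 2 ≤ ‖E‖ ^ 2 + δ / c * ‖u‖ ^ 2 := by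
    have : ∫ x, (E x ^ 2 + δ / c * ‖u‖ ^ 2) ∂μ = ‖E‖ ^ 2 + δ / c * ‖u‖ ^ 2 := by
      rw [integral_add (Lp.memLp E).integrable_sq (integrable_const _), norm_sq_eq_integral]
      simp
    rw [← this, norm_sq_eq_integral]
    exact integral_mono_ae (Lp.memLp _).integrable_sq
      ((Lp.memLp E).integrable_sq.add (integrable_const _)) hpt
  have htail := hT (u.fn, u.d) hwd
  have hfn : ‖u.fn‖ ^ 2 ≤ C ^ 2 * ‖u‖ ^ 2 := by
    rw [← mul_pow]
    exact pow_le_pow_left₀ (norm_nonneg _) (hC u) 2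
  have h1 : ε ^ 2 / (2 * (C ^ 2 + 1)) * (‖u.fn‖ ^ 2 + ‖u.d‖ ^ 2) ≤ ε ^ 2 / 2 * ‖u‖ ^ 2 := by
    have h8 : ‖u.d‖ = ‖u‖ := rfl
    rw [h8]
    calc ε ^ 2 / (2 * (C ^ 2 + 1)) * (‖u.fn‖ ^ 2 + ‖u‖ ^ 2)
        ≤ ε ^ 2 / (2 * (C ^ 2 + 1)) * ((C ^ 2 + 1) * ‖u‖ ^ 2) := by
          refine mul_le_mul_of_nonneg_left ?_ (by positivity)
          linarith
      _ = ε ^ 2 / 2 * ‖u‖ ^ 2 := by field_simp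
  have h2 := mul_le_mul_of_nonneg_right hδc (sq_nonneg ‖u‖)
  refine (abs_le_of_sq_le_sq' ?_ (by positivity)).2
  rw [mul_pow]
  simp only at htail
  linarith

/-- Replacing u by its averages on the cells has finite rank and converges to the embedding in
operator norm, and compact operators are closed in that norm. -/
theorem GibbsDensity.isCompactOperator_embed (h : GibbsDensity V P μ) (hP : 0 < P)
    (hV : PotentialAssumptions V μ) {C : ℝ} (hC : ∀ u : HSpace μ, ‖u.fn‖ ≤ C * ‖u‖) :
    IsCompactOperator (embed hC) := by
  have hcl : IsClosed {f : HSpace μ →L[ℝ] Lp ℝ 2 μ | IsCompactOperator f} :=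
    isClosed_setOfPred_isCompactOperator
  have hmem : embed hC ∈ closure {f : HSpace μ →L[ℝ] Lp ℝ 2 μ | IsCompactOperator f} := by
    refine (Metric.mem_closure_iff (α := HSpace μ →L[ℝ] Lp ℝ 2 μ)).2 fun ε hε => ?_
    obtain ⟨N, q, e, hS⟩ := h.exists_finiteRank hP hV hC (half_pos hε)
    let S : HSpace μ →L[ℝ] Lp ℝ 2 μ := ∑ i ∈ Finset.range N,
      (ContinuousLinearMap.toSpanSingleton ℝ (e i)) ∘L (innerSL ℝ (q i)) ∘L embed hC
    refine ⟨S, ?_, ?_⟩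
    · refine (compactOperator (RingHom.id ℝ) (HSpace μ) (Lp ℝ 2 μ)).sum_mem fun i _ => ?_
      exact (isCompactOperator_of_locallyCompactSpace_rng
        (ContinuousLinearMap.toSpanSingleton ℝ (e i))).comp_clm ((innerSL ℝ (q i)) ∘L embed hC)
    · rw [(dist_eq_norm (embed hC) S : dist (embed hC) S = _)]
      refine lt_of_le_of_lt ?_ (half_lt_self hε)
      refine ContinuousLinearMap.opNorm_le_bound _ (half_pos hε).le fun u => ?_
      have : (embed hC - S) u = u.fn - ∑ i ∈ Finset.range N, inner ℝ (q i) u.fn • e i := by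
        simp [S, embed_apply]
      rw [this]
      exact hS u
  exact hcl.closure_subset hmem

end compact

/-! ### Hilbert space preliminaries -/

section abstract

variable {H L : Type*} [SeminormedAddCommGroup H] [InnerProductSpace ℝ H] [CompleteSpace H]
  [NormedAddCommGroup L] [InnerProductSpace ℝ L] [CompleteSpace L]

/-- H is declared with a seminorm only; separation upgrades it to a Hilbert space inside the proof.
-/
lemma exists_adjoint (hsep : ∀ u : H, ‖u‖ = 0 → u = 0) (T : H →L[ℝ] L) :
    ∃ S : L →L[ℝ] H, ∀ g u, inner ℝ (S g) u = inner ℝ g (T u) := by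
  let _ : NormedAddCommGroup H := NormedAddCommGroup.ofSeparation hsep
  exact ⟨ContinuousLinearMap.adjoint T, fun g u => ContinuousLinearMap.adjoint_inner_left T u g⟩

lemma exists_riesz (hsep : ∀ u : H, ‖u‖ = 0 → u = 0) (ℓ : H →L[ℝ] ℝ) :
    ∃ f : H, ∀ u, ℓ u = inner ℝ u f := by
  obtain ⟨S, hS⟩ := exists_adjoint hsep ℓ
  refine ⟨S 1, fun u => ?_⟩
  rw [real_inner_comm, hS]
  simp

omit [CompleteSpace H] [CompleteSpace L] in
lemma norm_le_of_adjoint {T : H →L[ℝ] L} {S : L →L[ℝ] H}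
    (hS : ∀ g u, inner ℝ (S g) u = inner ℝ g (T u)) (g : L) : ‖S g‖ ≤ ‖T‖ * ‖g‖ := by
  have h1 : ‖S g‖ ^ 2 ≤ ‖g‖ * (‖T‖ * ‖S g‖) := by
    rw [← real_inner_self_eq_norm_sq, hS]
    exact (real_inner_le_norm _ _).trans
      (mul_le_mul_of_nonneg_left (T.le_opNorm _) (norm_nonneg _))
  rcases (norm_nonneg (S g)).eq_or_lt' with h2 | h2
  · rw [h2]; positivity
  · refine le_of_mul_le_mul_right ?_ h2
    nlinarith

omit [CompleteSpace H] [CompleteSpace L] in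
/-- A compact operator `T` attains its norm; the maximiser is an eigenvector of `T* T`. -/
lemma exists_eigenvector_of_isCompactOperator (hsep : ∀ u : H, ‖u‖ = 0 → u = 0) {T : H →L[ℝ] L}
    (hT : IsCompactOperator T) {S : L →L[ℝ] H} (hS : ∀ g u, inner ℝ (S g) u = inner ℝ g (T u))
    (hT0 : 0 < ‖T‖) : ∃ φ : H, φ ≠ 0 ∧ S (T φ) = ‖T‖ ^ 2 • φ := by
  let _ : NormedAddCommGroup H := NormedAddCommGroup.ofSeparation hsep
  have hex : ∀ n : ℕ, ∃ x : H, ‖x‖ ≤ 1 ∧ ‖T‖ - 1 / ((n : ℝ) + 1) < ‖T x‖ := fun n => by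
    have hlt : ‖T‖ - 1 / ((n : ℝ) + 1) < ‖T‖ := by
      have : 0 < 1 / ((n : ℝ) + 1) := by positivity
      linarith
    obtain ⟨x, hx1, hx2⟩ := T.exists_lt_apply_of_lt_opNorm hlt
    exact ⟨x, hx1.le, hx2⟩
  choose x hx1 hx2 using hex
  obtain ⟨K, hK, hKT⟩ := hT.image_closedBall_subset_compact (f := (T : H →ₗ[ℝ] L)) 1
  have hmem : ∀ n, T (x n) ∈ K := fun n =>
    hKT ⟨x n, by simpa using hx1 n, rfl⟩
  obtain ⟨y, -, ns, hns, hy⟩ := hK.tendsto_subseq hmem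
  have hnorm : Tendsto (fun n => ‖T (x n)‖) atTop (𝓝 ‖T‖) := by
    have h1 : Tendsto (fun n : ℕ => ‖T‖ - 1 / ((n : ℝ) + 1)) atTop (𝓝 ‖T‖) := by
      simpa using (tendsto_one_div_add_atTop_nhds_zero_nat (𝕜 := ℝ)).const_sub ‖T‖
    refine tendsto_of_tendsto_of_tendsto_of_le_of_le h1 tendsto_const_nhds
      (fun n => (hx2 n).le) fun n => ?_
    exact (T.le_opNorm _).trans (mul_le_of_le_one_right (norm_nonneg _) (hx1 n))
  -- Expanding the square gives ‖S T x - ‖T‖²x‖² ≤ 2‖T‖²(‖T‖² - ‖T x‖²) for ‖x‖ ≤ 1, so a maximising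
  -- sequence is asymptotically an eigenvector.
  have hdiff : Tendsto (fun n => S (T (x n)) - ‖T‖ ^ 2 • x n) atTop (𝓝 0) := by
    have h1 : Tendsto (fun n => 2 * ‖T‖ ^ 2 * (‖T‖ ^ 2 - ‖T (x n)‖ ^ 2)) atTop (𝓝 0) := by
      have := ((hnorm.pow 2).const_sub (‖T‖ ^ 2)).const_mul (2 * ‖T‖ ^ 2)
      simpa using this
    have h2 : Tendsto (fun n => ‖S (T (x n)) - ‖T‖ ^ 2 • x n‖ ^ 2) atTop (𝓝 0) := by
      refine squeeze_zero (fun n => by positivity) (fun n => ?_) h1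
      have e1 : inner ℝ (S (T (x n))) (‖T‖ ^ 2 • x n) = ‖T‖ ^ 2 * ‖T (x n)‖ ^ 2 := by
        rw [real_inner_smul_right, hS, real_inner_self_eq_norm_sq]
      have e2 : ‖S (T (x n))‖ ≤ ‖T‖ * ‖T‖ := (norm_le_of_adjoint hS _).trans
        (mul_le_mul_of_nonneg_left ((T.le_opNorm _).trans
          (mul_le_of_le_one_right (norm_nonneg _) (hx1 n))) (norm_nonneg _))
      have e3 : ‖‖T‖ ^ 2 • x n‖ ≤ ‖T‖ ^ 2 := by
        rw [norm_smul, Real.norm_eq_abs, abs_of_nonneg (by positivity)]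
        exact mul_le_of_le_one_right (by positivity) (hx1 n)
      rw [norm_sub_sq_real, e1]
      have e4 := pow_le_pow_left₀ (norm_nonneg _) e2 2
      have e5 := pow_le_pow_left₀ (norm_nonneg _) e3 2
      nlinarith
    have h3 := h2.sqrt
    simp only [Real.sqrt_zero, Real.sqrt_sq (norm_nonneg _)] at h3
    exact tendsto_zero_iff_norm_tendsto_zero.2 h3
  -- Convergence of T x along the subsequence forces convergence of x itself, with no appeal to weak
  -- compactness.
  have hlim : Tendsto (fun n => x (ns n)) atTop (𝓝 ((‖T‖ ^ 2)⁻¹ • S y)) := by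
    have h1 := ((S.continuous.tendsto y).comp hy).sub (hdiff.comp hns.tendsto_atTop)
    have h2 := h1.const_smul (‖T‖ ^ 2)⁻¹
    rw [sub_zero] at h2
    refine h2.congr fun n => ?_
    simp only [Function.comp_apply, sub_sub_cancel]
    rw [smul_smul, inv_mul_cancel₀ (by positivity), one_smul]
  set φ := (‖T‖ ^ 2)⁻¹ • S y with hφ
  have hTφ : Tendsto (fun n => T (x (ns n))) atTop (𝓝 (T φ)) := (T.continuous.tendsto φ).comp hlim
  refine ⟨φ, fun h0 => ?_, ?_⟩
  · have h1 := tendsto_nhds_unique hTφ.norm (hnorm.comp hns.tendsto_atTop)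
    rw [h0, map_zero, norm_zero] at h1
    exact hT0.ne h1
  · have h1 : Tendsto (fun n => S (T (x (ns n))) - ‖T‖ ^ 2 • x (ns n)) atTop
        (𝓝 (S (T φ) - ‖T‖ ^ 2 • φ)) :=
      ((S.continuous.tendsto _).comp hTφ).sub (hlim.const_smul _)
    exact sub_eq_zero.1 (tendsto_nhds_unique h1 (hdiff.comp hns.tendsto_atTop))

/-- The inverse of `1 + K` for a symmetric positive operator `K`. -/
lemma exists_inverse_one_add {K : L →L[ℝ] L} (hsym : ∀ g h, inner ℝ (K g) h = inner ℝ g (K h))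
    (hpos : ∀ g, 0 ≤ inner ℝ g (K g)) :
    ∃ M : L →L[ℝ] L, (∀ g, M (g + K g) = g) ∧ (∀ g, M g + K (M g) = g) ∧ (∀ g, ‖M g‖ ≤ ‖g‖) ∧
      (∀ g h, inner ℝ (M g) h = inner ℝ g (M h)) ∧ ∀ g, g ≠ 0 → 0 < inner ℝ (M g) g := by
  -- Coercivity with constant 1: it gives invertibility, and applied to `M g` it gives both the
  -- contraction bound and positivity of `M`.
  have hle : ∀ g, ‖g‖ ^ 2 ≤ inner ℝ ((1 + K) g) g := fun g => by
    rw [add_apply, one_apply_eq_self, inner_add_left,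
      real_inner_self_eq_norm_sq, hsym]
    linarith [hpos g]
  have hu : IsUnit (1 + K) := by
    refine ContinuousLinearMap.isUnit_of_forall_le_norm_inner_map (1 + K) (c := 1) one_pos
      fun g => ?_
    rw [NNReal.coe_one, mul_one]
    exact (hle g).trans (le_abs_self _)
  obtain ⟨U, hU⟩ := hu
  set M : L →L[ℝ] L := ((U⁻¹ : (L →L[ℝ] L)ˣ) : L →L[ℝ] L) with hM
  have h1 : ∀ g, M (g + K g) = g := fun g => by
    have : M * (1 + K) = 1 := by rw [hM, ← hU, Units.inv_mul]
    exact congrArg (fun f : L →L[ℝ] L => f g) this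
  have h2 : ∀ g, M g + K (M g) = g := fun g => by
    have : (1 + K) * M = 1 := by rw [hM, ← hU, Units.mul_inv]
    exact congrArg (fun f : L →L[ℝ] L => f g) this
  have h3 : ∀ g, ‖M g‖ ^ 2 ≤ inner ℝ (M g) g := fun g => by
    have := hle (M g)
    rw [show (1 + K) (M g) = g from h2 g] at this
    rwa [real_inner_comm]
  refine ⟨M, h1, h2, fun g => ?_, fun g h => ?_, fun g hg => ?_⟩
  · have h4 := (h3 g).trans (real_inner_le_norm _ _)
    rcases (norm_nonneg (M g)).eq_or_lt' with h5 | h5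
    · rw [h5]; positivity
    · refine le_of_mul_le_mul_left ?_ h5
      rwa [← sq]
  · conv_lhs => rw [← h2 h]
    conv_rhs => rw [← h2 g]
    rw [inner_add_left, inner_add_right, hsym]
  · have h4 : M g ≠ 0 := fun h0 => hg (by rw [← h2 g, h0, map_zero, add_zero])
    exact lt_of_lt_of_le (by positivity) (h3 g)

end abstract

/-! ### The operators on `L²(μ)` -/

section operators

variable {V : ℝ → ℝ} {P : ℝ} {μ : Measure ℝ} [IsProbabilityMeasure μ]

lemma GibbsDensity.integrable_flux (h : GibbsDensity V P μ) {g : ℝ → ℝ} (hg : MemLp g 2 μ) :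
    Integrable fun x => g x * density μ x := by
  have := (integrable_iff_density h.ac).1 (hg.integrable (by norm_num))
  simpa only [mul_comm] using this

lemma GibbsDensity.memLp_flux (h : GibbsDensity V P μ) {g : ℝ → ℝ} (hg : MemLp g 2 μ) :
    MemLp (fun x => g x * density μ x) 2 volume := by
  obtain ⟨K, hK0, hK⟩ := h.bounded
  have hi := h.integrable_flux hg
  rw [memLp_two_iff_integrable_sq hi.1]
  refine ((((integrable_iff_density h.ac).1 hg.integrable_sq)).const_mul K).mono' (hi.1.pow 2) ?_
  filter_upwards [hK] with x hx
  rw [Real.norm_eq_abs, abs_of_nonneg (sq_nonneg _), mul_pow]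
  nlinarith [mul_le_mul_of_nonneg_left hx
    (mul_nonneg (density_nonneg μ x) (sq_nonneg (g x)))]

lemma GibbsDensity.memLp_restrict (h : GibbsDensity V P μ) {f : ℝ → ℝ} (hf : MemLp f 2 volume) :
    MemLp f 2 μ := by
  obtain ⟨K, hK0, hK⟩ := h.bounded
  have hm := hf.1.mono_ac h.ac
  rw [memLp_two_iff_integrable_sq hm, integrable_iff_density h.ac]
  refine (hf.integrable_sq.const_mul K).mono'
    ((measurable_density μ).aestronglyMeasurable.mul (hf.1.pow 2)) ?_
  filter_upwards [hK] with x hx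
  rw [norm_mul, Real.norm_eq_abs, Real.norm_eq_abs, abs_of_nonneg (density_nonneg μ x),
    abs_of_nonneg (sq_nonneg _)]
  exact mul_le_mul_of_nonneg_right hx (sq_nonneg _)

/-- Multiplication by the density, from `L²(μ)` to `L²(dx)`. -/
lemma GibbsDensity.exists_fluxL (h : GibbsDensity V P μ) :
    ∃ Φ : Lp ℝ 2 μ →L[ℝ] Lp ℝ 2 (volume : Measure ℝ),
      ∀ g : Lp ℝ 2 μ, Φ g = (h.memLp_flux (Lp.memLp g)).toLp _ := by
  obtain ⟨K, hK0, hK⟩ := h.bounded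
  refine ⟨LinearMap.mkContinuous
    { toFun := fun g => (h.memLp_flux (Lp.memLp g)).toLp _
      map_add' := fun f g => ?_
      map_smul' := fun c g => ?_ } √K fun g => ?_, fun g => rfl⟩
  · rw [← MemLp.toLp_add, MemLp.toLp_eq_toLp_iff]
    filter_upwards [h.ae_iff.1 (Lp.coeFn_add f g)] with x hx
    rw [hx, Pi.add_apply, Pi.add_apply, add_mul]
  · rw [RingHom.id_apply, ← MemLp.toLp_const_smul, MemLp.toLp_eq_toLp_iff]
    filter_upwards [h.ae_iff.1 (Lp.coeFn_smul c g)] with x hx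
    rw [hx, Pi.smul_apply, Pi.smul_apply, smul_mul_assoc]
  · refine (abs_le_of_sq_le_sq' ?_ (by positivity)).2
    rw [mul_pow, Real.sq_sqrt hK0.le, norm_sq_eq_integral, norm_sq_eq_integral,
      integral_eq_density h.ac, ← integral_const_mul]
    refine integral_mono_ae (Lp.memLp _).integrable_sq
      (((integrable_iff_density h.ac).1 (Lp.memLp g).integrable_sq).const_mul K) ?_
    filter_upwards [hK, (h.memLp_flux (Lp.memLp g)).coeFn_toLp] with x hx hx'
    simp only [LinearMap.coe_mk, AddHom.coe_mk]
    rw [hx', mul_pow]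
    nlinarith [mul_le_mul_of_nonneg_left hx
      (mul_nonneg (density_nonneg μ x) (sq_nonneg (g x)))]

/-- The inclusion of `L²(dx)` in `L²(μ)`. -/
lemma GibbsDensity.exists_restrictL (h : GibbsDensity V P μ) :
    ∃ Φ : Lp ℝ 2 (volume : Measure ℝ) →L[ℝ] Lp ℝ 2 μ,
      ∀ f : Lp ℝ 2 (volume : Measure ℝ), Φ f =ᵐ[μ] f := by
  obtain ⟨K, hK0, hK⟩ := h.bounded
  refine ⟨LinearMap.mkContinuous
    { toFun := fun f => (h.memLp_restrict (Lp.memLp f)).toLp _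
      map_add' := fun f g => ?_
      map_smul' := fun c g => ?_ } √K fun f => ?_,
    fun f => (h.memLp_restrict (Lp.memLp f)).coeFn_toLp⟩
  · rw [← MemLp.toLp_add, MemLp.toLp_eq_toLp_iff]
    exact h.ac.ae_le (Lp.coeFn_add f g)
  · rw [RingHom.id_apply, ← MemLp.toLp_const_smul, MemLp.toLp_eq_toLp_iff]
    exact h.ac.ae_le (Lp.coeFn_smul c g)
  · refine (abs_le_of_sq_le_sq' ?_ (by positivity)).2
    rw [mul_pow, Real.sq_sqrt hK0.le, norm_sq_eq_integral, norm_sq_eq_integral,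
      integral_eq_density h.ac, ← integral_const_mul]
    refine integral_mono_ae ((integrable_iff_density h.ac).1 (Lp.memLp _).integrable_sq)
      ((Lp.memLp f).integrable_sq.const_mul K) ?_
    filter_upwards [hK, h.ae_iff.1 (h.memLp_restrict (Lp.memLp f)).coeFn_toLp] with x hx hx'
    simp only [LinearMap.coe_mk, AddHom.coe_mk]
    rw [hx']
    exact mul_le_mul_of_nonneg_right hx (sq_nonneg _)

lemma GibbsDensity.hilbert_flux (h : GibbsDensity V P μ) (u : HSpace μ) :
    MemLp (hilbert u.flux) 2 μ := h.memLp_restrict (memLp_hilbert (h.memLp_flux (Lp.memLp u.d)))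

lemma GibbsDensity.integrable_hilbert_flux (h : GibbsDensity V P μ) (u : HSpace μ) :
    Integrable (hilbert u.flux) μ := (h.hilbert_flux u).integrable (by norm_num)

lemma GibbsDensity.integral_opW (h : GibbsDensity V P μ) (u : HSpace μ) :
    ∫ x, opW u x ∂μ = 0 := by
  unfold opW
  have e : ∀ x, -hilbert u.flux x + ∫ y, hilbert u.flux y ∂μ =
      (∫ y, hilbert u.flux y ∂μ) - hilbert u.flux x := fun x => by ring
  simp only [e]
  rw [integral_sub (integrable_const _) (h.integrable_hilbert_flux u)]
  simp

/-- The operator `W`, as a bounded operator of `u'`. -/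
lemma GibbsDensity.exists_opWL (h : GibbsDensity V P μ) :
    ∃ W : Lp ℝ 2 μ →L[ℝ] Lp ℝ 2 μ, ∀ u : HSpace μ, W u.d =ᵐ[μ] opW u := by
  obtain ⟨Φ, hΦ⟩ := h.exists_fluxL
  obtain ⟨r, hr⟩ := h.exists_restrictL
  set one : Lp ℝ 2 μ := (memLp_const (1 : ℝ)).toLp _ with h1
  set N : Lp ℝ 2 μ →L[ℝ] Lp ℝ 2 μ := r ∘L hilbertR ∘L Φ with hN
  refine ⟨(ContinuousLinearMap.toSpanSingleton ℝ one) ∘L (innerSL ℝ one) ∘L N - N, fun u => ?_⟩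
  have hNu : N u.d =ᵐ[μ] hilbert u.flux := by
    have e1 : N u.d = r (hilbertR (Φ u.d)) := rfl
    rw [e1, hΦ]
    exact (hr _).trans (h.ac.ae_le (hilbert_ae_eq (h.memLp_flux (Lp.memLp u.d))).symm)
  have e2 : ((ContinuousLinearMap.toSpanSingleton ℝ one) ∘L (innerSL ℝ one) ∘L N - N) u.d =
      (inner ℝ one (N u.d) : ℝ) • one - N u.d := by simp
  rw [e2]
  filter_upwards [Lp.coeFn_sub ((inner ℝ one (N u.d) : ℝ) • one) (N u.d),
    Lp.coeFn_smul (inner ℝ one (N u.d) : ℝ) one, hNu,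
    (memLp_const (1 : ℝ) : MemLp (fun _ => (1 : ℝ)) 2 μ).coeFn_toLp] with x h3 h4 h5 h6
  rw [h3, Pi.sub_apply, h4, Pi.smul_apply, h5, h6, inner_one_eq_integral, integral_congr_ae hNu,
    opW, smul_eq_mul]
  ring

/-! ### The form domain -/

/-- `g` represents `A[v]`. -/
def RepresentsA (v : HSpace μ) (g : Lp ℝ 2 μ) : Prop :=
  HasWeakDeriv v.flux (fun x => -(g x * density μ x))

lemma GibbsDensity.opA_ae_eq (h : GibbsDensity V P μ) {v : HSpace μ} {g : Lp ℝ 2 μ}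
    (hv : RepresentsA v g) : opA v =ᵐ[μ] g := by
  refine h.ae_iff.2 ?_
  filter_upwards [HasWeakDeriv.weakDeriv_ae_eq hv, h.pos] with x h1 h2
  rw [opA, h1, neg_neg, mul_div_cancel_right₀ _ h2.ne']

/-- The Fourier condition is automatic: u'ρ and its weak derivative -A[u]ρ lie in L¹ ∩ L² because ρ
is bounded. -/
lemma GibbsDensity.mem_formDomain_iff (h : GibbsDensity V P μ) (v : HSpace μ) :
    v ∈ formDomain μ ↔ ∃ g, RepresentsA v g := by
  constructor
  · rintro ⟨⟨⟨w, hw⟩, hA⟩, -⟩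
    refine ⟨hA.toLp _, hw.congr .rfl ?_⟩
    filter_upwards [hw.weakDeriv_ae_eq, h.pos, h.ae_iff.1 hA.coeFn_toLp] with x h1 h2 h3
    rw [h3, opA, h1]
    field_simp
  · rintro ⟨g, hg⟩
    refine ⟨⟨⟨_, hg⟩, (Lp.memLp g).ae_eq (h.opA_ae_eq hg).symm⟩, ?_⟩
    exact HasWeakDeriv.integrable_fourierInt hg (h.integrable_flux (Lp.memLp v.d))
      (h.integrable_flux (Lp.memLp g)).neg (h.memLp_flux (Lp.memLp v.d))
      (h.memLp_flux (Lp.memLp g)).neg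

lemma GibbsDensity.integral_of_representsA (h : GibbsDensity V P μ) {v : HSpace μ} {g : Lp ℝ 2 μ}
    (hv : RepresentsA v g) : ∫ x, g x ∂μ = 0 := by
  have h1 := HasWeakDeriv.integral_eq_zero hv (h.integrable_flux (Lp.memLp v.d))
    (h.integrable_flux (Lp.memLp g)).neg
  rw [integral_neg, neg_eq_zero] at h1
  rw [integral_eq_density h.ac, ← h1]
  simp only [mul_comm]

/-- Integration by parts of u against v'ρ. It identifies A as the operator whose inverse is the
adjoint of the embedding. -/
lemma GibbsDensity.inner_eq_of_representsA (h : GibbsDensity V P μ) {v : HSpace μ} {g : Lp ℝ 2 μ}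
    (hv : RepresentsA v g) (u : HSpace μ) : inner ℝ u v = inner ℝ u.fn g := by
  have h1 := (h.hasWeakDeriv_fn u).integral_mul_add hv
    (h.integrable_mul_density (Lp.memLp u.fn) (Lp.memLp v.d))
    (h.integrable_mul_density (Lp.memLp u.d) (Lp.memLp v.d)) (by
      simp only [mul_neg]
      exact (h.integrable_mul_density (Lp.memLp u.fn) (Lp.memLp g)).neg)
  simp only [mul_neg, integral_neg, HSpace.flux] at h1
  rw [h.integral_mul_density, h.integral_mul_density] at h1
  exact add_neg_eq_zero.1 h1

lemma GibbsDensity.exists_hspace (h : GibbsDensity V P μ) {f g : ℝ → ℝ} (hw : HasWeakDeriv f g)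
    (hf : MemLp f 2 μ) (hg : MemLp g 2 μ) (h0 : ∫ x, f x ∂μ = 0) :
    ∃ u : HSpace μ, u.fn =ᵐ[μ] f ∧ u.d =ᵐ[μ] g := by
  refine ⟨⟨(hf.toLp f, hg.toLp g), (h.mem_HSubmodule_iff _).2 ⟨hw.congr ?_ ?_, ?_⟩⟩,
    hf.coeFn_toLp, hg.coeFn_toLp⟩
  · exact h.ac'.ae_le hf.coeFn_toLp.symm
  · exact h.ac'.ae_le hg.coeFn_toLp.symm
  · rw [integral_congr_ae hf.coeFn_toLp, h0]

lemma GibbsDensity.exists_hspace_of_test (h : GibbsDensity V P μ) {ψ : ℝ → ℝ}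
    (hψ : ContDiff ℝ ∞ ψ) (hc : HasCompactSupport ψ) :
    ∃ u : HSpace μ, u.fn =ᵐ[μ] (fun x => ψ x - ∫ y, ψ y ∂μ) ∧ u.d =ᵐ[μ] deriv ψ := by
  have h1 : MemLp ψ 2 μ := hψ.continuous.memLp_of_hasCompactSupport hc
  have h2 : MemLp (deriv ψ) 2 μ :=
    (hψ.continuous_deriv (by simp)).memLp_of_hasCompactSupport hc.deriv
  refine h.exists_hspace ?_ (h1.sub (memLp_const _)) h2 ?_
  · have := hasWeakDeriv_of_contDiff (f := fun x => ψ x - ∫ y, ψ y ∂μ)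
      ((hψ.of_le (by simp)).sub contDiff_const)
    refine this.congr .rfl (.of_forall fun x => ?_)
    exact deriv_sub_const _
  · rw [integral_sub (h1.integrable (by norm_num)) (integrable_const _)]
    simp

/-- Elements of H have mean zero, so a test function enters only after subtracting its mean; the
condition on ∫g makes this subtraction invisible. -/
lemma GibbsDensity.representsA_of_inner (h : GibbsDensity V P μ) {v : HSpace μ} {g : Lp ℝ 2 μ}
    (hv : ∀ u : HSpace μ, inner ℝ u v = inner ℝ u.fn g) (h0 : ∫ x, g x ∂μ = 0) :
    RepresentsA v g := by
  refine ⟨(h.integrable_flux (Lp.memLp v.d)).locallyIntegrable,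
    (h.integrable_flux (Lp.memLp g)).neg.locallyIntegrable, fun ψ hψ hc => ?_⟩
  obtain ⟨u, hu1, hu2⟩ := h.exists_hspace_of_test hψ hc
  have h1 := hv u
  have h2 : MemLp ψ 2 μ := hψ.continuous.memLp_of_hasCompactSupport hc
  rw [HSpace.inner_eq, ← h.integral_mul_density, ← h.integral_mul_density] at h1
  have e1 : ∫ x, v.flux x * deriv ψ x = ∫ x, u.d x * (v.d x * density μ x) := by
    refine integral_congr_ae ?_
    filter_upwards [h.ae_iff.1 hu2] with x hx
    rw [hx, HSpace.flux, mul_comm]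
  have e2 : ∫ x, u.fn x * (g x * density μ x) = ∫ x, ψ x * (g x * density μ x) := by
    have hz : ∫ x, g x * density μ x = 0 := by
      rw [integral_eq_density h.ac] at h0
      simpa only [mul_comm] using h0
    have e3 : ∫ x, u.fn x * (g x * density μ x) =
        ∫ x, (ψ x * (g x * density μ x) - (∫ y, ψ y ∂μ) * (g x * density μ x)) := by
      refine integral_congr_ae ?_
      filter_upwards [h.ae_iff.1 hu1] with x hx
      rw [hx, sub_mul]
    rw [e3, integral_sub (h.integrable_mul_density h2 (Lp.memLp g))
      ((h.integrable_flux (Lp.memLp g)).const_mul _), integral_const_mul, hz, mul_zero, sub_zero]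
  rw [e1, h1, e2, ← integral_neg]
  congr 1; ext x; ring

/-! ### The form -/

/-- The Fourier part of the form. -/
def fourierForm (u v : HSpace μ) : ℝ :=
  (∫ ξ : ℝ, ((|ξ| : ℝ) : ℂ) * (fourierInt u.flux ξ * starRingEnd ℂ (fourierInt v.flux ξ))).re

lemma fourierForm_symm (u v : HSpace μ) : fourierForm u v = fourierForm v u := by
  unfold fourierForm
  rw [← Complex.conj_re, ← integral_conj]
  congr 2; ext ξ
  simp only [map_mul, Complex.conj_ofReal, Complex.conj_conj]
  ring

lemma fourierForm_nonneg (u : HSpace μ) : 0 ≤ fourierForm u u := by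
  have : ∀ ξ : ℝ, ((|ξ| : ℝ) : ℂ) * (fourierInt u.flux ξ * starRingEnd ℂ (fourierInt u.flux ξ)) =
      ((|ξ| * Complex.normSq (fourierInt u.flux ξ) : ℝ) : ℂ) := fun ξ => by
    rw [Complex.mul_conj]
    push_cast
    rfl
  unfold fourierForm
  simp only [this]
  rw [integral_complex_ofReal, Complex.ofReal_re]
  exact integral_nonneg fun ξ => mul_nonneg (abs_nonneg _) (Complex.normSq_nonneg _)

/-- The Hilbert-transform formula for the pairing, applied to (u'ρ)' = -gρ. The constant in W drops
out because g has mean zero. -/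
lemma GibbsDensity.fourierForm_eq (h : GibbsDensity V P μ) {u : HSpace μ} {g : Lp ℝ 2 μ}
    (hu : RepresentsA u g) (v : HSpace μ) :
    fourierForm u v = 2 * ∫ x, g x * opW v x ∂μ := by
  have h1 := HasWeakDeriv.integral_mul_hilbert hu (h.integrable_flux (Lp.memLp u.d))
    (h.integrable_flux (Lp.memLp g)).neg (h.memLp_flux (Lp.memLp g)).neg
    (h.integrable_flux (Lp.memLp v.d)) (h.memLp_flux (Lp.memLp v.d))
  unfold fourierForm
  refine h1.trans ?_
  congr 1
  have i1 : Integrable (fun x => g x * hilbert v.flux x) μ :=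
    (Lp.memLp g).integrable_mul (h.hilbert_flux v)
  have e1 : ∫ x, g x * opW v x ∂μ = -∫ x, g x * hilbert v.flux x ∂μ := by
    have e2 : ∀ x, g x * opW v x =
        g x * (∫ y, hilbert v.flux y ∂μ) - g x * hilbert v.flux x := fun x => by
      rw [opW]; ring
    simp only [e2]
    rw [integral_sub ((integrable_coeFn g).mul_const _) i1, integral_mul_const,
      h.integral_of_representsA hu, zero_mul, zero_sub]
  rw [e1, integral_eq_density h.ac, ← integral_neg]
  refine integral_congr_ae (.of_forall fun x => ?_)
  change -(g x * density μ x) * hilbert v.flux x = -(density μ x * (g x * hilbert v.flux x))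
  ring

/-- Brings q(u, v) to the form ⟨A[u], A[v] + 2P W[v]⟩, from which the operator A + 2P W is read off.
-/
lemma GibbsDensity.formL_eq (h : GibbsDensity V P μ) {u v : HSpace μ} {g k w : Lp ℝ 2 μ}
    (hu : RepresentsA u g) (hv : RepresentsA v k) (hw : w =ᵐ[μ] opW v) :
    formL P u v = inner ℝ g (k + (2 * P) • w) := by
  have e1 : ∫ x, opA u x * opA v x ∂μ = inner ℝ g k := by
    rw [L2.inner_def]
    refine integral_congr_ae ?_
    filter_upwards [h.opA_ae_eq hu, h.opA_ae_eq hv] with x h1 h2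
    rw [h1, h2]
    simp [mul_comm]
  have e2 : ∫ x, g x * opW v x ∂μ = inner ℝ g w := by
    rw [L2.inner_def]
    refine integral_congr_ae ?_
    filter_upwards [hw] with x h1
    rw [h1]
    simp [mul_comm]
  rw [inner_add_right, real_inner_smul_right, ← e1, ← e2]
  have e3 := h.fourierForm_eq hu v
  unfold formL
  rw [show (∫ ξ : ℝ, ((|ξ| : ℝ) : ℂ) * (fourierInt u.flux ξ *
    starRingEnd ℂ (fourierInt v.flux ξ))).re = fourierForm u v from rfl, e3]
  ring

end operators

/-! ### The Friedrichs operator through the solution operator of A. -/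

section friedrichs

variable {V : ℝ → ℝ} {P : ℝ} {μ : Measure ℝ} [IsProbabilityMeasure μ]

variable (μ) in
/-- The weak derivative as an isometry from `H` to `L²(μ)`. -/
def derivL : HSpace μ →L[ℝ] Lp ℝ 2 μ :=
  LinearMap.mkContinuous (HSpace.dₗ μ) 1 fun u => by rw [one_mul]; rfl

lemma integral_sub_smul_one (g : Lp ℝ 2 μ) :
    ∫ x, (g - (∫ y, g y ∂μ) • ((memLp_const (1 : ℝ)).toLp _ : Lp ℝ 2 μ)) x ∂μ = 0 := by
  rw [← inner_one_eq_integral, inner_sub_right, real_inner_smul_right, inner_one_eq_integral,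
    inner_one_eq_integral, integral_congr_ae (memLp_const (1 : ℝ)).coeFn_toLp]
  simp

/-- `S` maps `g` to the solution `v ∈ H` of `A[v] = g - ∫ g dμ`. -/
def IsSolutionOperator (S : Lp ℝ 2 μ →L[ℝ] HSpace μ) : Prop :=
  ∀ g u, inner ℝ (S g) u = inner ℝ g (HSpace.fn u)

namespace IsSolutionOperator

variable {S : Lp ℝ 2 μ →L[ℝ] HSpace μ}

lemma representsA (hS : IsSolutionOperator S) (h : GibbsDensity V P μ) {g : Lp ℝ 2 μ}
    (h0 : ∫ x, g x ∂μ = 0) : RepresentsA (S g) g :=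
  h.representsA_of_inner (fun u => by rw [real_inner_comm, hS, real_inner_comm]) h0

lemma eq_of_representsA (hS : IsSolutionOperator S) (h : GibbsDensity V P μ)
    (hsep : ∀ u : HSpace μ, ‖u‖ = 0 → u = 0) {v : HSpace μ} {g : Lp ℝ 2 μ}
    (hv : RepresentsA v g) : v = S g := by
  rw [← sub_eq_zero]
  refine hsep _ ?_
  have h1 : inner ℝ (v - S g) (v - S g) = (0 : ℝ) := by
    rw [inner_sub_right, h.inner_eq_of_representsA hv, real_inner_comm (S g) (v - S g), hS,
      real_inner_comm, sub_self]
  rw [real_inner_self_eq_norm_sq] at h1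
  exact pow_eq_zero_iff two_ne_zero |>.1 h1

/-- Constants are orthogonal to the mean-zero functions of H, so the adjoint of the embedding kills
them. -/
lemma map_sub_mean (hS : IsSolutionOperator S) (hsep : ∀ u : HSpace μ, ‖u‖ = 0 → u = 0)
    (g : Lp ℝ 2 μ) (c : ℝ) : S (g - c • ((memLp_const (1 : ℝ)).toLp _ : Lp ℝ 2 μ)) = S g := by
  have h1 : S ((memLp_const (1 : ℝ)).toLp _ : Lp ℝ 2 μ) = 0 := by
    refine hsep _ (pow_eq_zero_iff two_ne_zero |>.1 ?_)
    rw [← real_inner_self_eq_norm_sq, hS, inner_one_eq_integral, HSpace.integral_fn]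
  rw [map_sub, map_smul, h1, smul_zero, sub_zero]

/-- W[v] has mean zero, so g may be replaced by g minus its mean, which is A[S g]. This identity
makes K symmetric and nonnegative on all of L²(μ). -/
lemma inner_opW (hS : IsSolutionOperator S) (h : GibbsDensity V P μ)
    (hsep : ∀ u : HSpace μ, ‖u‖ = 0 → u = 0) {W : Lp ℝ 2 μ →L[ℝ] Lp ℝ 2 μ}
    (hW : ∀ u : HSpace μ, W u.d =ᵐ[μ] opW u) (g : Lp ℝ 2 μ) (v : HSpace μ) :
    inner ℝ g (W v.d) = fourierForm (S g) v / 2 := by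
  set g₀ := g - (∫ y, g y ∂μ) • ((memLp_const (1 : ℝ)).toLp _ : Lp ℝ 2 μ) with hg₀
  have h1 : RepresentsA (S g) g₀ := by
    rw [← hS.map_sub_mean hsep g (∫ y, g y ∂μ)]
    exact hS.representsA h (integral_sub_smul_one g)
  have h2 : ∫ x, g₀ x * opW v x ∂μ = inner ℝ g₀ (W v.d) := by
    rw [L2.inner_def]
    refine integral_congr_ae ?_
    filter_upwards [hW v] with x hx
    rw [hx]
    simp [mul_comm]
  rw [h.fourierForm_eq h1 v, h2, hg₀, inner_sub_left, real_inner_smul_left, inner_one_eq_integral,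
    integral_congr_ae (hW v), h.integral_opW]
  ring

end IsSolutionOperator

lemma GibbsDensity.formL_eq_inner (h : GibbsDensity V P μ) {W : Lp ℝ 2 μ →L[ℝ] Lp ℝ 2 μ}
    (hW : ∀ u : HSpace μ, W u.d =ᵐ[μ] opW u) {v f : HSpace μ} {k : Lp ℝ 2 μ}
    (hv : RepresentsA v k) (hf : k + (2 * P) • W v.d = f.fn) :
    ∀ φ ∈ formDomain μ, formL P φ v = inner ℝ φ f := by
  intro φ hφ
  obtain ⟨g, hg⟩ := (h.mem_formDomain_iff φ).1 hφ
  rw [h.formL_eq hg hv (hW v), hf, real_inner_comm, ← h.inner_eq_of_representsA hg,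
    real_inner_comm]

lemma GibbsDensity.mem_domL (h : GibbsDensity V P μ) {v f : HSpace μ} {k : Lp ℝ 2 μ}
    (hv : RepresentsA v k) (hf : ∀ φ ∈ formDomain μ, formL P φ v = inner ℝ φ f) :
    v ∈ domL μ P := by
  refine ⟨(h.mem_formDomain_iff v).2 ⟨k, hv⟩, innerSL ℝ f, fun φ hφ => ?_⟩
  rw [hf φ hφ, innerSL_apply_apply, real_inner_comm]

/-- The form domain separates H: testing with the solution of A[φ] = f - f' yields ‖f - f'‖² = 0 in
L²(μ). Hence the element defining -L[v] is unique. -/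
lemma GibbsDensity.eq_of_inner_eq (h : GibbsDensity V P μ) {S : Lp ℝ 2 μ →L[ℝ] HSpace μ}
    (hS : IsSolutionOperator S) {f f' : HSpace μ}
    (hf : ∀ φ ∈ formDomain μ, inner ℝ φ f = (inner ℝ φ f' : ℝ)) : f = f' := by
  refine h.eq_of_fn_eq (sub_eq_zero.1 ?_)
  have h0 : ∫ x, (f.fn - f'.fn) x ∂μ = 0 := by
    rw [← inner_one_eq_integral, inner_sub_right, inner_one_eq_integral, inner_one_eq_integral,
      HSpace.integral_fn, HSpace.integral_fn, sub_self]
  have h1 := hf (S (f.fn - f'.fn))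
    ((h.mem_formDomain_iff _).2 ⟨_, hS.representsA h h0⟩)
  rw [hS, hS, ← sub_eq_zero, ← inner_sub_right] at h1
  exact inner_self_eq_zero.1 h1

lemma GibbsDensity.negL_eq (h : GibbsDensity V P μ) {S : Lp ℝ 2 μ →L[ℝ] HSpace μ}
    (hS : IsSolutionOperator S) (v : domL μ P) {f : HSpace μ}
    (hf : ∀ φ ∈ formDomain μ, formL P φ v = inner ℝ φ f) : negL P v = f := by
  have h1 : ∀ φ ∈ formDomain μ, formL P φ v = inner ℝ φ (negL P v) :=
    Classical.epsilon_spec (p := fun f => ∀ φ ∈ formDomain μ, formL P φ v = inner ℝ φ f) ⟨f, hf⟩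
  exact h.eq_of_inner_eq hS fun φ hφ => by rw [← h1 φ hφ, hf φ hφ]

/-- The Riesz element f of the extended functional satisfies ⟨A[φ], A[v] + 2P W[v] - f⟩ = 0 on the
form domain. The second factor w has mean zero, so φ = S w is admissible and gives w = 0; thus A[v]
+ 2P W[v] belongs to H. -/
lemma GibbsDensity.exists_of_mem_domL (h : GibbsDensity V P μ) [CompleteSpace (HSpace μ)]
    (hsep : ∀ u : HSpace μ, ‖u‖ = 0 → u = 0) {S : Lp ℝ 2 μ →L[ℝ] HSpace μ}
    (hS : IsSolutionOperator S) {W : Lp ℝ 2 μ →L[ℝ] Lp ℝ 2 μ}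
    (hW : ∀ u : HSpace μ, W u.d =ᵐ[μ] opW u) (v : domL μ P) :
    ∃ (k : Lp ℝ 2 μ) (f : HSpace μ), RepresentsA (v : HSpace μ) k ∧
      k + (2 * P) • W (v : HSpace μ).d = f.fn := by
  obtain ⟨hv, ℓ, hℓ⟩ := v.2
  obtain ⟨k, hk⟩ := (h.mem_formDomain_iff _).1 hv
  obtain ⟨f, hf⟩ := exists_riesz hsep ℓ
  refine ⟨k, f, hk, sub_eq_zero.1 ?_⟩
  set w := k + (2 * P) • W (v : HSpace μ).d - f.fn with hw
  have h0 : ∫ x, w x ∂μ = 0 := by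
    rw [← inner_one_eq_integral, hw, inner_sub_right, inner_add_right, real_inner_smul_right,
      inner_one_eq_integral, inner_one_eq_integral, inner_one_eq_integral,
      h.integral_of_representsA hk, integral_congr_ae (hW _), h.integral_opW, HSpace.integral_fn]
    ring
  have h1 := hS.representsA h h0
  have h2 := hℓ (S w) ((h.mem_formDomain_iff _).2 ⟨_, h1⟩)
  rw [hf, hS, h.formL_eq h1 hk (hW _), ← sub_eq_zero, ← inner_sub_right,
    ← neg_sub, ← hw, inner_neg_right, neg_eq_zero] at h2
  exact inner_self_eq_zero.1 h2

/-! ### Test functions -/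

lemma GibbsDensity.representsA_test (h : GibbsDensity V P μ) (hV : ContDiff ℝ 1 V)
    {u : HSpace μ} {φ : ℝ → ℝ} (hφ : ContDiff ℝ ∞ φ) (hud : u.d =ᵐ[volume] deriv φ)
    (hk : MemLp (fun x => -deriv (deriv φ) x + deriv φ x * (deriv V x +
      2 * P * hilbert (density μ) x)) 2 μ) : RepresentsA u (hk.toLp _) := by
  have hφ1 : ContDiff ℝ 1 (deriv φ) := (contDiff_infty_iff_deriv.1 hφ).2.of_le (by simp)
  refine ((h.hasWeakDeriv_density hV).mul_contDiff hφ1).congr ?_ ?_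
  · filter_upwards [hud] with x hx
    rw [HSpace.flux, hx]
  · filter_upwards [h.ae_iff.1 hk.coeFn_toLp] with x hx
    rw [hx]
    ring

/-- With χ = φ', A[φ] contains 2Pχℋ[ρ], while -2Pℋ[χρ] equals -2Pχℋ[ρ] minus 2P times the commutator
integral. The rough terms cancel, and what remains is C¹ plus Lipschitz, hence in H. -/
lemma GibbsDensity.exists_masterOp (h : GibbsDensity V P μ) (hV : ContDiff ℝ 2 V)
    {W : Lp ℝ 2 μ →L[ℝ] Lp ℝ 2 μ} (hW : ∀ u : HSpace μ, W u.d =ᵐ[μ] opW u)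
    {u : HSpace μ} {φ : ℝ → ℝ} (hφ : ContDiff ℝ ∞ φ) (hφc : HasCompactSupport φ)
    (hu : u.fn =ᵐ[μ] φ) :
    ∃ (k : Lp ℝ 2 μ) (f : HSpace μ), RepresentsA u k ∧ k + (2 * P) • W u.d = f.fn ∧
      f.fn =ᵐ[μ] fun x => -masterOp V P μ (deriv φ) x := by
  have hV1 : ContDiff ℝ 1 V := hV.of_le (by norm_num)
  have hV' : ContDiff ℝ 1 (deriv V) := by
    have : ContDiff ℝ (1 + 1) V := by simpa [one_add_one_eq_two] using hV
    exact (contDiff_succ_iff_deriv.1 this).2.2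
  set χ := deriv φ with hχd
  have hχ : ContDiff ℝ ∞ χ := (contDiff_infty_iff_deriv.1 hφ).2
  have hχ' : ContDiff ℝ ∞ (deriv χ) := (contDiff_infty_iff_deriv.1 hχ).2
  have hχc : HasCompactSupport χ := hφc.deriv
  have hχ1 : ContDiff ℝ 1 χ := hχ.of_le (by simp)
  have hud : u.d =ᵐ[volume] χ :=
    ((h.hasWeakDeriv_fn u).congr (h.ae_iff.1 hu) .rfl).unique
      (hasWeakDeriv_of_contDiff (hφ.of_le (by simp)))
  have hcs : ∀ g : ℝ → ℝ, Continuous g → HasCompactSupport g → MemLp g 2 μ :=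
    fun g hg hgc => hg.memLp_of_hasCompactSupport hgc
  have hH : MemLp (hilbert (density μ)) 2 volume := memLp_hilbert h.memLp_density
  obtain ⟨B, hB⟩ := hχ.continuous.bounded_above_of_compact_support hχc
  have hχH : MemLp (fun x => χ x * hilbert (density μ) x) 2 μ :=
    h.memLp_restrict (lpBounded_mulFun hχ.continuous.aestronglyMeasurable (.of_forall hB) _ hH).1
  have hG1 : ContDiff ℝ 1 fun x => χ x * deriv V x - deriv χ x :=
    (hχ1.mul hV').sub (hχ'.of_le (by simp))
  have hGc : HasCompactSupport fun x => χ x * deriv V x - deriv χ x :=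
    hχc.mul_right.sub hχc.deriv
  have hk : MemLp (fun x => -deriv χ x + χ x * (deriv V x +
      2 * P * hilbert (density μ) x)) 2 μ := by
    refine ((hcs _ hG1.continuous hGc).add (hχH.const_mul (2 * P))).ae_eq
      (.of_forall fun x => ?_)
    simp only [Pi.add_apply]
    ring
  have hrep : RepresentsA u (hk.toLp _) := h.representsA_test hV1 hφ hud hk
  have hχρ : MemLp (fun x => χ x * density μ x) 2 volume :=
    h.memLp_flux (hcs _ hχ.continuous hχc)
  have hflux : hilbert u.flux =ᵐ[volume] hilbert fun t => χ t * density μ t := by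
    refine hilbert_congr_ae (h.memLp_flux (Lp.memLp u.d)) ?_
    filter_upwards [hud] with x hx
    rw [HSpace.flux, hx]
  set m := ∫ y, hilbert (fun t => χ t * density μ t) y ∂μ with hm
  have hmu : ∫ y, hilbert u.flux y ∂μ = m := integral_congr_ae (h.ae_iff.2 hflux)
  have hmaster : ∀ x, -masterOp V P μ χ x =
      (χ x * deriv V x - deriv χ x) + ((-(2 * P)) • commKer χ (density μ)) x + 2 * P * m := by
    intro x
    rw [masterOp, integral_eq_density h.ac, Pi.smul_apply, smul_eq_mul, commKer]
    ring
  obtain ⟨Kl, hKl⟩ := exists_lipschitzWith_commKer (contDiff_infty.1 hχ 2) hχc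
    (integrable_density (μ := μ))
  obtain ⟨B', hB'⟩ := exists_abs_commKer_le hχ1 hχc (integrable_density (μ := μ))
  set F : ℝ → ℝ := fun x => -masterOp V P μ χ x with hF
  -- The local part is C¹ with compact support because V is C²; the commutator part has a bounded
  -- derivative.
  have hFw : ∃ F', HasWeakDeriv F F' ∧ MemLp F' 2 μ := by
    have w1 := hasWeakDeriv_of_contDiff (hG1.add (contDiff_const (c := 2 * P * m)))
    have w2 := (hasWeakDeriv_of_lipschitzWith hKl).smul (-(2 * P))
    refine ⟨_, (w1.add w2).congr (.of_forall fun x => ?_) .rfl, ?_⟩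
    · rw [hF]
      simp only [hmaster, Pi.add_apply]
      ring
    · refine MemLp.add (MemLp.ae_eq (f := deriv fun x => χ x * deriv V x - deriv χ x)
        (.of_forall fun x => (deriv_add_const _).symm)
        (hcs _ (hG1.continuous_deriv le_rfl) hGc.deriv)) (MemLp.const_smul ?_ _)
      exact MemLp.of_bound (measurable_deriv _).aestronglyMeasurable Kl
        (.of_forall fun x => norm_deriv_le_of_lipschitz hKl)
  obtain ⟨F', hFF', hF'⟩ := hFw
  have hFk : ((hk.toLp _ : Lp ℝ 2 μ) + (2 * P) • W u.d : Lp ℝ 2 μ) =ᵐ[μ] F := by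
    have hcomm := hilbert_mul_ae_eq hχ hχc h.memLp_density
    filter_upwards [Lp.coeFn_add (hk.toLp _ : Lp ℝ 2 μ) ((2 * P) • W u.d),
      Lp.coeFn_smul (2 * P) (W u.d), hk.coeFn_toLp, hW u, h.ae_iff.2 hflux,
      h.ae_iff.2 hcomm] with x h1 h2 h3 h4 h5 h6
    rw [h1, Pi.add_apply, h2, Pi.smul_apply, h3, h4, opW, hmu, h5, h6, hF]
    simp only [hmaster, Pi.smul_apply, smul_eq_mul]
    ring
  have hFm : MemLp F 2 μ := (Lp.memLp _).ae_eq hFk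
  have hF0 : ∫ x, F x ∂μ = 0 := by
    rw [← integral_congr_ae hFk, ← inner_one_eq_integral, inner_add_right, real_inner_smul_right,
      inner_one_eq_integral, inner_one_eq_integral, h.integral_of_representsA hrep,
      integral_congr_ae (hW u), h.integral_opW]
    ring
  obtain ⟨f, hf, -⟩ := h.exists_hspace hFF' hFm hF' hF0
  exact ⟨_, f, hrep, Lp.ext (hFk.trans hf.symm), hf⟩

/-- Needed for ‖T‖ > 0: a centred cutoff is not almost everywhere zero, since a continuous function
equal to a constant almost everywhere is constant. -/
lemma GibbsDensity.exists_fn_ne_zero (h : GibbsDensity V P μ) : ∃ u : HSpace μ, u.fn ≠ 0 := by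
  obtain ⟨u, hu, -⟩ := h.exists_hspace_of_test (cutoff_contDiff 1)
    (cutoff_hasCompactSupport one_pos)
  refine ⟨u, fun h0 => ?_⟩
  rw [h0] at hu
  have h1 : cutoff 1 =ᵐ[volume] fun _ => ∫ y, cutoff 1 y ∂μ := by
    filter_upwards [h.ae_iff.1 hu, h.ae_iff.1 (Lp.coeFn_zero ℝ 2 μ)] with x hx hx'
    rw [hx', Pi.zero_apply] at hx
    linarith
  have h2 := (Continuous.ae_eq_iff_eq volume (cutoff_contDiff 1).continuous continuous_const).1 h1
  have h3 := congrFun h2 0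
  have h4 := congrFun h2 2
  rw [cutoff_eq_one one_pos (by simp)] at h3
  rw [cutoff_eq_zero one_pos (by simp)] at h4
  linarith

/-- As `S` inverts A, S T φ = ‖T‖²φ says that A[φ] = ‖T‖⁻²φ. Conversely A[φ] = lφ gives ‖φ‖_H² =
l‖φ‖² in L²(μ), and ‖φ‖ ≤ ‖T‖‖φ‖_H forces l ≥ ‖T‖⁻². -/
lemma GibbsDensity.isLeast_eigenvaluesA (h : GibbsDensity V P μ)
    (hsep : ∀ u : HSpace μ, ‖u‖ = 0 → u = 0) {T : HSpace μ →L[ℝ] Lp ℝ 2 μ}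
    (hT : ∀ u, T u = u.fn) {S : Lp ℝ 2 μ →L[ℝ] HSpace μ} (hS : IsSolutionOperator S)
    (hT0 : 0 < ‖T‖) (hex : ∃ φ : HSpace μ, φ ≠ 0 ∧ S (T φ) = ‖T‖ ^ 2 • φ) :
    IsLeast (eigenvaluesA μ) (‖T‖ ^ 2)⁻¹ := by
  constructor
  · obtain ⟨φ, hφ0, hφ⟩ := hex
    have h1 : φ = S ((‖T‖ ^ 2)⁻¹ • φ.fn) := by
      rw [map_smul, ← hT, hφ, smul_smul, inv_mul_cancel₀ (by positivity), one_smul]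
    have h2 : ∫ x, ((‖T‖ ^ 2)⁻¹ • φ.fn) x ∂μ = 0 := by
      rw [← inner_one_eq_integral, real_inner_smul_right, inner_one_eq_integral,
        HSpace.integral_fn, mul_zero]
    have h3 := hS.representsA h h2
    rw [← h1] at h3
    refine ⟨φ, (h.mem_formDomain_iff φ).2 ⟨_, h3⟩, hφ0, (h.opA_ae_eq h3).trans ?_⟩
    exact Lp.coeFn_smul _ _
  · rintro l ⟨φ, hφ, hφ0, hl⟩
    obtain ⟨g, hg⟩ := (h.mem_formDomain_iff φ).1 hφ
    have h1 : g = l • φ.fn := Lp.ext (((h.opA_ae_eq hg).symm.trans hl).trans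
      (Lp.coeFn_smul l φ.fn).symm)
    have h2 := h.inner_eq_of_representsA hg φ
    rw [h1, real_inner_smul_right, real_inner_self_eq_norm_sq, real_inner_self_eq_norm_sq] at h2
    have h3 : 0 < ‖φ‖ := lt_of_le_of_ne (norm_nonneg _) fun h0 => hφ0 (hsep φ h0.symm)
    have h4 : ‖φ.fn‖ ^ 2 ≤ ‖T‖ ^ 2 * ‖φ‖ ^ 2 := by
      rw [← mul_pow, ← hT]
      exact pow_le_pow_left₀ (norm_nonneg _) (T.le_opNorm φ) 2
    have h5 : 0 < ‖φ‖ ^ 2 := by positivity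
    have h6 : 0 < l := by
      by_contra hcon
      nlinarith [sq_nonneg ‖φ.fn‖, mul_nonneg (neg_nonneg.2 (not_lt.1 hcon)) (sq_nonneg ‖φ.fn‖)]
    rw [inv_le_iff_one_le_mul₀ (by positivity)]
    refine le_of_mul_le_mul_right ?_ h5
    nlinarith

end friedrichs

end

end BetaEnsemble

open BetaEnsemble

/-! ### The inversion theorem. -/

theorem theorem6p6 (V : ℝ → ℝ) (P : ℝ) (hP : 0 < P) (μ : Measure ℝ) [IsProbabilityMeasure μ]
    (hμ : IsEquilibriumMeasure V P μ) (hV : PotentialAssumptions V μ) :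
    -- `H` is a Hilbert space
    ((∀ u : HSpace μ, ‖u‖ = 0 → u = 0) ∧ CompleteSpace (HSpace μ)) ∧
    -- `-L` is well defined on `D(L)` by the form, and nothing else satisfies its definition
    (∀ (v : domL μ P) (f : HSpace μ),
      (∀ φ ∈ formDomain μ, formL P φ v = inner ℝ φ f) ↔ f = negL P v) ∧
    -- it is the operator `A + 2 P W`
    (∀ v : domL μ P,
      ⇑(negL P v).fn =ᵐ[μ] fun x => opA (v : HSpace μ) x + 2 * P * opW (v : HSpace μ) x) ∧
    -- and on test functions it is `φ ↦ -Ξ[φ']`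
    (∀ (u : HSpace μ) (φ : ℝ → ℝ), ContDiff ℝ ∞ φ → HasCompactSupport φ → ⇑u.fn =ᵐ[μ] φ →
      ∃ hu : u ∈ domL μ P,
        ⇑(negL P ⟨u, hu⟩).fn =ᵐ[μ] fun x => -masterOp V P μ (deriv φ) x) ∧
    -- the inversion
    Function.Bijective (negL P : domL μ P → HSpace μ) ∧
    ∃ l₁ : ℝ, IsLeast (eigenvaluesA μ) l₁ ∧ 0 < l₁ ∧
      ∃ R : HSpace μ →L[ℝ] HSpace μ,
        (∀ v : domL μ P, R (negL P v) = v) ∧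
        (∀ f g : HSpace μ, inner ℝ (R f) g = inner ℝ f (R g)) ∧
        (∀ f : HSpace μ, f ≠ 0 → 0 < inner ℝ (R f) f) ∧
        ∀ f : HSpace μ, ‖R f‖ ≤ l₁⁻¹ * ‖f‖ := by
  have hg := hμ.gibbsDensity hP hV
  have hVc : Continuous V := hV.contDiff.continuous
  have hsep : ∀ u : HSpace μ, ‖u‖ = 0 → u = 0 := hg.eq_zero_of_norm_eq_zero hV.poincare
  have hcomplete : CompleteSpace (HSpace μ) := hg.completeSpace hVc hV.poincare
  obtain ⟨C, -, hC⟩ := hg.exists_norm_fn_le hV.poincare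
  set T := embed hC
  have hT : ∀ u, T u = u.fn := fun u => rfl
  obtain ⟨S, hS'⟩ := exists_adjoint hsep T
  have hS : IsSolutionOperator S := hS'
  obtain ⟨W, hW⟩ := hg.exists_opWL
  have hnegL := fun v : domL μ P => hg.exists_of_mem_domL hsep hS hW v
  -- In the unknown k = A[v], v = S k, the equation -L[v] = f reads (1 + K)k = f.
  set K : Lp ℝ 2 μ →L[ℝ] Lp ℝ 2 μ := (2 * P) • (W ∘L derivL μ ∘L S) with hK
  have hKapp : ∀ g, K g = (2 * P) • W (S g).d := fun g => rfl
  have hKinner : ∀ g k, inner ℝ g (K k) = P * fourierForm (S g) (S k) := fun g k => by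
    rw [hKapp, real_inner_smul_right, hS.inner_opW hg hsep hW]
    ring
  obtain ⟨M, hM1, hM2, hM3, hM4, hM5⟩ := exists_inverse_one_add (K := K)
    (fun g k => by rw [real_inner_comm, hKinner, hKinner, fourierForm_symm])
    (fun g => by rw [hKinner]; exact mul_nonneg hP.le (fourierForm_nonneg _))
  have hinv : ∀ v : domL μ P, S (M (negL P v).fn) = v := fun v => by
    obtain ⟨k, f, hk, hf⟩ := hnegL v
    have hv := hS.eq_of_representsA hg hsep hk
    rw [hg.negL_eq hS v (hg.formL_eq_inner hW hk hf), ← hf, hv, ← hKapp, hM1]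
  have hT0 : 0 < ‖T‖ := by
    obtain ⟨u, hu⟩ := hg.exists_fn_ne_zero
    refine lt_of_le_of_ne T.opNorm_nonneg fun h0 => hu ?_
    have h1 := T.le_opNorm u
    rw [← h0, zero_mul] at h1
    exact norm_le_zero_iff.1 h1
  refine ⟨⟨hsep, hcomplete⟩, fun v f => ⟨fun hf => (hg.negL_eq hS v hf).symm, ?_⟩, fun v => ?_,
    fun u φ hφ hφc hu => ?_, ⟨fun v v' hvv' => ?_, fun f => ?_⟩, (‖T‖ ^ 2)⁻¹,
    hg.isLeast_eigenvaluesA hsep hT hS hT0 (exists_eigenvector_of_isCompactOperator hsep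
      (hg.isCompactOperator_embed hP hV hC) hS' hT0), by positivity, S ∘L M ∘L T, hinv,
    fun f g => ?_, fun f hf => ?_, fun f => ?_⟩
  · rintro rfl
    obtain ⟨k, f, hk, hf⟩ := hnegL v
    have h1 := hg.formL_eq_inner hW hk hf
    rwa [hg.negL_eq hS v h1]
  · obtain ⟨k, f, hk, hf⟩ := hnegL v
    rw [hg.negL_eq hS v (hg.formL_eq_inner hW hk hf), ← hf]
    filter_upwards [Lp.coeFn_add k ((2 * P) • W (v : HSpace μ).d),
      Lp.coeFn_smul (2 * P) (W (v : HSpace μ).d), hW v, hg.opA_ae_eq hk] with x h1 h2 h3 h4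
    rw [h1, Pi.add_apply, h2, Pi.smul_apply, h3, h4, smul_eq_mul]
  · obtain ⟨k, f, hk, hf, hfm⟩ := hg.exists_masterOp (P := P) (hV.contDiff.of_le (by norm_num)) hW
      hφ hφc hu
    have h1 := hg.formL_eq_inner hW hk hf
    refine ⟨hg.mem_domL hk h1, ?_⟩
    rw [hg.negL_eq hS ⟨u, hg.mem_domL hk h1⟩ h1]
    exact hfm
  · refine Subtype.ext ?_
    rw [← hinv v, ← hinv v', hvv']
  -- Both f and the range of K have mean zero, hence so does M f = f - K(M f); only then does S(M f)
  -- solve A[v] = M f without a correction by the mean.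
  · have h0 : ∫ x, M f.fn x ∂μ = 0 := by
      have h1 := congrArg (inner ℝ ((memLp_const (1 : ℝ)).toLp _ : Lp ℝ 2 μ)) (hM2 f.fn)
      rwa [inner_add_right, hKapp, real_inner_smul_right, inner_one_eq_integral,
        inner_one_eq_integral, inner_one_eq_integral, HSpace.integral_fn,
        integral_congr_ae (hW _), hg.integral_opW, mul_zero, add_zero] at h1
    have hk := hS.representsA hg h0
    have h1 := hg.formL_eq_inner hW hk (hM2 f.fn)
    exact ⟨⟨_, hg.mem_domL hk h1⟩, hg.negL_eq hS _ h1⟩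
  · change inner ℝ (S (M f.fn)) g = inner ℝ f (S (M g.fn))
    rw [hS, hM4, real_inner_comm (S (M g.fn)) f, hS, real_inner_comm]
  · change 0 < inner ℝ (S (M f.fn)) f
    rw [hS]
    exact hM5 _ fun h0 => hf (hg.eq_of_fn_eq (v := 0) h0)
  · change ‖S (M f.fn)‖ ≤ _
    rw [inv_inv]
    -- One factor ‖T‖ comes from the adjoint and one from the embedding, while M costs nothing; ‖T‖²
    -- is the inverse of the smallest eigenvalue.
    calc ‖S (M f.fn)‖ ≤ ‖T‖ * ‖M f.fn‖ := norm_le_of_adjoint hS' _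
      _ ≤ ‖T‖ * (‖T‖ * ‖f‖) :=
        mul_le_mul_of_nonneg_left ((hM3 _).trans (T.le_opNorm f)) T.opNorm_nonneg
      _ = ‖T‖ ^ 2 * ‖f‖ := by ring
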